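/- Let $d\in\{1,2\}$, $s\ge 0$, $t_0>\frac d2$. Write $\langle\xi\rangle=(1+|\xi|^2)^{1/2}$, $|f|_{H^s}=|\langle \mathrm D\rangle^s f|_{L^2}$, $\mathrm D=-i\nabla$. For $\mu,\beta\in[0,1]$ and $b\in C_c^\infty(\mathbb R^d)$ real-valued, define the symbols $$L_1(X,\xi)=-\frac1\beta\,\frac{\sinh(\beta b(X)\sqrt\mu|\xi|)\,\mathrm{sech}(\sqrt\mu|\xi|)}{\sqrt\mu|\xi|},\qquad L_2(X,\xi)=-\frac{L_1(X,\xi)+b(X)}{\mu|\xi|^2},$$ $$L_3(X,\xi)=-\frac{\cosh(\beta b(X)\sqrt\mu|\xi|)\,\mathrm{sech}(\sqrt\mu|\xi|)-1}{\mu|\xi|^2},$$ each extended by its limit where $\beta=0$, $\mu=0$ or $\xi=0$. For $u\in\mathscr S(\mathbb R^d)$ let $\mathcal L_i^\mu[\beta b]u(X)=\mathcal F^{-1}\big(L_i(X,\xi)\hat u(\xi)\big)(X)$. Let $\mathrm F_3=\mathrm{sech}(\sqrt\mu|\mathrm D|)$ and $\mathrm F_4=\frac{2}{\mu|\mathrm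 D|^2}(1-\mathrm F_3)$ be the Fourier multipliers with symbols extended in the same way. (i) Let $b\in C^\infty_c(\mathbb R^d)$ and $h_{b,\min}\in(0,1)$. Then $L_1,L_2,L_3$ belong to $S^0$ uniformly in $\mu$ and $\beta$: they are smooth on $\mathbb R^d\times\mathbb R^d$, and for all multi-indices $\alpha,\gamma$ there is a constant $K_{\alpha,\gamma}$ such that $$|\partial_X^\alpha\partial_\xi^\gamma L_i(X,\xi)|\le K_{\alpha,\gamma}\langle\xi\rangle^{-|\gamma|}$$ for $i=1,2,3$, all $X,\xi$, and all $\mu,\beta\in[0,1]$ with $\beta|b|\le 1-h_{b,\min}$ on $\mathbb R^d$. (ii) There is a positive function $C$, non-decreasing in both arguments and depending only on $d,s,t_0$, such that for all $b\in C_c^\infty(\mathbb R^d)$, $h_{b,\min}\in(0,1)$ and $\mu,\beta\in[0,1]$ with $\beta|b|\le 1-h_{b,\min}$ on $\mathbb R^d$, setting $M(s)=C\big(\tfrac1{h_{b,\min}},|b|_{H^{\max\{t_0+2,s\}}}\big)$, the operators $\mathcal L_1^\mu[\beta b],\mathcal L_2^\mu[\beta b],\mathcal L_3^\mu[\beta b]$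 extend from $\mathscr S(\mathbb R^d)$ to bounded operators on $L^2(\mathbb R^d)$ which map $H^s(\mathbb R^d)$ to itself with norm at most $M(s)$, and for every $u\in\mathscr S(\mathbb R^d)$ $$|\mathcal L_i^\mu[\beta b]u|_{H^s}\le M(s)|u|_{H^s}\quad(i=1,2,3),$$ $$|\mathcal L_1^\mu[\beta b]u+bu|_{H^s}\le \mu M(s)|u|_{H^{s+2}},$$ $$\Big|\mathcal L_1^\mu[\beta b]u-\Big(-b-\frac{\mu\beta^2}{6}b^3|\mathrm D|^2\Big)\mathrm F_3u\Big|_{H^s}\le\mu^2\beta^4M(s)|u|_{H^{s+4}},$$ $$\Big|\mathcal L_2^\mu[\beta b]u-\Big(-\frac12 b\,\mathrm F_4+\frac{\beta^2}{6}b^3\mathrm F_3\Big)u\Big|_{H^s}\le\mu\beta^4M(s)|u|_{H^{s+2}}.$$ -/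

import Mathlib

open MeasureTheory FourierTransform
open scoped SchwartzMap ENNReal ContDiff

noncomputable section

/-- The horizontal space, of dimension `d`, with its Euclidean norm. -/
abbrev HorizSpace (d : ℕ) : Type := EuclideanSpace ℝ (Fin d)

namespace WaterWaves

/-! ### Sobolev norms -/

/-- The `H^s` norm (`s ≥ 0`) of a function: the `L²` norm of `(1 + |D|²)^(s/2) f`, computed on the
Fourier side by Plancherel. Since `H^s ⊆ L²` for `s ≥ 0`, it is `∞` when `f` is not in `L²`.
In Mathlib's normalisation of the Fourier transform the frequency of `D` is `2πη`. -/
def sobolevNorm {d : ℕ} (s : ℝ) (f : HorizSpace d → ℂ) : ℝ≥0∞ :=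
  open Classical in
  if hf : MemLp f 2 (volume : Measure (HorizSpace d)) then
    eLpNorm (fun η : HorizSpace d =>
      (((1 + ‖(2 * Real.pi) • η‖ ^ 2) ^ (s / 2) : ℝ) : ℂ) *
        (𝓕 (hf.toLp f) : Lp ℂ 2 (volume : Measure (HorizSpace d))) η) 2 volume
  else ∞

/-! ### Symbols and pseudo-differential operators -/

/-- `L ∈ S^m`, with constants `K k l`: `L` is smooth on `ℝ^d × ℝ^d`, and all derivatives of order
`k` in `X` and order `l` in `ξ` are bounded by `K k l * ⟨ξ⟩^(m - l)`. -/
def IsSymbolWith {d : ℕ} (m : ℝ) (K : ℕ → ℕ → ℝ) (L : HorizSpace d → HorizSpace d → ℝ) : Prop :=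
  ContDiff ℝ ∞ (fun p : HorizSpace d × HorizSpace d => L p.1 p.2) ∧
    ∀ (k l : ℕ) (X ξ : HorizSpace d),
      ‖iteratedFDeriv ℝ k (fun Y : HorizSpace d => iteratedFDeriv ℝ l (fun ζ : HorizSpace d => L Y ζ) ξ) X‖
        ≤ K k l * (1 + ‖ξ‖ ^ 2) ^ ((m - l) / 2)

/-- `L[X, D] u (X) = 𝓕⁻¹ (L(X, ξ) û(ξ)) (X)`. In Mathlib's normalisation of the Fourier transform,
`ξ = 2πη` where `η` is the Fourier variable. -/
def pseudoOp {d : ℕ} (L : HorizSpace d → HorizSpace d → ℝ) (u : 𝓢(HorizSpace d, ℂ)) (X : HorizSpace d) : ℂ :=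
  𝓕⁻ (fun η : HorizSpace d =>
    (L X ((2 * Real.pi) • η) : ℂ) * (𝓕 u : 𝓢(HorizSpace d, ℂ)) η) X

/-- The Fourier multiplier `F(D)`. -/
def fourierMult {d : ℕ} (F : HorizSpace d → ℝ) (u : 𝓢(HorizSpace d, ℂ)) : HorizSpace d → ℂ :=
  pseudoOp (fun _ => F) u

/-- The operator with symbol `L`, given on Schwartz functions, extends to a bounded operator on
`L²` that maps `H^s` to `H^s` with norm at most `M`. -/
def ExtendsBoundedly {d : ℕ} (s : ℝ) (M : ℝ) (L : HorizSpace d → HorizSpace d → ℝ) : Prop :=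
  ∃ T : Lp ℂ 2 (volume : Measure (HorizSpace d)) →L[ℂ] Lp ℂ 2 (volume : Measure (HorizSpace d)),
    (∀ u : 𝓢(HorizSpace d, ℂ), T (u.toLp 2) =ᵐ[volume] pseudoOp L u) ∧
      ∀ f : Lp ℂ 2 (volume : Measure (HorizSpace d)),
        sobolevNorm s (T f) ≤ ENNReal.ofReal M * sobolevNorm s f

/-! ### The particular symbols -/

/-- Hyperbolic secant. -/
def sech (x : ℝ) : ℝ := 1 / Real.cosh x

/-- `sinh y / y`, with its limit `1` at `y = 0`. -/
def sinhc (y : ℝ) : ℝ := if y = 0 then 1 else Real.sinh y / y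

variable {d : ℕ}

/-- `F₃ = sech(√μ|ξ|)`. -/
def symF3 (μ : ℝ) (ξ : HorizSpace d) : ℝ := sech (√μ * ‖ξ‖)

/-- `F₄ = 2 / (μ|ξ|²) * (1 - F₃)`, with its limit `1` where `μ|ξ|² = 0`. -/
def symF4 (μ : ℝ) (ξ : HorizSpace d) : ℝ :=
  if μ * ‖ξ‖ ^ 2 = 0 then 1 else 2 / (μ * ‖ξ‖ ^ 2) * (1 - symF3 μ ξ)

/-- `L₁ = -(1/β) sinh(β b(X) √μ|ξ|) sech(√μ|ξ|) / (√μ|ξ|)`, written so that it takes its limit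
value where `β = 0` or `√μ|ξ| = 0`; see `symL1_eq`. -/
def symL1 (μ β : ℝ) (b : HorizSpace d → ℝ) (X ξ : HorizSpace d) : ℝ :=
  -(b X * sinhc (β * b X * (√μ * ‖ξ‖)) * sech (√μ * ‖ξ‖))

/-- `L₂ = -(L₁ + b(X)) / (μ|ξ|²)`, with its limit where `μ|ξ|² = 0`. -/
def symL2 (μ β : ℝ) (b : HorizSpace d → ℝ) (X ξ : HorizSpace d) : ℝ :=
  if μ * ‖ξ‖ ^ 2 = 0 then β ^ 2 / 6 * b X ^ 3 - b X / 2
  else -(symL1 μ β b X ξ + b X) * (1 / (μ * ‖ξ‖ ^ 2))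

/-- `L₃ = -(cosh(β b(X) √μ|ξ|) sech(√μ|ξ|) - 1) / (μ|ξ|²)`, with its limit where `μ|ξ|² = 0`. -/
def symL3 (μ β : ℝ) (b : HorizSpace d → ℝ) (X ξ : HorizSpace d) : ℝ :=
  if μ * ‖ξ‖ ^ 2 = 0 then (1 - (β * b X) ^ 2) / 2
  else -(Real.cosh (β * b X * (√μ * ‖ξ‖)) * sech (√μ * ‖ξ‖) - 1) * (1 / (μ * ‖ξ‖ ^ 2))

theorem symL1_eq (μ β : ℝ) (b : HorizSpace d → ℝ) (X ξ : HorizSpace d) (hβ : β ≠ 0)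
    (hx : √μ * ‖ξ‖ ≠ 0) :
    symL1 μ β b X ξ =
      -(1 / β) * Real.sinh (β * b X * (√μ * ‖ξ‖)) * sech (√μ * ‖ξ‖) * (1 / (√μ * ‖ξ‖)) := by
  unfold symL1 sinhc
  by_cases hb : b X = 0
  · simp [hb]
  · rw [if_neg (mul_ne_zero (mul_ne_zero hβ hb) hx)]
    generalize √μ * ‖ξ‖ = x at hx
    field_simp

end WaterWaves

end

/-!
Put `z = μ|ξ|²`, `a = βb` and `S_p(w) = ∑ wᵏ / (2k + p)!`, so that `S₀(r²) = cosh r`,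
`S₁(r²) = sinh r / r` and `S_p(w) = 1 / p! + w S_{p+2}(w)`. Each of the symbols is of the form
`(e₀(X) S₂(z) + e(X) a(X)^(2j) S_p(a(X)² z)) / S₀(z)`. Expanding `S_p` gives a series
`e₀(X) H(z) + ∑ₙ e(X) a(X)^(2(n+j)) G_{p,n}(z)` of products of a function of `X` and a radial Fourier
multiplier, where `H = S₂ / S₀` and `G_{p,n}(z) = zⁿ / (2n+p)! / S₀(z)`. The factorials are absorbed
by `S₀`: all these multipliers are at most one on `[0, ∞)`, and since `|a| ≤ 1 - hmin < 1` the powers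
of `a` make the series converge.

*Symbols of order zero.* The `i`-th derivatives of `H` and `G_{p,n}` are at most `(1 + z)⁻ⁱ` times a
constant polynomial in `n`, so that Faà di Bruno's formula bounds the multipliers in `S⁰` uniformly in
`μ`; the derivatives of `aᴺ` are at most a polynomial in `N` times `(1 - hmin)ᴺ`. The series is then
differentiated term by term (`isSymbolWith_tsum`, `exists_isSymbolWith_symL`).

*Bounds on `H^s`.* The series also converges in operator norm, on `L²` and on `H^s`. Fourier multipliers
bounded by one have norm at most one on `H^s`, so everything rests on the operators of multiplication
by `aⁿ`: their norms on `H^s` have to decay geometrically, with constants depending on `a` only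
through its supremum `ρ < 1` and its norm in `H^σ`, `σ = max (t₀ + 2) s`. Multiplication by `m` has
norm at most `C |m|_{H^σ}` (`exists_sobolevBound_mulOp`). As `σ > d`, interpolation between `L²` and
`H^σ` gives `|m²|²_{H^σ} ≤ C |m|_{L²} |m|³_{H^σ}`
(`exists_sq_sobolevNorm_schwartzMul_self_le`). Iterated over the squares `a^(2ᵏ)`, whose `L²` norms
are of size `ρ^(2ᵏ)`, it shows that `|a^(2ᵏ)|_{H^σ}` is at most `Y^((3/2)ᵏ) ρ^(2ᵏ)`, and
`(3/2)ᵏ` is negligible against `2ᵏ`: the spectral radius of `a` is at most `ρ`, quantitatively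
(`exists_sobolevBound_mulOp_pow`).

*Remainders.* By the recursion for `S_p`, the remainders are exactly `-μ|ξ|² L₂`, `-μ²β⁴|ξ|⁴ Q` and
`μβ⁴|ξ|² Q`, where `Q = b⁵ S₅(a² z) / S₀(z)` is of the same form as the symbols, so that its operator
is bounded on `H^s`; the powers of `|ξ|` fall on `u` (`sobolevNorm_pseudoOp_norm_pow_mul_le`).
-/

namespace WaterWaves

/-! ### Power series with rapidly decreasing coefficients -/

/-- Nonnegative coefficients with `(k + 1) a_{k+1} ≤ a_k`. The class is stable under the
differentiation of power series, and differentiation decreases the coefficients. -/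
structure DerivDecreasing (a : ℕ → ℝ) : Prop where
  nonneg : ∀ k, 0 ≤ a k
  succ_le : ∀ k, (k + 1) * a (k + 1) ≤ a k

/-- The coefficients of the derivative of a power series. -/
def derivCoeff (a : ℕ → ℝ) (k : ℕ) : ℝ := (k + 1) * a (k + 1)

/-- The sum of the power series with coefficients `a`. -/
noncomputable def powSum (a : ℕ → ℝ) (z : ℝ) : ℝ := ∑' k, a k * z ^ k

theorem DerivDecreasing.derivCoeff {a : ℕ → ℝ} (h : DerivDecreasing a) :
    DerivDecreasing (derivCoeff a) where
  nonneg k := mul_nonneg (by positivity) (h.nonneg _)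
  succ_le k := by
    have := h.succ_le (k + 1)
    unfold WaterWaves.derivCoeff
    push_cast at this ⊢
    exact mul_le_mul_of_nonneg_left this (by positivity)

theorem DerivDecreasing.le_div_factorial {a : ℕ → ℝ} (h : DerivDecreasing a) (k : ℕ) :
    a k ≤ a 0 / k.factorial := by
  induction k with
  | zero => simp
  | succ k ih =>
    rw [Nat.factorial_succ, le_div_iff₀ (by positivity)]
    rw [le_div_iff₀ (by positivity)] at ih
    push_cast
    calc a (k + 1) * ((k + 1) * k.factorial) = ((k + 1) * a (k + 1)) * k.factorial := by ring
      _ ≤ a k * k.factorial := by gcongr; exact h.succ_le k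
      _ ≤ a 0 := ih

theorem DerivDecreasing.summable {a : ℕ → ℝ} (h : DerivDecreasing a) (z : ℝ) :
    Summable fun k => a k * z ^ k := by
  refine .of_norm_bounded ((Real.summable_pow_div_factorial |z|).mul_left (a 0)) fun k => ?_
  rw [norm_mul, norm_pow, Real.norm_of_nonneg (h.nonneg k), Real.norm_eq_abs]
  calc a k * |z| ^ k ≤ a 0 / k.factorial * |z| ^ k := by gcongr; exact h.le_div_factorial k
    _ = _ := by ring

theorem DerivDecreasing.summable_deriv {a : ℕ → ℝ} (h : DerivDecreasing a) (z : ℝ) :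
    Summable fun k : ℕ => a k * (k * z ^ (k - 1)) := by
  refine (summable_nat_add_iff 1).1 ((h.derivCoeff.summable z).congr fun k => ?_)
  unfold WaterWaves.derivCoeff
  rw [Nat.add_sub_cancel]
  push_cast
  ring

theorem DerivDecreasing.hasDerivAt {a : ℕ → ℝ} (h : DerivDecreasing a) (z : ℝ) :
    HasDerivAt (powSum a) (powSum (WaterWaves.derivCoeff a) z) z := by
  set R := |z| + 1
  have hR : 0 < R := by positivity
  have key : HasDerivAt (powSum a) (∑' k, a k * (k * z ^ (k - 1))) z := by
    refine hasDerivAt_tsum_of_isPreconnected (g := fun k z => a k * z ^ k)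
      (g' := fun k z => a k * (k * z ^ (k - 1)))
      (t := Metric.ball 0 R) (y₀ := 0) (h.summable_deriv R) Metric.isOpen_ball
      (convex_ball 0 R).isPreconnected (fun k y _ => ?_) (fun k y hy => ?_)
      (Metric.mem_ball_self hR) (h.summable 0) ?_
    · exact (hasDerivAt_pow k y).const_mul (a k)
    · rw [mem_ball_zero_iff, Real.norm_eq_abs] at hy
      rw [norm_mul, norm_mul, norm_pow, Real.norm_of_nonneg (h.nonneg k), Real.norm_eq_abs,
        Real.norm_eq_abs, Nat.abs_cast]
      have := h.nonneg k
      gcongr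
    · rw [mem_ball_zero_iff, Real.norm_eq_abs]
      exact lt_add_one _
  convert! key using 1
  rw [(h.summable_deriv z).tsum_eq_zero_add]
  unfold powSum WaterWaves.derivCoeff
  simp only [Nat.cast_zero, zero_mul, mul_zero, zero_add]
  refine tsum_congr fun k => ?_
  rw [Nat.add_sub_cancel]
  push_cast
  ring

theorem DerivDecreasing.contDiff {a : ℕ → ℝ} (h : DerivDecreasing a) :
    ContDiff ℝ ∞ (powSum a) := by
  rw [contDiff_infty]
  intro n
  induction n generalizing a with
  | zero =>
    exact contDiff_zero.2 (Differentiable.continuous fun z => (h.hasDerivAt z).differentiableAt)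
  | succ n ih =>
    push_cast
    rw [contDiff_succ_iff_deriv]
    refine ⟨fun z => (h.hasDerivAt z).differentiableAt, by simp, ?_⟩
    have : deriv (powSum a) = powSum (WaterWaves.derivCoeff a) :=
      funext fun z => (h.hasDerivAt z).deriv
    rw [this]
    exact ih h.derivCoeff

theorem DerivDecreasing.powSum_mono {a b : ℕ → ℝ} (ha : DerivDecreasing a)
    (hb : DerivDecreasing b) (hab : ∀ k, a k ≤ b k) {z : ℝ} (hz : 0 ≤ z) :
    powSum a z ≤ powSum b z :=
  (ha.summable z).tsum_le_tsum (fun k => by have := hab k; gcongr) (hb.summable z)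

theorem DerivDecreasing.powSum_nonneg {a : ℕ → ℝ} (ha : DerivDecreasing a) {z : ℝ}
    (hz : 0 ≤ z) : 0 ≤ powSum a z :=
  tsum_nonneg fun k => mul_nonneg (ha.nonneg k) (by positivity)

/-- On `[0, ∞)` every derivative of the power series is dominated by the series itself. -/
theorem DerivDecreasing.abs_iteratedDeriv_le {a : ℕ → ℝ} (h : DerivDecreasing a) (i : ℕ) {z : ℝ}
    (hz : 0 ≤ z) : |iteratedDeriv i (powSum a) z| ≤ powSum a z := by
  induction i generalizing a with
  | zero => rw [iteratedDeriv_zero, abs_of_nonneg (h.powSum_nonneg hz)]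
  | succ i ih =>
    have : deriv (powSum a) = powSum (WaterWaves.derivCoeff a) :=
      funext fun z => (h.hasDerivAt z).deriv
    rw [iteratedDeriv_succ', this]
    exact (ih h.derivCoeff).trans (h.derivCoeff.powSum_mono h h.succ_le hz)

/-! ### The series `∑ z ^ k / (2k + p)!` -/

/-- The coefficients `1 / (2k + p)!`. -/
noncomputable def evenCoeff (p k : ℕ) : ℝ := 1 / (2 * k + p).factorial

/-- `S_p(z) = ∑ z ^ k / (2k + p)!`. For `z = r²` this is `cosh r` when `p = 0` and `sinh r / r` when
`p = 1`; larger `p` give the Taylor remainders of these two functions. -/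
noncomputable def evenSeries (p : ℕ) (z : ℝ) : ℝ := powSum (evenCoeff p) z

theorem derivDecreasing_evenCoeff (p : ℕ) : DerivDecreasing (evenCoeff p) where
  nonneg k := by unfold evenCoeff; positivity
  succ_le k := by
    unfold evenCoeff
    rw [show 2 * (k + 1) + p = 2 * k + p + 1 + 1 by ring, Nat.factorial_succ, Nat.factorial_succ,
      mul_one_div, div_le_div_iff₀ (by positivity) (by positivity), one_mul]
    push_cast
    rw [← mul_assoc]
    gcongr
    have : (0 : ℝ) ≤ k := by positivity
    have : (0 : ℝ) ≤ p := by positivity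
    nlinarith

theorem evenSeries_eq_add_mul (p : ℕ) (z : ℝ) :
    evenSeries p z = 1 / p.factorial + z * evenSeries (p + 2) z := by
  unfold evenSeries powSum
  rw [((derivDecreasing_evenCoeff p).summable z).tsum_eq_zero_add, ← tsum_mul_left]
  congr 1
  · simp [evenCoeff]
  · refine tsum_congr fun k => ?_
    rw [evenCoeff, evenCoeff, show 2 * (k + 1) + p = 2 * k + (p + 2) by ring]
    ring

theorem evenSeries_zero_right (p : ℕ) : evenSeries p 0 = 1 / p.factorial := by
  rw [evenSeries_eq_add_mul]; simp

theorem evenSeries_nonneg (p : ℕ) {z : ℝ} (hz : 0 ≤ z) : 0 ≤ evenSeries p z :=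
  (derivDecreasing_evenCoeff p).powSum_nonneg hz

theorem one_le_evenSeries_zero {z : ℝ} (hz : 0 ≤ z) : 1 ≤ evenSeries 0 z := by
  rw [evenSeries_eq_add_mul]
  have := mul_nonneg hz (evenSeries_nonneg 2 hz)
  simpa using this

theorem evenSeries_le_zero (p : ℕ) {z : ℝ} (hz : 0 ≤ z) : evenSeries p z ≤ evenSeries 0 z := by
  refine (derivDecreasing_evenCoeff p).powSum_mono (derivDecreasing_evenCoeff 0) (fun k => ?_) hz
  unfold evenCoeff
  gcongr
  omega

theorem pow_le_factorial_mul_evenSeries (n : ℕ) {z : ℝ} (hz : 0 ≤ z) :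
    z ^ n ≤ (2 * n).factorial * evenSeries 0 z := by
  have h := ((derivDecreasing_evenCoeff 0).summable z).le_tsum n
    (fun k _ => mul_nonneg ((derivDecreasing_evenCoeff 0).nonneg k) (by positivity))
  unfold evenCoeff at h
  rw [add_zero, one_div, inv_mul_le_iff₀ (by positivity)] at h
  exact h

theorem evenSeries_zero_sq (r : ℝ) : evenSeries 0 (r ^ 2) = Real.cosh r := by
  rw [Real.cosh_eq_tsum]
  refine tsum_congr fun k => ?_
  rw [evenCoeff, ← pow_mul, add_zero]
  ring

theorem evenSeries_one_sq (r : ℝ) : evenSeries 1 (r ^ 2) = sinhc r := by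
  unfold sinhc
  split_ifs with h
  · simp [h, evenSeries_zero_right]
  · rw [eq_div_iff h, Real.sinh_eq_tsum, evenSeries, powSum, ← tsum_mul_right]
    refine tsum_congr fun k => ?_
    rw [evenCoeff, ← pow_mul]
    ring

/-! ### Derivatives of the reciprocal of `S₀` -/

/-- The open set on which `S₀` does not vanish; it contains `[0, ∞)`. -/
def evenSeriesDomain : Set ℝ := {z | evenSeries 0 z ≠ 0}

theorem contDiff_evenSeries (p : ℕ) : ContDiff ℝ ∞ (evenSeries p) :=
  (derivDecreasing_evenCoeff p).contDiff

theorem isOpen_evenSeriesDomain : IsOpen evenSeriesDomain :=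
  isOpen_ne_fun (contDiff_evenSeries 0).continuous continuous_const

theorem mem_evenSeriesDomain {z : ℝ} (hz : 0 ≤ z) : z ∈ evenSeriesDomain :=
  (zero_lt_one.trans_le (one_le_evenSeries_zero hz)).ne'

theorem contDiffOn_inv_evenSeries :
    ContDiffOn ℝ ∞ (fun z => (evenSeries 0 z)⁻¹) evenSeriesDomain :=
  (contDiff_evenSeries 0).contDiffOn.inv fun _ hz => hz

theorem contDiffAt_inv_evenSeries {z : ℝ} (hz : 0 ≤ z) (n : ℕ) :
    ContDiffAt ℝ n (fun z => (evenSeries 0 z)⁻¹) z :=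
  ((contDiffOn_inv_evenSeries.contDiffAt
    (isOpen_evenSeriesDomain.mem_nhds (mem_evenSeriesDomain hz)))).of_le (mod_cast le_top)

theorem contDiffAt_evenSeries (p : ℕ) (z : ℝ) (n : ℕ) : ContDiffAt ℝ n (evenSeries p) z :=
  ((contDiff_evenSeries p).of_le (mod_cast le_top)).contDiffAt

theorem abs_iteratedDeriv_evenSeries_le (p i : ℕ) {z : ℝ} (hz : 0 ≤ z) :
    |iteratedDeriv i (evenSeries p) z| ≤ evenSeries p z :=
  (derivDecreasing_evenCoeff p).abs_iteratedDeriv_le i hz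

/-- The derivatives of `1 / S₀` are `O(1 / S₀)` on `[0, ∞)`, by differentiating
`S₀ * (1 / S₀) = 1`. -/
theorem exists_abs_iteratedDeriv_inv_evenSeries_le (i : ℕ) :
    ∃ C : ℝ, 0 ≤ C ∧ ∀ j ≤ i, ∀ z : ℝ, 0 ≤ z →
      |iteratedDeriv j (fun z => (evenSeries 0 z)⁻¹) z| ≤ C * (evenSeries 0 z)⁻¹ := by
  induction i with
  | zero =>
    refine ⟨1, zero_le_one, fun j hj z hz => ?_⟩
    obtain rfl : j = 0 := by omega
    rw [iteratedDeriv_zero, one_mul, abs_of_nonneg]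
    exact inv_nonneg.2 (evenSeries_nonneg 0 hz)
  | succ i ih =>
    obtain ⟨C, hC0, hC⟩ := ih
    set C' := ∑ m ∈ Finset.range (i + 1), ((i + 1).choose (m + 1) : ℝ) * C with hC'
    have hC'0 : 0 ≤ C' := Finset.sum_nonneg fun m _ => by positivity
    refine ⟨C + C', by positivity, fun j hj z hz => ?_⟩
    have hpos : 0 < evenSeries 0 z := zero_lt_one.trans_le (one_le_evenSeries_zero hz)
    rcases Nat.lt_or_ge j (i + 1) with hlt | hge
    · refine (hC j (by omega) z hz).trans ?_
      gcongr
      linarith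
    obtain rfl : j = i + 1 := by omega
    have hprod : (evenSeries 0 * fun z => (evenSeries 0 z)⁻¹) =ᶠ[nhds z] fun _ => (1 : ℝ) := by
      filter_upwards [isOpen_evenSeriesDomain.mem_nhds (mem_evenSeriesDomain hz)] with w hw
      exact mul_inv_cancel₀ hw
    have h0 := hprod.iteratedDeriv_eq (i + 1)
    rw [iteratedDeriv_mul (contDiffAt_evenSeries 0 z _) (contDiffAt_inv_evenSeries hz _),
      Finset.sum_range_succ', iteratedDeriv_const] at h0
    simp only [Nat.choose_zero_right, Nat.cast_one, one_mul, iteratedDeriv_zero, tsub_zero,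
      Nat.add_eq_zero_iff, one_ne_zero, and_false, if_false] at h0
    have h1 : evenSeries 0 z * |iteratedDeriv (i + 1) (fun z => (evenSeries 0 z)⁻¹) z| ≤ C' := by
      nth_rw 1 [← abs_of_pos hpos]
      rw [← abs_mul, eq_neg_of_add_eq_zero_right h0, abs_neg]
      refine (Finset.abs_sum_le_sum_abs _ _).trans (Finset.sum_le_sum fun m hm => ?_)
      rw [abs_mul, abs_mul, Nat.abs_cast, mul_assoc]
      gcongr
      calc |iteratedDeriv (m + 1) (evenSeries 0) z| *
            |iteratedDeriv (i + 1 - (m + 1)) (fun z => (evenSeries 0 z)⁻¹) z|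
          ≤ evenSeries 0 z * (C * (evenSeries 0 z)⁻¹) := by
            gcongr
            · exact abs_iteratedDeriv_evenSeries_le 0 _ hz
            · exact hC _ (by omega) z hz
        _ = C := by field_simp
    calc _ ≤ C' * (evenSeries 0 z)⁻¹ := by
          rw [← div_eq_mul_inv, le_div_iff₀ hpos, mul_comm]
          exact h1
      _ ≤ _ := by gcongr; linarith

/-! ### The frequency profiles of the expansion -/

/-- `H(z) = S₂(z) / S₀(z)`; for `z = r²` this is `(1 - sech r) / r²`. -/
noncomputable def profileH (z : ℝ) : ℝ := evenSeries 2 z * (evenSeries 0 z)⁻¹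

/-- `G_{p,n}(z) = z ^ n / (2n + p)! / S₀(z)`; for `z = r²` this is `r ^ (2n) sech r / (2n + p)!`. -/
noncomputable def profileG (p n : ℕ) (z : ℝ) : ℝ :=
  evenCoeff p n * (z ^ n * (evenSeries 0 z)⁻¹)

theorem contDiffOn_profileH : ContDiffOn ℝ ∞ profileH evenSeriesDomain :=
  (contDiff_evenSeries 2).contDiffOn.mul contDiffOn_inv_evenSeries

theorem contDiffOn_profileG (p n : ℕ) : ContDiffOn ℝ ∞ (profileG p n) evenSeriesDomain :=
  contDiffOn_const.mul ((contDiff_id.pow n).contDiffOn.mul contDiffOn_inv_evenSeries)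

theorem abs_profileH_le_one {z : ℝ} (hz : 0 ≤ z) : |profileH z| ≤ 1 := by
  have hpos : 0 < evenSeries 0 z := zero_lt_one.trans_le (one_le_evenSeries_zero hz)
  rw [profileH, abs_of_nonneg (mul_nonneg (evenSeries_nonneg 2 hz) (by positivity)),
    ← div_eq_mul_inv, div_le_one hpos]
  exact evenSeries_le_zero 2 hz

theorem evenCoeff_mul_factorial_le (p n : ℕ) : evenCoeff p n * (2 * n).factorial ≤ 1 := by
  rw [evenCoeff, one_div, inv_mul_le_iff₀ (by positivity), mul_one]
  exact_mod_cast Nat.factorial_le (by omega)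

theorem abs_profileG_le_one (p n : ℕ) {z : ℝ} (hz : 0 ≤ z) : |profileG p n z| ≤ 1 := by
  have hpos : 0 < evenSeries 0 z := zero_lt_one.trans_le (one_le_evenSeries_zero hz)
  have hc := (derivDecreasing_evenCoeff p).nonneg n
  rw [profileG, abs_of_nonneg (by positivity)]
  calc evenCoeff p n * (z ^ n * (evenSeries 0 z)⁻¹)
      ≤ evenCoeff p n * (((2 * n).factorial * evenSeries 0 z) * (evenSeries 0 z)⁻¹) := by
        gcongr; exact pow_le_factorial_mul_evenSeries n hz
    _ = evenCoeff p n * (2 * n).factorial := by field_simp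
    _ ≤ 1 := evenCoeff_mul_factorial_le p n

theorem one_add_pow_le (j : ℕ) {z : ℝ} (hz : 0 ≤ z) : (1 + z) ^ j ≤ 2 ^ j * (1 + z ^ j) := by
  rcases le_total z 1 with h | h
  · calc (1 + z) ^ j ≤ 2 ^ j := by gcongr; linarith
      _ ≤ 2 ^ j * (1 + z ^ j) := le_mul_of_one_le_right (by positivity) (by
        have : 0 ≤ z ^ j := by positivity
        linarith)
  · calc (1 + z) ^ j ≤ (2 * z) ^ j := by gcongr; linarith
      _ = 2 ^ j * z ^ j := by ring
      _ ≤ _ := by gcongr; linarith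

/-- Multiplication of `z ^ N` by a power of `1 + z` costs only a polynomial in `n`: the quotient
`(2n + 2j)! / (2n)!` is at most `(2n + 2j) ^ (2j)`. -/
theorem pow_mul_one_add_pow_le (N n j : ℕ) (hN : N ≤ n) {z : ℝ} (hz : 0 ≤ z) :
    z ^ N * (1 + z) ^ j ≤
      2 ^ j * (2 * ((2 * j + 2) * (n + 1)) ^ (2 * j)) * ((2 * n).factorial * evenSeries 0 z) := by
  have hS : 0 ≤ evenSeries 0 z := evenSeries_nonneg 0 hz
  have hbase : (1 : ℝ) ≤ (2 * j + 2) * (n + 1) := by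
    have : (0 : ℝ) ≤ j := by positivity
    have : (0 : ℝ) ≤ n := by positivity
    nlinarith
  have h1 : z ^ N ≤ ((2 * j + 2) * (n + 1) : ℝ) ^ (2 * j) * ((2 * n).factorial * evenSeries 0 z) := by
    calc z ^ N ≤ (2 * N).factorial * evenSeries 0 z := pow_le_factorial_mul_evenSeries N hz
      _ ≤ (2 * n).factorial * evenSeries 0 z := by gcongr
      _ ≤ _ := le_mul_of_one_le_left (by positivity) (one_le_pow₀ hbase)
  have h2 : z ^ (N + j) ≤
      ((2 * j + 2) * (n + 1) : ℝ) ^ (2 * j) * ((2 * n).factorial * evenSeries 0 z) := by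
    have hfac : ((2 * (N + j)).factorial : ℝ) ≤
        ((2 * j + 2) * (n + 1) : ℝ) ^ (2 * j) * (2 * n).factorial := by
      have h3 : (2 * (N + j)).factorial ≤ (2 * n).factorial * ((2 * j + 2) * (n + 1)) ^ (2 * j) := by
        calc (2 * (N + j)).factorial ≤ (2 * n + 2 * j).factorial :=
              Nat.factorial_le (by omega)
          _ ≤ (2 * n).factorial * (2 * n + 2 * j) ^ (2 * j) := by
            rw [← Nat.factorial_mul_ascFactorial]
            gcongr
            exact Nat.ascFactorial_le_pow_add _ _
          _ ≤ _ := by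
            gcongr
            nlinarith
      calc ((2 * (N + j)).factorial : ℝ)
          ≤ ((2 * n).factorial * ((2 * j + 2) * (n + 1)) ^ (2 * j) : ℕ) := by exact_mod_cast h3
        _ = _ := by push_cast; ring
    calc z ^ (N + j) ≤ (2 * (N + j)).factorial * evenSeries 0 z :=
          pow_le_factorial_mul_evenSeries _ hz
      _ ≤ _ := by rw [← mul_assoc]; gcongr
  calc z ^ N * (1 + z) ^ j ≤ z ^ N * (2 ^ j * (1 + z ^ j)) := by
        gcongr; exact one_add_pow_le j hz
    _ = 2 ^ j * (z ^ N + z ^ (N + j)) := by ring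
    _ ≤ 2 ^ j * (((2 * j + 2) * (n + 1) : ℝ) ^ (2 * j) * ((2 * n).factorial * evenSeries 0 z) +
        ((2 * j + 2) * (n + 1) : ℝ) ^ (2 * j) * ((2 * n).factorial * evenSeries 0 z)) := by gcongr
    _ = _ := by ring

/-- Symbol-type bounds for the profiles `G_{p,n}`, of polynomial growth in `n`. The factorial in the
denominator absorbs `z ^ n` up to a factor `S₀`, also after multiplication by a fixed power
of `z`, which costs a polynomial in `n`. -/
theorem exists_abs_iteratedDeriv_profileG_le (j : ℕ) :
    ∃ B : ℝ, 0 ≤ B ∧ ∀ (p n : ℕ) (z : ℝ), 0 ≤ z →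
      |iteratedDeriv j (profileG p n) z| * (1 + z) ^ j ≤ B * (n + 1 : ℝ) ^ (3 * j) := by
  obtain ⟨C, hC0, hC⟩ := exists_abs_iteratedDeriv_inv_evenSeries_le j
  refine ⟨∑ i ∈ Finset.range (j + 1),
    (j.choose i : ℝ) * (C * (2 ^ j * (2 * (2 * j + 2) ^ (2 * j)))),
    Finset.sum_nonneg fun _ _ => by positivity, fun p n z hz => ?_⟩
  have hpos : 0 < evenSeries 0 z := zero_lt_one.trans_le (one_le_evenSeries_zero hz)
  have hpow : ContDiffAt ℝ j (fun z : ℝ => z ^ n) z := by fun_prop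
  have hd : iteratedDeriv j (profileG p n) z = evenCoeff p n *
      ∑ i ∈ Finset.range (j + 1), j.choose i * iteratedDeriv i (fun z => z ^ n) z *
        iteratedDeriv (j - i) (fun z => (evenSeries 0 z)⁻¹) z := by
    rw [← iteratedDeriv_mul hpow (contDiffAt_inv_evenSeries hz _)]
    exact iteratedDeriv_const_mul_field _ _
  have hc := (derivDecreasing_evenCoeff p).nonneg n
  rw [hd, abs_mul, abs_of_nonneg hc]
  calc evenCoeff p n * |∑ i ∈ Finset.range (j + 1), j.choose i * iteratedDeriv i (fun z => z ^ n) z *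
        iteratedDeriv (j - i) (fun z => (evenSeries 0 z)⁻¹) z| * (1 + z) ^ j
      ≤ evenCoeff p n * (∑ i ∈ Finset.range (j + 1), j.choose i *
          ((n + 1 : ℝ) ^ j * z ^ (n - i)) * (C * (evenSeries 0 z)⁻¹)) * (1 + z) ^ j := by
        gcongr
        refine (Finset.abs_sum_le_sum_abs _ _).trans (Finset.sum_le_sum fun i hi => ?_)
        rw [abs_mul, abs_mul, Nat.abs_cast, iteratedDeriv_pow]
        gcongr
        · rw [abs_of_nonneg (by positivity)]
          gcongr
          calc (n.descFactorial i : ℝ) ≤ (n : ℝ) ^ i := by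
                exact_mod_cast Nat.descFactorial_le_pow n i
            _ ≤ (n + 1 : ℝ) ^ i := by gcongr; linarith
            _ ≤ (n + 1 : ℝ) ^ j := by
              gcongr
              · linarith [(Nat.cast_nonneg n : (0 : ℝ) ≤ n)]
              · exact Nat.lt_succ_iff.1 (Finset.mem_range.1 hi)
        · exact hC _ (by omega) z hz
    _ = ∑ i ∈ Finset.range (j + 1), (j.choose i : ℝ) * (C * ((n + 1 : ℝ) ^ j *
          (evenCoeff p n * (evenSeries 0 z)⁻¹ * (z ^ (n - i) * (1 + z) ^ j)))) := by
        rw [Finset.mul_sum, Finset.sum_mul]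
        refine Finset.sum_congr rfl fun i _ => ?_
        ring
    _ ≤ ∑ i ∈ Finset.range (j + 1), (j.choose i : ℝ) * (C * ((n + 1 : ℝ) ^ j *
          (2 ^ j * (2 * ((2 * j + 2) * (n + 1)) ^ (2 * j))))) := by
        refine Finset.sum_le_sum fun i hi => ?_
        refine mul_le_mul_of_nonneg_left (mul_le_mul_of_nonneg_left
          (mul_le_mul_of_nonneg_left ?_ (by positivity)) hC0) (by positivity)
        calc evenCoeff p n * (evenSeries 0 z)⁻¹ * (z ^ (n - i) * (1 + z) ^ j)
            ≤ evenCoeff p n * (evenSeries 0 z)⁻¹ * (2 ^ j * (2 * ((2 * j + 2) * (n + 1)) ^ (2 * j)) *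
              ((2 * n).factorial * evenSeries 0 z)) := by
              exact mul_le_mul_of_nonneg_left
                (pow_mul_one_add_pow_le _ n j (Nat.sub_le _ _) hz) (by positivity)
          _ = (evenCoeff p n * (2 * n).factorial) *
              (2 ^ j * (2 * ((2 * j + 2) * (n + 1)) ^ (2 * j))) := by field_simp
          _ ≤ _ := mul_le_of_le_one_left (by positivity) (evenCoeff_mul_factorial_le p n)
    _ = _ := by
        rw [Finset.sum_mul]
        refine Finset.sum_congr rfl fun i _ => ?_
        rw [mul_pow (2 * (j : ℝ) + 2), show 3 * j = j + 2 * j by ring, pow_add]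
        ring

theorem contDiffAt_profileH {z : ℝ} (hz : 0 ≤ z) (n : ℕ) : ContDiffAt ℝ n profileH z :=
  (contDiffAt_evenSeries 2 z n).mul (contDiffAt_inv_evenSeries hz n)

/-- Differentiating `z * H = 1 - 1 / S₀` gives a recurrence for the derivatives of `H`. -/
theorem mul_iteratedDeriv_profileH (j : ℕ) {z : ℝ} (hz : 0 ≤ z) :
    z * iteratedDeriv (j + 1) profileH z = -(j + 1) * iteratedDeriv j profileH z -
      iteratedDeriv (j + 1) (fun z => (evenSeries 0 z)⁻¹) z := by
  have hprod : ((fun z => z) * profileH) =ᶠ[nhds z] fun z => 1 - (evenSeries 0 z)⁻¹ := by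
    filter_upwards [isOpen_evenSeriesDomain.mem_nhds (mem_evenSeriesDomain hz)] with w hw
    have h0 : evenSeries 0 w = 1 + w * evenSeries 2 w := by
      simpa using evenSeries_eq_add_mul 0 w
    have hw' : evenSeries 0 w ≠ 0 := hw
    simp only [Pi.mul_apply, profileH]
    field_simp
    linarith
  have h1 := hprod.iteratedDeriv_eq (j + 1)
  rw [iteratedDeriv_mul (by fun_prop) (contDiffAt_profileH hz _), Finset.sum_range_succ',
    Finset.sum_range_succ', Finset.sum_eq_zero] at h1
  · rw [iteratedDeriv_const_sub (by omega)] at h1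
    simp at h1
    linarith
  · intro i _
    have : iteratedDeriv (i + 1 + 1) (fun z : ℝ => z) z = 0 := by
      rw [iteratedDeriv_succ', iteratedDeriv_succ']
      simp
    rw [this]
    ring

/-- Decay of the derivatives of `H`: the recurrence gains one power of `1 + z` for each derivative. -/
theorem exists_abs_iteratedDeriv_profileH_mul_le (m : ℕ) :
    ∀ j, m ≤ j → ∃ B : ℝ, 0 ≤ B ∧ ∀ z : ℝ, 0 ≤ z →
      |iteratedDeriv j profileH z| * (1 + z) ^ m ≤ B := by
  induction m with
  | zero =>
    intro j _
    obtain ⟨C, hC0, hC⟩ := exists_abs_iteratedDeriv_inv_evenSeries_le j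
    refine ⟨∑ i ∈ Finset.range (j + 1), (j.choose i : ℝ) * C,
      Finset.sum_nonneg fun _ _ => by positivity, fun z hz => ?_⟩
    have hpos : 0 < evenSeries 0 z := zero_lt_one.trans_le (one_le_evenSeries_zero hz)
    have : profileH = evenSeries 2 * fun z => (evenSeries 0 z)⁻¹ := rfl
    rw [pow_zero, mul_one, this,
      iteratedDeriv_mul (contDiffAt_evenSeries 2 z _) (contDiffAt_inv_evenSeries hz _)]
    refine (Finset.abs_sum_le_sum_abs _ _).trans (Finset.sum_le_sum fun i _ => ?_)
    rw [abs_mul, abs_mul, Nat.abs_cast, mul_assoc]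
    gcongr
    calc _ ≤ evenSeries 0 z * (C * (evenSeries 0 z)⁻¹) := by
          gcongr
          · exact (abs_iteratedDeriv_evenSeries_le 2 i hz).trans (evenSeries_le_zero 2 hz)
          · exact hC _ (Nat.sub_le _ _) z hz
      _ = C := by field_simp
  | succ m ih =>
    intro j hj
    obtain ⟨j, rfl⟩ : ∃ i, j = i + 1 := ⟨j - 1, by omega⟩
    obtain ⟨B₁, hB₁, h₁⟩ := ih (j + 1) (by omega)
    obtain ⟨B₀, hB₀, h₀⟩ := ih j (by omega)
    obtain ⟨C, hC0, hC⟩ := exists_abs_iteratedDeriv_inv_evenSeries_le (j + 1)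
    refine ⟨B₁ + ((j + 1) * B₀ + C * (2 ^ m * (2 * ((2 * m + 2) * 1) ^ (2 * m)))), by positivity,
      fun z hz => ?_⟩
    have hpos : 0 < evenSeries 0 z := zero_lt_one.trans_le (one_le_evenSeries_zero hz)
    have hrec : |iteratedDeriv (j + 1) profileH z| * z ≤
        (j + 1) * |iteratedDeriv j profileH z| + C * (evenSeries 0 z)⁻¹ := by
      rw [mul_comm]
      nth_rw 1 [← abs_of_nonneg hz]
      rw [← abs_mul, mul_iteratedDeriv_profileH j hz]
      refine (abs_sub _ _).trans (add_le_add ?_ (hC _ le_rfl z hz))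
      rw [abs_mul, abs_neg, abs_of_nonneg (by positivity : (0 : ℝ) ≤ j + 1)]
    have hdec : (evenSeries 0 z)⁻¹ * (1 + z) ^ m ≤ 2 ^ m * (2 * ((2 * m + 2) * 1) ^ (2 * m)) := by
      have := pow_mul_one_add_pow_le 0 0 m le_rfl hz
      rw [inv_mul_le_iff₀ hpos]
      simpa [mul_comm] using this
    calc |iteratedDeriv (j + 1) profileH z| * (1 + z) ^ (m + 1)
        = |iteratedDeriv (j + 1) profileH z| * (1 + z) ^ m +
          (|iteratedDeriv (j + 1) profileH z| * z) * (1 + z) ^ m := by ring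
      _ ≤ B₁ + ((j + 1) * |iteratedDeriv j profileH z| + C * (evenSeries 0 z)⁻¹) * (1 + z) ^ m := by
          gcongr
          exact h₁ z hz
      _ = B₁ + ((j + 1) * (|iteratedDeriv j profileH z| * (1 + z) ^ m) +
          C * ((evenSeries 0 z)⁻¹ * (1 + z) ^ m)) := by ring
      _ ≤ _ := by
          gcongr
          exact h₀ z hz

/-! ### Radial symbols -/

theorem iteratedDeriv_comp_mul_left (c : ℝ) (f : ℝ → ℝ) (i : ℕ) :
    iteratedDeriv i (fun w => f (c * w)) = fun w => c ^ i * iteratedDeriv i f (c * w) := by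
  induction i with
  | zero => simp
  | succ i ih =>
    ext w
    rw [iteratedDeriv_succ, ih, deriv_const_mul_field, deriv_comp_mul_left c (iteratedDeriv i f),
      smul_eq_mul, iteratedDeriv_succ]
    ring

section

variable {E : Type*} [NormedAddCommGroup E] [InnerProductSpace ℝ E]

theorem norm_iteratedFDeriv_norm_sq_le_one (x : E) :
    ‖iteratedFDeriv ℝ 1 (fun x : E => ‖x‖ ^ 2) x‖ ≤ 2 * ‖x‖ := by
  rw [norm_iteratedFDeriv_one, fderiv_norm_sq_apply, ← Nat.cast_smul_eq_nsmul ℝ, norm_smul]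
  simp

theorem norm_iteratedFDeriv_norm_sq_le_two (x : E) :
    ‖iteratedFDeriv ℝ 2 (fun x : E => ‖x‖ ^ 2) x‖ ≤ 2 := by
  have h : fderiv ℝ (fun x : E => ‖x‖ ^ 2) = fun x => ((2 : ℕ) • innerSL ℝ : E →L[ℝ] E →L[ℝ] ℝ) x := by
    ext1 x
    rw [fderiv_norm_sq_apply]
    rfl
  rw [← norm_iteratedFDeriv_fderiv, norm_iteratedFDeriv_one, h, ContinuousLinearMap.fderiv,
    ← Nat.cast_smul_eq_nsmul ℝ, norm_smul]
  have h1 : ‖(innerSL ℝ : E →L[ℝ] E →L[ℝ] ℝ)‖ ≤ 1 := norm_innerSL_le ℝ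
  rw [Nat.cast_ofNat, Real.norm_ofNat]
  linarith

theorem iteratedFDeriv_norm_sq_of_three_le (x : E) (k : ℕ) :
    ‖iteratedFDeriv ℝ (k + 3) (fun x : E => ‖x‖ ^ 2) x‖ = 0 := by
  have h : fderiv ℝ (fun x : E => ‖x‖ ^ 2) = fun x => ((2 : ℕ) • innerSL ℝ : E →L[ℝ] E →L[ℝ] ℝ) x := by
    ext1 x
    rw [fderiv_norm_sq_apply]
    rfl
  have h2 : fderiv ℝ (fun x => ((2 : ℕ) • innerSL ℝ : E →L[ℝ] E →L[ℝ] ℝ) x) =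
      fun _ => (2 : ℕ) • innerSL ℝ := by
    ext1 x
    rw [ContinuousLinearMap.fderiv]
  rw [← norm_iteratedFDeriv_fderiv, h, ← norm_iteratedFDeriv_fderiv, h2,
    iteratedFDeriv_succ_const]
  simp

/-- If `|G⁽ⁱ⁾(z)| ≤ B (1 + z)⁻ⁱ` on `[0, ∞)`, then `G(μ|ξ|²)` is a symbol of order zero,
uniformly in `μ ∈ [0, 1]`. This is Faà di Bruno's formula applied after rescaling so that
`1 + μ|ξ|²` becomes of size one at the point considered. -/
theorem norm_iteratedFDeriv_comp_norm_sq_le {G : ℝ → ℝ} {U : Set ℝ} (hU : IsOpen U)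
    (hU0 : ∀ z, 0 ≤ z → z ∈ U) (hG : ContDiffOn ℝ ∞ G U) {l : ℕ} {B : ℝ}
    (hB : ∀ i ≤ l, ∀ z, 0 ≤ z → |iteratedDeriv i G z| * (1 + z) ^ i ≤ B)
    {μ : ℝ} (hμ : μ ∈ Set.Icc (0 : ℝ) 1) (ξ : E) :
    ‖iteratedFDeriv ℝ l (fun ξ : E => G (μ * ‖ξ‖ ^ 2)) ξ‖ ≤
      (l.factorial * B * 2 ^ l) * (1 + ‖ξ‖ ^ 2) ^ ((0 - l : ℝ) / 2) := by
  obtain ⟨hμ0, hμ1⟩ := hμ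
  set Q : ℝ := 1 + μ * ‖ξ‖ ^ 2 with hQ
  have hQ0 : 0 < Q := by positivity
  set R : ℝ := √(1 + ‖ξ‖ ^ 2) with hR
  have hR0 : 0 < R := by positivity
  have hR2 : R ^ 2 = 1 + ‖ξ‖ ^ 2 := Real.sq_sqrt (by positivity)
  have hξR : ‖ξ‖ ≤ R := Real.le_sqrt_of_sq_le (by linarith)
  have hμQ : μ * R ^ 2 ≤ Q := by rw [hR2, hQ]; linarith
  set f : E → ℝ := fun ξ => (μ / Q) • ‖ξ‖ ^ 2 with hf
  have hfc : ContDiff ℝ ∞ f := (contDiff_norm_sq ℝ).const_smul _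
  have hcomp : (fun ξ : E => G (μ * ‖ξ‖ ^ 2)) = (fun w => G (Q * w)) ∘ f := by
    ext ζ
    simp only [hf, Function.comp, smul_eq_mul]
    congr 1
    field_simp
  have hopen : IsOpen ((fun w => Q * w) ⁻¹' U) := hU.preimage (by fun_prop)
  have hval : ∀ ζ, Q * f ζ = μ * ‖ζ‖ ^ 2 := fun ζ => by
    simp only [hf, smul_eq_mul]
    field_simp
  have hmem : ∀ ζ, f ζ ∈ (fun w => Q * w) ⁻¹' U := fun ζ => by
    rw [Set.mem_preimage, hval]
    exact hU0 _ (by positivity)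
  have hfd : ∀ i, iteratedFDeriv ℝ i f ξ = (μ / Q) • iteratedFDeriv ℝ i (fun x : E => ‖x‖ ^ 2) ξ :=
    fun i => iteratedFDeriv_const_smul_apply' ((contDiff_norm_sq ℝ).contDiffAt)
  have key := norm_iteratedFDeriv_comp_le' (𝕜 := ℝ) (g := fun w => G (Q * w)) (f := f) (n := l)
    (N := ∞) (t := (fun w => Q * w) ⁻¹' U) (C := B) (D := 2 / R)
    (by rintro _ ⟨ζ, rfl⟩; exact hmem ζ) hopen.uniqueDiffOn
    (hG.comp (by fun_prop) (Set.mapsTo_preimage _ _)) hfc (mod_cast le_top) ξ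
    (fun i hi => by
      rw [iteratedFDerivWithin_of_isOpen i hopen (hmem ξ), norm_iteratedFDeriv_eq_norm_iteratedDeriv,
        iteratedDeriv_comp_mul_left]
      beta_reduce
      rw [hval, Real.norm_eq_abs, abs_mul, abs_of_nonneg (by positivity),
        mul_comm]
      exact hB i hi _ (by positivity))
    (fun i h1 hi => by
      rw [hfd, norm_smul, Real.norm_of_nonneg (by positivity)]
      match i, h1 with
      | 1, _ =>
        calc μ / Q * ‖iteratedFDeriv ℝ 1 (fun x : E => ‖x‖ ^ 2) ξ‖ ≤ μ / Q * (2 * R) := by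
              gcongr
              exact (norm_iteratedFDeriv_norm_sq_le_one ξ).trans (by gcongr)
          _ = 2 * (μ * R) / Q := by ring
          _ ≤ (2 / R) ^ 1 := by
              rw [pow_one, div_le_div_iff₀ hQ0 hR0]
              nlinarith
      | 2, _ =>
        calc μ / Q * ‖iteratedFDeriv ℝ 2 (fun x : E => ‖x‖ ^ 2) ξ‖ ≤ μ / Q * 2 := by
              gcongr
              exact norm_iteratedFDeriv_norm_sq_le_two ξ
          _ = 2 * μ / Q := by ring
          _ ≤ (2 / R) ^ 2 := by
              rw [div_pow, div_le_div_iff₀ hQ0 (by positivity)]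
              nlinarith
      | k + 3, _ =>
        rw [iteratedFDeriv_norm_sq_of_three_le, mul_zero]
        positivity)
  rw [hcomp]
  refine key.trans_eq ?_
  have : (1 + ‖ξ‖ ^ 2) ^ ((0 - l : ℝ) / 2) = (R ^ l)⁻¹ := by
    rw [← hR2, ← Real.rpow_natCast R 2, ← Real.rpow_mul hR0.le, ← Real.rpow_natCast R l,
      ← Real.rpow_neg hR0.le]
    congr 1
    push_cast
    ring
  rw [this, div_pow]
  ring

end

/-! ### Symbols given by series of products -/

variable {d : ℕ}

/-- A series `∑ m_n(X) g_n(ξ)` is a symbol of order zero when, for each pair of orders of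
differentiation, the products of the bounds on the factors are summable. -/
theorem isSymbolWith_tsum {m g : ℕ → HorizSpace d → ℝ} {A B : ℕ → ℕ → ℝ}
    (hm : ∀ n, ContDiff ℝ ∞ (m n)) (hg : ∀ n, ContDiff ℝ ∞ (g n))
    (hA : ∀ k n X, ‖iteratedFDeriv ℝ k (m n) X‖ ≤ A k n)
    (hB : ∀ l n ξ, ‖iteratedFDeriv ℝ l (g n) ξ‖ ≤ B l n * (1 + ‖ξ‖ ^ 2) ^ ((0 - l : ℝ) / 2))
    (hs : ∀ k l, Summable fun n => A k n * B l n) :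
    IsSymbolWith 0 (fun k l => ∑' n, A k n * B l n) (fun X ξ => ∑' n, m n X * g n ξ) := by
  have hA0 : ∀ k n, 0 ≤ A k n := fun k n => (norm_nonneg _).trans (hA k n 0)
  have hB0 : ∀ l n, 0 ≤ B l n := fun l n => by
    have := (norm_nonneg _).trans (hB l n 0)
    simpa using this
  have hw : ∀ (l : ℕ) (ξ : HorizSpace d), (1 + ‖ξ‖ ^ 2) ^ ((0 - l : ℝ) / 2) ≤ 1 := fun l ξ => by
    refine Real.rpow_le_one_of_one_le_of_nonpos (by nlinarith [norm_nonneg ξ]) ?_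
    have : (0 : ℝ) ≤ l := by positivity
    linarith
  have hB1 : ∀ l n ξ, ‖iteratedFDeriv ℝ l (g n) ξ‖ ≤ B l n := fun l n ξ =>
    (hB l n ξ).trans (mul_le_of_le_one_right (hB0 l n) (hw l ξ))
  constructor
  · refine contDiff_tsum (N := ⊤)
      (v := fun k n => ∑ i ∈ Finset.range (k + 1), (k.choose i : ℝ) * (A i n * B (k - i) n))
      (fun n => ?_) (fun k _ => ?_) (fun k n p _ => ?_)
    · exact ((hm n).comp contDiff_fst).mul ((hg n).comp contDiff_snd)
    · exact summable_sum fun i _ => (hs i (k - i)).mul_left _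
    · refine (norm_iteratedFDeriv_mul_le ((hm n).comp contDiff_fst) ((hg n).comp contDiff_snd) p
        (mod_cast le_top)).trans (Finset.sum_le_sum fun i _ => ?_)
      rw [mul_assoc]
      have h1 : ‖iteratedFDeriv ℝ i (m n ∘ Prod.fst) p‖ ≤ A i n := by
        have := (ContinuousLinearMap.fst ℝ (HorizSpace d) (HorizSpace d)).iteratedFDeriv_comp_right
          (hm n) p (i := i) (mod_cast le_top)
        rw [ContinuousLinearMap.coe_fst'] at this
        rw [this]
        refine (ContinuousMultilinearMap.norm_compContinuousLinearMap_le _ _).trans ?_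
        refine (mul_le_of_le_one_right (norm_nonneg _) ?_).trans (hA i n p.1)
        exact Finset.prod_le_one (fun _ _ => norm_nonneg _)
          fun _ _ => ContinuousLinearMap.norm_fst_le ..
      have h2 : ‖iteratedFDeriv ℝ (k - i) (g n ∘ Prod.snd) p‖ ≤ B (k - i) n := by
        have := (ContinuousLinearMap.snd ℝ (HorizSpace d) (HorizSpace d)).iteratedFDeriv_comp_right
          (hg n) p (i := k - i) (WithTop.coe_le_coe.2 le_top)
        rw [ContinuousLinearMap.coe_snd'] at this
        rw [this]
        refine (ContinuousMultilinearMap.norm_compContinuousLinearMap_le _ _).trans ?_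
        refine (mul_le_of_le_one_right (norm_nonneg _) ?_).trans (hB1 (k - i) n p.2)
        exact Finset.prod_le_one (fun _ _ => norm_nonneg _)
          fun _ _ => ContinuousLinearMap.norm_snd_le ..
      have := hA0 i n
      gcongr
  · intro k l X ξ
    -- first differentiate in `ξ` at fixed `X`, then in `X`; both times the series may be
    -- differentiated term by term
    have hξ : (fun Y : HorizSpace d => iteratedFDeriv ℝ l (fun ζ => ∑' n, m n Y * g n ζ) ξ) =
        fun Y => ∑' n, m n Y • iteratedFDeriv ℝ l (g n) ξ := by
      ext1 Y
      have hd : ∀ (j n : ℕ) (ζ : HorizSpace d), iteratedFDeriv ℝ j (fun ζ => m n Y * g n ζ) ζ =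
          m n Y • iteratedFDeriv ℝ j (g n) ζ := fun j n ζ =>
        iteratedFDeriv_const_smul_apply' (a := m n Y)
          (((hg n).of_le (mod_cast le_top)).contDiffAt)
      rw [iteratedFDeriv_tsum_apply (N := ⊤) (v := fun j n => A 0 n * B j n)
        (fun n => contDiff_const.mul (hg n)) (fun j _ => hs 0 j) (fun j n ζ _ => ?_) le_top]
      · exact tsum_congr fun n => hd l n ξ
      · rw [hd, norm_smul]
        have := hA0 0 n
        gcongr
        · simpa using hA 0 n Y
        · exact hB1 j n ζ
    have hterm : ∀ (j n : ℕ) (Y : HorizSpace d),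
        ‖iteratedFDeriv ℝ j (fun Y => m n Y • iteratedFDeriv ℝ l (g n) ξ) Y‖ ≤
          A j n * B l n * (1 + ‖ξ‖ ^ 2) ^ ((0 - l : ℝ) / 2) := fun j n Y => by
      have := ContinuousLinearMap.norm_iteratedFDeriv_comp_left
        ((ContinuousLinearMap.id ℝ ℝ).smulRight (iteratedFDeriv ℝ l (g n) ξ))
        ((hm n).contDiffAt (x := Y)) (n := j) (mod_cast le_top)
      refine this.trans ?_
      rw [ContinuousLinearMap.norm_smulRight_apply, ContinuousLinearMap.norm_id, one_mul, mul_comm,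
        mul_assoc]
      have := hA0 j n
      gcongr
      · exact hA j n Y
      · exact hB l n ξ
    rw [hξ, iteratedFDeriv_tsum_apply (N := ⊤) (f := fun n Y => m n Y • iteratedFDeriv ℝ l (g n) ξ)
      (v := fun j n => A j n * B l n * (1 + ‖ξ‖ ^ 2) ^ ((0 - l : ℝ) / 2))
      (fun n => by have := hm n; fun_prop) (fun j _ => (hs j l).mul_right _)
      (fun j n Y _ => hterm j n Y) le_top]
    rw [← tsum_mul_right]
    exact tsum_of_norm_bounded ((hs k l).mul_right _).hasSum fun n => hterm k n X

/-! ### The expansion of the symbols -/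

/-- The coefficients in `X` of the expansion: `e₀`, followed by `e a ^ (2 (n + j))`. -/
def expansionCoeff (a e₀ e : HorizSpace d → ℝ) (j : ℕ) : ℕ → HorizSpace d → ℝ
  | 0, X => e₀ X
  | n + 1, X => e X * a X ^ (2 * (n + j))

/-- The Fourier multipliers of the expansion: `H(μ|ξ|²)`, followed by `G_{p,n}(μ|ξ|²)`. -/
noncomputable def expansionMult (μ : ℝ) (p : ℕ) : ℕ → HorizSpace d → ℝ
  | 0, ξ => profileH (μ * ‖ξ‖ ^ 2)
  | n + 1, ξ => profileG p n (μ * ‖ξ‖ ^ 2)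

/-- The symbol `(e₀ S₂(z) + e a^(2j) S_p(a² z)) / S₀(z)` with `z = μ|ξ|²`, written as a series of
products of a function of `X` and a Fourier multiplier. -/
noncomputable def expansionSymbol (μ : ℝ) (a e₀ e : HorizSpace d → ℝ) (j p : ℕ)
    (X ξ : HorizSpace d) : ℝ :=
  ∑' n, expansionCoeff a e₀ e j n X * expansionMult μ p n ξ

theorem expansionSymbol_eq (μ : ℝ) (a e₀ e : HorizSpace d → ℝ) (j p : ℕ)
    (X ξ : HorizSpace d) :
    expansionSymbol μ a e₀ e j p X ξ =
      (e₀ X * evenSeries 2 (μ * ‖ξ‖ ^ 2) +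
        e X * a X ^ (2 * j) * evenSeries p (a X ^ 2 * (μ * ‖ξ‖ ^ 2))) *
          (evenSeries 0 (μ * ‖ξ‖ ^ 2))⁻¹ := by
  have h : HasSum (fun n => expansionCoeff a e₀ e j (n + 1) X * expansionMult μ p (n + 1) ξ)
      (e X * a X ^ (2 * j) * evenSeries p (a X ^ 2 * (μ * ‖ξ‖ ^ 2)) *
        (evenSeries 0 (μ * ‖ξ‖ ^ 2))⁻¹) := by
    have := ((derivDecreasing_evenCoeff p).summable (a X ^ 2 * (μ * ‖ξ‖ ^ 2))).hasSum
    have he : (fun n => expansionCoeff a e₀ e j (n + 1) X * expansionMult μ p (n + 1) ξ) =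
        fun n => e X * a X ^ (2 * j) * (evenCoeff p n * (a X ^ 2 * (μ * ‖ξ‖ ^ 2)) ^ n) *
          (evenSeries 0 (μ * ‖ξ‖ ^ 2))⁻¹ := by
      ext n
      simp only [expansionCoeff, expansionMult, profileG]
      ring
    rw [he]
    exact (this.mul_left _).mul_right _
  have hs : Summable fun n => expansionCoeff a e₀ e j n X * expansionMult μ p n ξ :=
    (summable_nat_add_iff (f := fun n => expansionCoeff a e₀ e j n X * expansionMult μ p n ξ) 1).1
      h.summable
  rw [expansionSymbol, hs.tsum_eq_zero_add, h.tsum_eq]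
  simp only [expansionCoeff, expansionMult, profileH]
  ring

theorem sech_sqrt_mul_norm {μ : ℝ} (hμ : 0 ≤ μ) (ξ : HorizSpace d) :
    sech (√μ * ‖ξ‖) = (evenSeries 0 (μ * ‖ξ‖ ^ 2))⁻¹ := by
  rw [sech, ← evenSeries_zero_sq, mul_pow, Real.sq_sqrt hμ, one_div]

theorem symL1_eq_evenSeries {μ : ℝ} (hμ : 0 ≤ μ) (β : ℝ) (b : HorizSpace d → ℝ)
    (X ξ : HorizSpace d) :
    symL1 μ β b X ξ = -(b X * evenSeries 1 ((β * b X) ^ 2 * (μ * ‖ξ‖ ^ 2)) *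
      (evenSeries 0 (μ * ‖ξ‖ ^ 2))⁻¹) := by
  rw [symL1, sech_sqrt_mul_norm hμ, ← evenSeries_one_sq]
  congr 4
  rw [mul_pow (β * b X), mul_pow (√μ), Real.sq_sqrt hμ]

theorem symL1_eq_expansionSymbol {μ : ℝ} (hμ : 0 ≤ μ) (β : ℝ) (b : HorizSpace d → ℝ) :
    symL1 μ β b = expansionSymbol μ (fun X => β * b X) (fun _ => 0) (fun X => -b X) 0 1 := by
  ext X ξ
  rw [expansionSymbol_eq, symL1_eq_evenSeries hμ]
  ring

theorem symL2_eq_expansionSymbol {μ : ℝ} (hμ : 0 ≤ μ) (β : ℝ) (b : HorizSpace d → ℝ) :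
    symL2 μ β b = expansionSymbol μ (fun X => β * b X) (fun X => -b X) b 1 3 := by
  ext X ξ
  rw [expansionSymbol_eq, symL2, symL1_eq_evenSeries hμ]
  have hz : 0 ≤ μ * ‖ξ‖ ^ 2 := by positivity
  generalize μ * ‖ξ‖ ^ 2 = z at hz
  have hpos : 0 < evenSeries 0 z := zero_lt_one.trans_le (one_le_evenSeries_zero hz)
  split_ifs with h
  · simp only [h, mul_zero, evenSeries_zero_right, Nat.factorial]
    norm_num
    ring
  · have h1 := evenSeries_eq_add_mul 1 ((β * b X) ^ 2 * z)
    have h0 := evenSeries_eq_add_mul 0 z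
    simp only [Nat.factorial, Nat.cast_one, div_one, zero_add, mul_one] at h1 h0
    rw [h1]
    field_simp
    rw [h0]
    ring

theorem symL3_eq_expansionSymbol {μ : ℝ} (hμ : 0 ≤ μ) (β : ℝ) (b : HorizSpace d → ℝ) :
    symL3 μ β b = expansionSymbol μ (fun X => β * b X) (fun _ => 1) (fun _ => -1) 1 2 := by
  ext X ξ
  have hcosh : Real.cosh (β * b X * (√μ * ‖ξ‖)) =
      evenSeries 0 ((β * b X) ^ 2 * (μ * ‖ξ‖ ^ 2)) := by
    rw [← evenSeries_zero_sq, mul_pow (β * b X), mul_pow (√μ), Real.sq_sqrt hμ]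
  rw [expansionSymbol_eq, symL3, sech_sqrt_mul_norm hμ, hcosh]
  have hz : 0 ≤ μ * ‖ξ‖ ^ 2 := by positivity
  generalize μ * ‖ξ‖ ^ 2 = z at hz
  have hpos : 0 < evenSeries 0 z := zero_lt_one.trans_le (one_le_evenSeries_zero hz)
  split_ifs with h
  · simp only [h, mul_zero, evenSeries_zero_right, Nat.factorial]
    norm_num
    ring
  · have h1 := evenSeries_eq_add_mul 0 ((β * b X) ^ 2 * z)
    have h0 := evenSeries_eq_add_mul 0 z
    simp only [Nat.factorial, Nat.cast_one, div_one, zero_add] at h1 h0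
    rw [h1]
    field_simp
    rw [h0]
    ring

theorem symF3_eq_evenSeries {μ : ℝ} (hμ : 0 ≤ μ) (ξ : HorizSpace d) :
    symF3 μ ξ = (evenSeries 0 (μ * ‖ξ‖ ^ 2))⁻¹ := sech_sqrt_mul_norm hμ ξ

theorem symF4_eq_profileH {μ : ℝ} (hμ : 0 ≤ μ) (ξ : HorizSpace d) :
    symF4 μ ξ = 2 * profileH (μ * ‖ξ‖ ^ 2) := by
  rw [symF4, symF3_eq_evenSeries hμ, profileH]
  have hz : 0 ≤ μ * ‖ξ‖ ^ 2 := by positivity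
  generalize μ * ‖ξ‖ ^ 2 = z at hz
  have hpos : 0 < evenSeries 0 z := zero_lt_one.trans_le (one_le_evenSeries_zero hz)
  split_ifs with h
  · simp [h, evenSeries_zero_right]
  · have h0 := evenSeries_eq_add_mul 0 z
    simp only [Nat.factorial, Nat.cast_one, div_one, zero_add] at h0
    field_simp
    linarith

/-- The common symbol `b⁵ S₅((βb)² z) / S₀(z)`, `z = μ|ξ|²`, of the remainders of `L₁` and `L₂`. -/
noncomputable def remainderSymbol (μ β : ℝ) (b : HorizSpace d → ℝ) : HorizSpace d → HorizSpace d → ℝ :=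
  expansionSymbol μ (fun X => β * b X) (fun _ => 0) (fun X => b X ^ 5) 0 5

theorem symL1_add_eq (μ : ℝ) (β : ℝ) (b : HorizSpace d → ℝ) (X ξ : HorizSpace d) :
    symL1 μ β b X ξ + b X = -μ * (‖ξ‖ ^ 2 * symL2 μ β b X ξ) := by
  rw [symL2]
  split_ifs with h
  · have h' : √μ * ‖ξ‖ = 0 := by
      rcases mul_eq_zero.1 h with h | h
      · simp [h]
      · simp [pow_eq_zero_iff two_ne_zero |>.1 h]
    rw [symL1, h', mul_zero, sinhc, if_pos rfl, sech, Real.cosh_zero, ← mul_assoc, neg_mul, h]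
    simp
  · have hμ : μ ≠ 0 := left_ne_zero_of_mul h
    have hξ : ‖ξ‖ ≠ 0 := fun h0 => h (by simp [h0])
    field_simp

theorem symL1_sub_eq {μ : ℝ} (hμ : 0 ≤ μ) (β : ℝ) (b : HorizSpace d → ℝ) (X ξ : HorizSpace d) :
    symL1 μ β b X ξ - (-(b X * symF3 μ ξ) - μ * β ^ 2 / 6 * b X ^ 3 * (‖ξ‖ ^ 2 * symF3 μ ξ)) =
      -(μ ^ 2 * β ^ 4) * (‖ξ‖ ^ 4 * remainderSymbol μ β b X ξ) := by
  rw [remainderSymbol, expansionSymbol_eq, symL1_eq_evenSeries hμ, symF3_eq_evenSeries hμ]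
  have h1 := evenSeries_eq_add_mul 1 ((β * b X) ^ 2 * (μ * ‖ξ‖ ^ 2))
  have h3 := evenSeries_eq_add_mul 3 ((β * b X) ^ 2 * (μ * ‖ξ‖ ^ 2))
  simp only [Nat.factorial, Nat.reduceAdd] at h1 h3
  rw [h1, h3]
  push_cast
  ring

theorem symL2_sub_eq {μ : ℝ} (hμ : 0 ≤ μ) (β : ℝ) (b : HorizSpace d → ℝ) (X ξ : HorizSpace d) :
    symL2 μ β b X ξ - (-(1 / 2 * b X * symF4 μ ξ) + β ^ 2 / 6 * b X ^ 3 * symF3 μ ξ) =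
      μ * β ^ 4 * (‖ξ‖ ^ 2 * remainderSymbol μ β b X ξ) := by
  rw [remainderSymbol, expansionSymbol_eq, symL2_eq_expansionSymbol hμ, expansionSymbol_eq,
    symF3_eq_evenSeries hμ, symF4_eq_profileH hμ, profileH]
  have h3 := evenSeries_eq_add_mul 3 ((β * b X) ^ 2 * (μ * ‖ξ‖ ^ 2))
  simp only [Nat.factorial, Nat.reduceAdd] at h3
  rw [h3]
  push_cast
  ring

/-! ### The symbols are of order zero -/

theorem exists_norm_iteratedFDeriv_expansionMult_le (l : ℕ) :
    ∃ B : ℝ, 0 ≤ B ∧ ∀ (p n : ℕ), ∀ μ ∈ Set.Icc (0 : ℝ) 1, ∀ ξ : HorizSpace d,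
      ‖iteratedFDeriv ℝ l (expansionMult μ p n) ξ‖ ≤
        (B * (n + 1 : ℝ) ^ (3 * l)) * (1 + ‖ξ‖ ^ 2) ^ ((0 - l : ℝ) / 2) := by
  choose BG hBG0 hBG using exists_abs_iteratedDeriv_profileG_le
  choose BH hBH0 hBH using fun j => exists_abs_iteratedDeriv_profileH_mul_le j j le_rfl
  set B : ℝ := ∑ i ∈ Finset.range (l + 1), (BG i + BH i) with hBdef
  have hB : ∀ i ≤ l, BG i + BH i ≤ B := fun i hi =>
    Finset.single_le_sum (f := fun i => BG i + BH i)
      (fun i _ => add_nonneg (hBG0 i) (hBH0 i)) (Finset.mem_range.2 (by omega))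
  have hB0 : 0 ≤ B := Finset.sum_nonneg fun i _ => add_nonneg (hBG0 i) (hBH0 i)
  refine ⟨l.factorial * B * 2 ^ l, by positivity, fun p n μ hμ ξ => ?_⟩
  match n with
  | 0 =>
    have := norm_iteratedFDeriv_comp_norm_sq_le isOpen_evenSeriesDomain
      (fun z hz => mem_evenSeriesDomain hz) contDiffOn_profileH (l := l) (B := B)
      (fun i hi z hz => (hBH i z hz).trans (by linarith [hB i hi, hBG0 i])) hμ ξ
    have he : expansionMult (d := d) μ p 0 = fun ξ => profileH (μ * ‖ξ‖ ^ 2) := rfl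
    rw [he]
    simpa using this
  | n + 1 =>
    have := norm_iteratedFDeriv_comp_norm_sq_le isOpen_evenSeriesDomain
      (fun z hz => mem_evenSeriesDomain hz) (contDiffOn_profileG p n) (l := l)
      (B := B * (n + 1 + 1 : ℝ) ^ (3 * l))
      (fun i hi z hz => (hBG i p n z hz).trans (by
        have h1 : BG i ≤ B := by linarith [hB i hi, hBH0 i]
        have h0 : (0 : ℝ) ≤ n := by positivity
        calc BG i * (n + 1 : ℝ) ^ (3 * i) ≤ B * (n + 1 + 1 : ℝ) ^ (3 * i) := by
              gcongr
              linarith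
          _ ≤ _ := by
              gcongr
              linarith)) hμ ξ
    have he : expansionMult (d := d) μ p (n + 1) = fun ξ => profileG p n (μ * ‖ξ‖ ^ 2) := rfl
    rw [he]
    refine this.trans_eq ?_
    push_cast
    ring

theorem contDiff_expansionMult {μ : ℝ} (hμ : 0 ≤ μ) (p n : ℕ) :
    ContDiff ℝ ∞ (expansionMult (d := d) μ p n) := by
  have hf : ContDiff ℝ ∞ fun ξ : HorizSpace d => μ * ‖ξ‖ ^ 2 :=
    contDiff_const.mul (contDiff_norm_sq ℝ)
  have hmem : ∀ ξ : HorizSpace d, μ * ‖ξ‖ ^ 2 ∈ evenSeriesDomain :=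
    fun ξ => mem_evenSeriesDomain (by positivity)
  match n with
  | 0 => exact contDiffOn_profileH.comp_contDiff hf hmem
  | n + 1 => exact (contDiffOn_profileG p n).comp_contDiff hf hmem

/-- The derivatives of the powers of `β b` decay geometrically with the exponent, at the rate of
the supremum of `|β b|` up to a polynomial factor. -/
theorem exists_norm_iteratedFDeriv_pow_le {b : HorizSpace d → ℝ} (hb : ContDiff ℝ ∞ b)
    {D : ℕ → ℝ} (hD : ∀ k X, ‖iteratedFDeriv ℝ k b X‖ ≤ D k) {ρ : ℝ} (hρ0 : 0 < ρ) (hρ1 : ρ ≤ 1)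
    (k : ℕ) :
    ∃ A : ℝ, 0 ≤ A ∧ ∀ β ∈ Set.Icc (0 : ℝ) 1, (∀ X, β * |b X| ≤ ρ) → ∀ (N : ℕ) (X : HorizSpace d),
      ‖iteratedFDeriv ℝ k (fun X => (β * b X) ^ N) X‖ ≤ A * ((N + 1 : ℝ) ^ k * ρ ^ N) := by
  have hD0 : ∀ k, 0 ≤ D k := fun k => (norm_nonneg _).trans (hD k 0)
  set D' : ℝ := 1 + ∑ i ∈ Finset.range (k + 1), D i with hD'
  have hD'1 : 1 ≤ D' := le_add_of_nonneg_right (Finset.sum_nonneg fun i _ => hD0 i)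
  refine ⟨k.factorial * (ρ ^ k)⁻¹ * D' ^ k, by positivity, fun β hβ hle N X => ?_⟩
  have hval : |β * b X| ≤ ρ := by rw [abs_mul, abs_of_nonneg hβ.1]; exact hle X
  have key := norm_iteratedFDeriv_comp_le (𝕜 := ℝ) (g := fun x : ℝ => x ^ N)
    (f := fun X => β • b X) (n := k) (N := ∞) (C := (ρ ^ k)⁻¹ * ((N + 1 : ℝ) ^ k * ρ ^ N)) (D := D')
    (contDiff_id.pow N) (hb.const_smul β) (mod_cast le_top) X
    (fun i hi => by
      rw [norm_iteratedFDeriv_eq_norm_iteratedDeriv, iteratedDeriv_pow, norm_mul, norm_pow,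
        Real.norm_eq_abs (_ • _), smul_eq_mul, Real.norm_natCast]
      rcases lt_or_ge N i with h | h
      · rw [Nat.descFactorial_eq_zero_iff_lt.2 h]
        simp only [Nat.cast_zero, zero_mul]
        positivity
      · rw [mul_left_comm]
        have h1 : (N.descFactorial i : ℝ) ≤ (N + 1 : ℝ) ^ k := by
          calc (N.descFactorial i : ℝ) ≤ (N : ℝ) ^ i := by
                exact_mod_cast Nat.descFactorial_le_pow N i
            _ ≤ (N + 1 : ℝ) ^ i := by gcongr; linarith
            _ ≤ (N + 1 : ℝ) ^ k := by
              gcongr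
              linarith [(Nat.cast_nonneg N : (0 : ℝ) ≤ N)]
        have h2 : |β * b X| ^ (N - i) ≤ (ρ ^ k)⁻¹ * ρ ^ N := by
          calc |β * b X| ^ (N - i) ≤ ρ ^ (N - i) := by gcongr
            _ = (ρ ^ i)⁻¹ * ρ ^ N := by
              rw [← Nat.sub_add_cancel h, pow_add, Nat.add_sub_cancel]
              field_simp
            _ ≤ (ρ ^ k)⁻¹ * ρ ^ N := by
              gcongr ?_ * _
              exact inv_anti₀ (by positivity) (pow_le_pow_of_le_one hρ0.le hρ1 hi)
        gcongr)
    (fun i h1 hi => by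
      rw [iteratedFDeriv_const_smul_apply' (a := β) ((hb.of_le (mod_cast le_top)).contDiffAt),
        norm_smul, Real.norm_of_nonneg hβ.1]
      calc β * ‖iteratedFDeriv ℝ i b X‖ ≤ 1 * D i := by
            have := hβ.2
            gcongr
            exact hD i X
        _ ≤ D' := by
            rw [one_mul]
            have := Finset.single_le_sum (f := D) (fun i _ => hD0 i)
              (Finset.mem_range.2 (Nat.lt_succ_of_le hi))
            linarith
        _ ≤ D' ^ i := le_self_pow₀ hD'1 (by omega))
  refine key.trans_eq ?_
  ring

theorem summable_succ_pow_mul_geometric (P : ℕ) {ρ : ℝ} (hρ0 : 0 ≤ ρ) (hρ1 : ρ < 1) :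
    Summable fun n : ℕ => ((n + 1 : ℝ) ^ P) * ρ ^ n := by
  rcases hρ0.eq_or_lt with rfl | hpos
  · exact summable_of_ne_finset_zero (s := {0}) fun n hn => by
      simp [Finset.mem_singleton.not.1 hn]
  have h := summable_pow_mul_geometric_of_norm_lt_one P (r := ρ)
    (by rwa [Real.norm_of_nonneg hρ0])
  refine (((summable_nat_add_iff 1).2 h).mul_left ρ⁻¹).congr fun n => ?_
  push_cast
  rw [pow_succ]
  field_simp

/-- The expansion symbols are of order zero, with constants uniform in `μ` and in `β`. -/
theorem exists_isSymbolWith_expansionSymbol {b e₀ e : HorizSpace d → ℝ} (hb : ContDiff ℝ ∞ b)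
    (he₀ : ContDiff ℝ ∞ e₀) (he : ContDiff ℝ ∞ e) {D D₀ D₁ : ℕ → ℝ}
    (hD : ∀ k X, ‖iteratedFDeriv ℝ k b X‖ ≤ D k) (hD₀ : ∀ k X, ‖iteratedFDeriv ℝ k e₀ X‖ ≤ D₀ k)
    (hD₁ : ∀ k X, ‖iteratedFDeriv ℝ k e X‖ ≤ D₁ k) {ρ : ℝ} (hρ0 : 0 < ρ) (hρ1 : ρ < 1)
    (j p : ℕ) :
    ∃ K : ℕ → ℕ → ℝ, ∀ μ ∈ Set.Icc (0 : ℝ) 1, ∀ β ∈ Set.Icc (0 : ℝ) 1,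
      (∀ X, β * |b X| ≤ ρ) →
        IsSymbolWith 0 K (expansionSymbol μ (fun X => β * b X) e₀ e j p) := by
  choose A hA0 hA using exists_norm_iteratedFDeriv_pow_le hb hD hρ0 hρ1.le
  choose B hB0 hB using exists_norm_iteratedFDeriv_expansionMult_le (d := d)
  have hD₁0 : ∀ k, 0 ≤ D₁ k := fun k => (norm_nonneg _).trans (hD₁ k 0)
  have hD₀0 : ∀ k, 0 ≤ D₀ k := fun k => (norm_nonneg _).trans (hD₀ k 0)
  set A₁ : ℕ → ℝ := fun k => ∑ i ∈ Finset.range (k + 1), (k.choose i : ℝ) * D₁ i *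
    A (k - i) with hA₁
  have hA₁0 : ∀ k, 0 ≤ A₁ k := fun k => Finset.sum_nonneg fun i _ => by
    have := hD₁0 i
    have := hA0 (k - i)
    positivity
  -- the bounds on the coefficients
  let A₂ : ℕ → ℕ → ℝ := fun k n =>
    (D₀ k + A₁ k) * ((2 * j + 2) ^ k * ρ⁻¹) * ((n + 1 : ℝ) ^ k * ρ ^ n)
  refine ⟨fun k l => ∑' n, A₂ k n * (B l * (n + 1 : ℝ) ^ (3 * l)), fun μ hμ β hβ hle => ?_⟩
  refine isSymbolWith_tsum (A := A₂) (B := fun l n => B l * (n + 1 : ℝ) ^ (3 * l))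
    (fun n => ?_) (fun n => contDiff_expansionMult hμ.1 p n) (fun k n X => ?_)
    (fun l n ξ => hB l p n μ hμ ξ) (fun k l => ?_)
  · match n with
    | 0 => exact he₀
    | n + 1 => exact he.mul ((contDiff_const.mul hb).pow _)
  · have hj0 : (0 : ℝ) ≤ j := by positivity
    have h2j : (1 : ℝ) ≤ (2 * j + 2) ^ k := one_le_pow₀ (by linarith)
    have hρinv : 1 ≤ ρ⁻¹ := (one_le_inv₀ hρ0).2 hρ1.le
    match n with
    | 0 =>
      calc ‖iteratedFDeriv ℝ k e₀ X‖ ≤ D₀ k := hD₀ k X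
        _ ≤ D₀ k + A₁ k := le_add_of_nonneg_right (hA₁0 k)
        _ ≤ (D₀ k + A₁ k) * ((2 * j + 2) ^ k * ρ⁻¹) :=
          le_mul_of_one_le_right (add_nonneg (hD₀0 k) (hA₁0 k))
            (one_le_mul_of_one_le_of_one_le h2j hρinv)
        _ = A₂ k 0 := by simp [A₂]
    | n + 1 =>
      have hn0 : (0 : ℝ) ≤ n := by positivity
      have hpow : ∀ i ≤ k, ((2 * (n + j) : ℕ) + 1 : ℝ) ^ (k - i) * ρ ^ (2 * (n + j)) ≤
          ((2 * j + 2) ^ k * ρ⁻¹) * (((n + 1 : ℕ) + 1 : ℝ) ^ k * ρ ^ (n + 1)) := fun i hi => by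
        calc ((2 * (n + j) : ℕ) + 1 : ℝ) ^ (k - i) * ρ ^ (2 * (n + j))
            ≤ ((2 * j + 2) * ((n + 1 : ℕ) + 1) : ℝ) ^ k * ρ ^ n := by
              gcongr ?_ * ?_
              · calc ((2 * (n + j) : ℕ) + 1 : ℝ) ^ (k - i) ≤ ((2 * (n + j) : ℕ) + 1 : ℝ) ^ k := by
                      gcongr
                      · push_cast; nlinarith
                      · omega
                  _ ≤ _ := by
                      gcongr
                      push_cast
                      nlinarith
              · exact pow_le_pow_of_le_one hρ0.le hρ1.le (by omega)
          _ = _ := by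
              rw [mul_pow, pow_succ ρ n]
              field_simp
      calc ‖iteratedFDeriv ℝ k (fun X => e X * (β * b X) ^ (2 * (n + j))) X‖
          ≤ ∑ i ∈ Finset.range (k + 1), (k.choose i : ℝ) * ‖iteratedFDeriv ℝ i e X‖ *
            ‖iteratedFDeriv ℝ (k - i) (fun X => (β * b X) ^ (2 * (n + j))) X‖ :=
            norm_iteratedFDeriv_mul_le he ((contDiff_const.mul hb).pow _) X (mod_cast le_top)
        _ ≤ ∑ i ∈ Finset.range (k + 1), (k.choose i : ℝ) * D₁ i * (A (k - i) *
            (((2 * j + 2) ^ k * ρ⁻¹) * (((n + 1 : ℕ) + 1 : ℝ) ^ k * ρ ^ (n + 1)))) := by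
            refine Finset.sum_le_sum fun i hi => ?_
            have := hD₁0 i
            gcongr
            · exact hD₁ i X
            · refine (hA (k - i) β hβ hle _ X).trans ?_
              exact mul_le_mul_of_nonneg_left
                (hpow i (Nat.lt_succ_iff.1 (Finset.mem_range.1 hi))) (hA0 _)
        _ = A₁ k * (((2 * j + 2) ^ k * ρ⁻¹) * (((n + 1 : ℕ) + 1 : ℝ) ^ k * ρ ^ (n + 1))) := by
            rw [hA₁, Finset.sum_mul]
            exact Finset.sum_congr rfl fun i _ => by ring
        _ ≤ (D₀ k + A₁ k) *
            (((2 * j + 2) ^ k * ρ⁻¹) * (((n + 1 : ℕ) + 1 : ℝ) ^ k * ρ ^ (n + 1))) := by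
            gcongr
            linarith [hD₀0 k]
        _ = A₂ k (n + 1) := by simp only [A₂]; ring
  · refine ((summable_succ_pow_mul_geometric (k + 3 * l) hρ0.le hρ1).mul_left
      ((D₀ k + A₁ k) * ((2 * j + 2) ^ k * ρ⁻¹) * B l)).congr fun n => ?_
    simp only [A₂]
    ring

theorem exists_norm_iteratedFDeriv_le_of_hasCompactSupport {f : HorizSpace d → ℝ}
    (hf : ContDiff ℝ ∞ f) (hc : HasCompactSupport f) :
    ∃ D : ℕ → ℝ, ∀ k X, ‖iteratedFDeriv ℝ k f X‖ ≤ D k := by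
  choose D hD using fun k : ℕ => (hc.iteratedFDeriv (𝕜 := ℝ) k).exists_bound_of_continuous
    (hf.continuous_iteratedFDeriv (m := k) (mod_cast le_top))
  exact ⟨D, hD⟩

theorem exists_norm_iteratedFDeriv_const_le (c : ℝ) :
    ∃ D : ℕ → ℝ, ∀ k X, ‖iteratedFDeriv ℝ k (fun _ : HorizSpace d => c) X‖ ≤ D k := by
  refine ⟨fun _ => |c|, fun k X => ?_⟩
  match k with
  | 0 => simp
  | k + 1 => rw [iteratedFDeriv_succ_const]; simp

/-- Uniform symbol bounds for `L₁`, `L₂` and `L₃`. -/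
theorem exists_isSymbolWith_symL {b : HorizSpace d → ℝ} {hmin : ℝ} (hb : ContDiff ℝ ∞ b)
    (hbc : HasCompactSupport b) (h0 : 0 < hmin) (h1 : hmin < 1) :
    ∃ K : ℕ → ℕ → ℝ, ∀ μ ∈ Set.Icc (0 : ℝ) 1, ∀ β ∈ Set.Icc (0 : ℝ) 1,
      (∀ X, β * |b X| ≤ 1 - hmin) →
        IsSymbolWith 0 K (symL1 μ β b) ∧ IsSymbolWith 0 K (symL2 μ β b) ∧
          IsSymbolWith 0 K (symL3 μ β b) := by
  have hρ0 : 0 < 1 - hmin := by linarith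
  have hρ1 : 1 - hmin < 1 := by linarith
  obtain ⟨D, hD⟩ := exists_norm_iteratedFDeriv_le_of_hasCompactSupport hb hbc
  have hDneg : ∀ k X, ‖iteratedFDeriv ℝ k (fun X => -b X) X‖ ≤ D k := fun k X => by
    have : (fun X => -b X) = -b := rfl
    rw [this, iteratedFDeriv_neg_apply, norm_neg]
    exact hD k X
  obtain ⟨D0, hD0⟩ := exists_norm_iteratedFDeriv_const_le (d := d) 0
  obtain ⟨D1, hD1⟩ := exists_norm_iteratedFDeriv_const_le (d := d) 1
  obtain ⟨D2, hD2⟩ := exists_norm_iteratedFDeriv_const_le (d := d) (-1)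
  obtain ⟨K1, hK1⟩ := exists_isSymbolWith_expansionSymbol hb contDiff_const hb.neg hD hD0 hDneg
    hρ0 hρ1 0 1
  obtain ⟨K2, hK2⟩ := exists_isSymbolWith_expansionSymbol hb hb.neg hb hD hDneg hD hρ0 hρ1 1 3
  obtain ⟨K3, hK3⟩ := exists_isSymbolWith_expansionSymbol hb contDiff_const contDiff_const
    hD hD1 hD2 hρ0 hρ1 1 2
  refine ⟨fun k l => max (K1 k l) (max (K2 k l) (K3 k l)), fun μ hμ β hβ hle => ?_⟩
  have mono : ∀ {K K' : ℕ → ℕ → ℝ} {L : HorizSpace d → HorizSpace d → ℝ},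
      IsSymbolWith 0 K L → (∀ k l, K k l ≤ K' k l) → IsSymbolWith 0 K' L :=
    fun h hK => ⟨h.1, fun k l X ξ => (h.2 k l X ξ).trans (by gcongr; exact hK k l)⟩
  rw [symL1_eq_expansionSymbol hμ.1, symL2_eq_expansionSymbol hμ.1, symL3_eq_expansionSymbol hμ.1]
  exact ⟨mono (hK1 μ hμ β hβ hle) fun k l => le_max_left _ _,
    mono (hK2 μ hμ β hβ hle) fun k l => (le_max_left _ _).trans (le_max_right _ _),
    mono (hK3 μ hμ β hβ hle) fun k l => (le_max_right _ _).trans (le_max_right _ _)⟩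

/-! ### Multiplication operators and Fourier multipliers on `L²` -/

open scoped BoundedContinuousFunction
open Filter Topology

/-- The space `L²(ℝ^d; ℂ)`. -/
abbrev LTwo (d : ℕ) : Type := Lp ℂ 2 (volume : Measure (HorizSpace d))

theorem memLp_bcf_mul (m : HorizSpace d →ᵇ ℂ) (f : LTwo d) :
    MemLp (fun x => m x * f x) 2 (volume : Measure (HorizSpace d)) := by
  refine (Lp.memLp f).of_le_mul (c := ‖m‖)
    (m.continuous.aestronglyMeasurable.mul (Lp.aestronglyMeasurable f)) (.of_forall fun x => ?_)
  rw [norm_mul]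
  gcongr
  exact m.norm_coe_le_norm x

/-- Multiplication by a bounded continuous function on `L²`. -/
noncomputable def mulOp (m : HorizSpace d →ᵇ ℂ) : LTwo d →L[ℂ] LTwo d :=
  LinearMap.mkContinuous
    { toFun := fun f => (memLp_bcf_mul m f).toLp _
      map_add' := fun f g => by
        rw [← MemLp.toLp_add]
        refine MemLp.toLp_congr _ _ ?_
        filter_upwards [Lp.coeFn_add f g] with x hx
        rw [hx]
        simp [mul_add]
      map_smul' := fun c f => by
        rw [RingHom.id_apply, ← MemLp.toLp_const_smul]
        refine MemLp.toLp_congr _ _ ?_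
        filter_upwards [Lp.coeFn_smul c f] with x hx
        rw [hx]
        simp [mul_left_comm] } ‖m‖ fun f => by
    refine Lp.norm_le_mul_norm_of_ae_le_mul ?_
    filter_upwards [(memLp_bcf_mul m f).coeFn_toLp] with x hx
    change ‖(memLp_bcf_mul m f).toLp _ x‖ ≤ _
    rw [hx, norm_mul]
    gcongr
    exact m.norm_coe_le_norm x

theorem coeFn_mulOp (m : HorizSpace d →ᵇ ℂ) (f : LTwo d) :
    mulOp m f =ᵐ[volume] fun x => m x * f x :=
  (memLp_bcf_mul m f).coeFn_toLp

theorem norm_mulOp_le (m : HorizSpace d →ᵇ ℂ) : ‖mulOp m‖ ≤ ‖m‖ :=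
  LinearMap.mkContinuous_norm_le _ (norm_nonneg m) _

theorem mulOp_mul (m m' : HorizSpace d →ᵇ ℂ) : mulOp (m * m') = mulOp m ∘L mulOp m' := by
  ext1 f
  refine Lp.ext ?_
  rw [ContinuousLinearMap.comp_apply]
  filter_upwards [coeFn_mulOp (m * m') f, coeFn_mulOp m (mulOp m' f), coeFn_mulOp m' f]
    with x h1 h2 h3
  rw [h1, h2, h3, BoundedContinuousFunction.mul_apply, mul_assoc]

theorem mulOp_one : mulOp (1 : HorizSpace d →ᵇ ℂ) = ContinuousLinearMap.id ℂ _ := by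
  ext1 f
  refine Lp.ext ?_
  filter_upwards [coeFn_mulOp 1 f] with x h1
  rw [h1]
  simp

/-- The Fourier multiplier with bounded continuous symbol `g`, in the Fourier variable
of Mathlib's normalisation. -/
noncomputable def fourierMultOp (g : HorizSpace d →ᵇ ℂ) : LTwo d →L[ℂ] LTwo d :=
  (Lp.fourierTransformₗᵢ (HorizSpace d) ℂ).symm.toContinuousLinearEquiv.toContinuousLinearMap ∘L
    mulOp g ∘L (Lp.fourierTransformₗᵢ (HorizSpace d) ℂ).toContinuousLinearEquiv.toContinuousLinearMap

theorem fourierMultOp_apply (g : HorizSpace d →ᵇ ℂ) (f : LTwo d) :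
    fourierMultOp g f = 𝓕⁻ (mulOp g (𝓕 f)) := rfl

theorem fourier_fourierMultOp (g : HorizSpace d →ᵇ ℂ) (f : LTwo d) :
    𝓕 (fourierMultOp g f) = mulOp g (𝓕 f) := by
  rw [fourierMultOp_apply, fourier_fourierInv_eq]

theorem norm_fourierMultOp_le (g : HorizSpace d →ᵇ ℂ) : ‖fourierMultOp g‖ ≤ ‖g‖ := by
  refine ContinuousLinearMap.opNorm_le_bound _ (norm_nonneg g) fun f => ?_
  rw [← Lp.norm_fourier_eq, fourier_fourierMultOp, ← Lp.norm_fourier_eq f]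
  exact (mulOp g).le_of_opNorm_le (norm_mulOp_le g) _

/-! ### The `L²` inverse Fourier transform of an integrable function -/

/-- On `L¹ ∩ L²` the inverse Fourier transform of `L²` is given by the integral: both have the same
pairing with test functions. -/
theorem coeFn_fourierInv_of_integrable (f : LTwo d) (hf : Integrable f) :
    (𝓕⁻ f : LTwo d) =ᵐ[volume] 𝓕⁻ (f : HorizSpace d → ℂ) := by
  have hL : Continuous fun p : HorizSpace d × HorizSpace d =>
      ((-innerₗ (HorizSpace d)) p.1) p.2 := by
    have : Continuous fun p : HorizSpace d × HorizSpace d => -inner ℝ p.1 p.2 := by fun_prop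
    simpa using this
  have hcont : Continuous (𝓕⁻ (f : HorizSpace d → ℂ)) :=
    VectorFourier.fourierIntegral_continuous Real.continuous_fourierChar hL hf
  refine ae_eq_of_integral_contDiff_smul_eq
    ((Lp.memLp (𝓕⁻ f : LTwo d)).locallyIntegrable one_le_two) hcont.locallyIntegrable
    fun g hg hgc => ?_
  have hg₁ : HasCompactSupport (Complex.ofRealCLM ∘ g) := hgc.comp_left rfl
  have hg₂ : ContDiff ℝ ∞ (Complex.ofRealCLM ∘ g) := by fun_prop
  set φ : 𝓢(HorizSpace d, ℂ) := hg₁.toSchwartzMap hg₂ with hφ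
  have hφg : ∀ x, φ x = g x := fun x => rfl
  have h1 : ∫ x, φ x • (𝓕⁻ f : LTwo d) x = ∫ x, (𝓕⁻ φ) x • f x := by
    have := DFunLike.congr_fun (Lp.fourierInv_toTemperedDistribution_eq f) φ
    rw [TemperedDistribution.fourierInv_apply, Lp.toTemperedDistribution_apply,
      Lp.toTemperedDistribution_apply] at this
    exact this.symm
  have h2 : ∫ x, (𝓕⁻ φ) x • f x = ∫ x, φ x • 𝓕⁻ (f : HorizSpace d → ℂ) x := by
    have := VectorFourier.integral_fourierIntegral_smul_eq_flip (L := -innerₗ (HorizSpace d))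
      (μ := volume) (ν := volume) (e := Real.fourierChar) (f := φ) (g := f)
      Real.continuous_fourierChar hL φ.integrable hf
    rw [SchwartzMap.fourierInv_coe]
    have hflip : (-innerₗ (HorizSpace d)).flip = -innerₗ (HorizSpace d) := by
      ext x y
      simp [real_inner_comm]
    rw [hflip] at this
    exact this
  calc ∫ x, g x • (𝓕⁻ f : LTwo d) x = ∫ x, φ x • (𝓕⁻ f : LTwo d) x := by
        simp [hφg]
    _ = ∫ x, φ x • 𝓕⁻ (f : HorizSpace d → ℂ) x := h1.trans h2
    _ = _ := by simp [hφg]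

/-- The action on a Schwartz function of a convergent series of products of a multiplication
operator and a Fourier multiplier is that of the pseudo-differential operator with the
corresponding symbol. -/
theorem coeFn_tsum_mulOp_comp_fourierMultOp {m g : ℕ → HorizSpace d →ᵇ ℂ}
    (hs : Summable fun n => ‖m n‖ * ‖g n‖) {L : HorizSpace d → HorizSpace d → ℝ}
    (hL : ∀ X η, (L X ((2 * Real.pi) • η) : ℂ) = ∑' n, m n X * g n η)
    (u : 𝓢(HorizSpace d, ℂ)) :
    (∑' n, mulOp (m n) ∘L fourierMultOp (g n)) (u.toLp 2) =ᵐ[volume] pseudoOp L u := by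
  set v : LTwo d := u.toLp 2 with hv
  have hbound : ∀ n, ‖mulOp (m n) ∘L fourierMultOp (g n)‖ ≤ ‖m n‖ * ‖g n‖ := fun n =>
    (ContinuousLinearMap.opNorm_comp_le _ _).trans
      (mul_le_mul (norm_mulOp_le _) (norm_fourierMultOp_le _) (norm_nonneg _) (norm_nonneg _))
  have hT : Summable fun n => mulOp (m n) ∘L fourierMultOp (g n) :=
    .of_norm_bounded hs hbound
  have happ : (∑' n, mulOp (m n) ∘L fourierMultOp (g n)) v =
      ∑' n, (mulOp (m n) ∘L fourierMultOp (g n)) v :=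
    (ContinuousLinearMap.apply ℂ (LTwo d) v : (LTwo d →L[ℂ] LTwo d) →L[ℂ] LTwo d).map_tsum hT
  have hfin : ∑' n, ‖(mulOp (m n) ∘L fourierMultOp (g n)) v‖ₑ ≠ ⊤ := by
    have hsn : Summable fun n => ‖(mulOp (m n) ∘L fourierMultOp (g n)) v‖ :=
      .of_nonneg_of_le (fun _ => norm_nonneg _)
        (fun n => ContinuousLinearMap.le_of_opNorm_le _ (hbound n) _) (hs.mul_right ‖v‖)
    simp_rw [← ofReal_norm]
    exact hsn.tsum_ofReal_ne_top
  have hint : ∀ n, Integrable fun η => g n η * (𝓕 u) η := fun n =>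
    (𝓕 u).integrable.bdd_mul (c := ‖g n‖) (g n).continuous.aestronglyMeasurable
      (.of_forall fun x => (g n).norm_coe_le_norm x)
  have hterm : ∀ n, (mulOp (m n) ∘L fourierMultOp (g n)) v =ᵐ[volume]
      fun X => m n X * 𝓕⁻ (fun η => g n η * (𝓕 u) η) X := fun n => by
    have hV : mulOp (g n) (𝓕 v : LTwo d) =ᵐ[volume] fun η => g n η * (𝓕 u) η := by
      rw [hv, SchwartzMap.toLp_fourier_eq]
      filter_upwards [coeFn_mulOp (g n) ((𝓕 u).toLp 2), (𝓕 u).coeFn_toLp 2] with η h1 h2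
      rw [h1, h2]
    have hVi := (hint n).congr hV.symm
    filter_upwards [coeFn_mulOp (m n) (fourierMultOp (g n) v),
      coeFn_fourierInv_of_integrable _ hVi] with X h1 h2
    rw [ContinuousLinearMap.comp_apply, h1, fourierMultOp_apply, h2, Real.fourierInv_congr_ae hV]
  rw [happ]
  filter_upwards [Lp.hasSum_coeFn_tsum hfin, ae_all_iff.2 hterm] with X h1 h2
  refine h1.unique ?_
  simp_rw [h2]
  -- the pointwise series, by dominated convergence
  have hF : ∀ n, m n X * 𝓕⁻ (fun η => g n η * (𝓕 u) η) X =
      ∫ η, m n X * (Real.fourierChar (inner ℝ η X) • (g n η * (𝓕 u) η)) := fun n => by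
    rw [integral_const_mul, Real.fourierInv_eq]
  have hsum := hasSum_integral_of_summable_integral_norm (μ := volume)
    (F := fun n (η : HorizSpace d) =>
      m n X * (Real.fourierChar (inner ℝ η X) • (g n η * (𝓕 u) η))) (fun n => ?_) ?_
  · simp_rw [hF]
    convert! hsum using 1
    rw [pseudoOp, Real.fourierInv_eq]
    refine integral_congr_ae (.of_forall fun η => ?_)
    simp only [hL]
    simp_rw [Circle.smul_def, smul_eq_mul]
    rw [← tsum_mul_right, ← tsum_mul_left]
    refine tsum_congr fun n => ?_
    ring
  · refine Integrable.const_mul ?_ _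
    refine ((Real.fourierIntegral_convergent_iff (-X)).2 (hint n)).congr (.of_forall fun η => ?_)
    simp
  · refine .of_nonneg_of_le (fun _ => integral_nonneg fun _ => norm_nonneg _) (fun n => ?_)
      (hs.mul_right (∫ η, ‖(𝓕 u) η‖))
    rw [← integral_const_mul]
    refine integral_mono_of_nonneg (.of_forall fun _ => norm_nonneg _)
      ((𝓕 u).integrable.norm.const_mul _) (.of_forall fun η => ?_)
    simp only [norm_mul, Circle.norm_smul]
    rw [mul_assoc]
    have h1 := (m n).norm_coe_le_norm X
    have h2 := (g n).norm_coe_le_norm η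
    gcongr

/-! ### Sobolev bounds for operators on `L²` -/

/-- The weight `(1 + |2πη|²)^(s/2)` in the Sobolev norm. -/
noncomputable def sobolevWeight (s : ℝ) (η : HorizSpace d) : ℝ :=
  (1 + ‖(2 * Real.pi) • η‖ ^ 2) ^ (s / 2)

theorem one_add_norm_sq_pos (η : HorizSpace d) : 0 < 1 + ‖(2 * Real.pi) • η‖ ^ 2 := by positivity

theorem sobolevWeight_pos (s : ℝ) (η : HorizSpace d) : 0 < sobolevWeight s η :=
  Real.rpow_pos_of_pos (one_add_norm_sq_pos η) _

theorem continuous_sobolevWeight (s : ℝ) : Continuous (sobolevWeight (d := d) s) :=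
  Continuous.rpow_const (by fun_prop) fun η => .inl (one_add_norm_sq_pos η).ne'

theorem sobolevWeight_add (s t : ℝ) (η : HorizSpace d) :
    sobolevWeight (s + t) η = sobolevWeight s η * sobolevWeight t η := by
  rw [sobolevWeight, add_div, Real.rpow_add (one_add_norm_sq_pos η)]
  rfl

theorem sobolevWeight_zero (η : HorizSpace d) : sobolevWeight 0 η = 1 := by
  simp [sobolevWeight]

theorem sobolevWeight_mono {s t : ℝ} (hst : s ≤ t) (η : HorizSpace d) :
    sobolevWeight s η ≤ sobolevWeight t η :=
  Real.rpow_le_rpow_of_exponent_le (by nlinarith [norm_nonneg ((2 * Real.pi) • η)]) (by linarith)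

theorem sobolevNorm_of_memLp (s : ℝ) {f : HorizSpace d → ℂ} (hf : MemLp f 2 volume) :
    sobolevNorm s f = eLpNorm (fun η => (sobolevWeight s η : ℂ) * (𝓕 (hf.toLp f) : LTwo d) η) 2
      volume := by
  rw [sobolevNorm, dif_pos hf]
  rfl

theorem sobolevNorm_coe (s : ℝ) (f : LTwo d) :
    sobolevNorm s f = eLpNorm (fun η => (sobolevWeight s η : ℂ) * (𝓕 f : LTwo d) η) 2 volume := by
  rw [sobolevNorm_of_memLp s (Lp.memLp f), Lp.toLp_coeFn]

theorem sobolevNorm_congr_ae (s : ℝ) {f g : HorizSpace d → ℂ} (h : f =ᵐ[volume] g) :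
    sobolevNorm s f = sobolevNorm s g := by
  by_cases hf : MemLp f 2 volume
  · rw [sobolevNorm_of_memLp s hf, sobolevNorm_of_memLp s (hf.ae_eq h),
      MemLp.toLp_congr hf (hf.ae_eq h) h]
  · have hg : ¬ MemLp g 2 volume := fun hg => hf (hg.ae_eq h.symm)
    rw [sobolevNorm, sobolevNorm, dif_neg hf, dif_neg hg]

theorem sobolevNorm_schwartz (s : ℝ) (u : 𝓢(HorizSpace d, ℂ)) :
    sobolevNorm s u = eLpNorm (fun η => (sobolevWeight s η : ℂ) * (𝓕 u) η) 2 volume := by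
  rw [← sobolevNorm_congr_ae s (u.coeFn_toLp 2), sobolevNorm_coe, SchwartzMap.toLp_fourier_eq]
  refine eLpNorm_congr_ae ?_
  filter_upwards [(𝓕 u).coeFn_toLp 2] with η h
  rw [h]

theorem aestronglyMeasurable_weight_mul (s : ℝ) (f : LTwo d) :
    AEStronglyMeasurable (fun η => (sobolevWeight s η : ℂ) * f η) volume :=
  (Complex.continuous_ofReal.comp (continuous_sobolevWeight s)).aestronglyMeasurable.mul
    (Lp.aestronglyMeasurable f)

theorem sobolevNorm_add_le (s : ℝ) (f g : LTwo d) :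
    sobolevNorm s (f + g : LTwo d) ≤ sobolevNorm s f + sobolevNorm s g := by
  simp_rw [sobolevNorm_coe, FourierTransform.fourier_add]
  refine le_trans (le_of_eq ?_) (eLpNorm_add_le (aestronglyMeasurable_weight_mul s (𝓕 f))
    (aestronglyMeasurable_weight_mul s (𝓕 g)) one_le_two)
  refine eLpNorm_congr_ae ?_
  filter_upwards [Lp.coeFn_add (𝓕 f : LTwo d) (𝓕 g)] with η h
  rw [h]
  simp [mul_add]

theorem sobolevNorm_zero_coe (s : ℝ) : sobolevNorm s (0 : LTwo d) = 0 := by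
  have h0 : (𝓕 (0 : LTwo d) : LTwo d) = 0 := (Lp.fourierTransformₗᵢ (HorizSpace d) ℂ).map_zero
  rw [sobolevNorm_coe, h0, ← eLpNorm_zero (ε := ℂ) (p := 2) (μ := (volume : Measure (HorizSpace d)))]
  refine eLpNorm_congr_ae ?_
  filter_upwards [Lp.coeFn_zero ℂ 2 (volume : Measure (HorizSpace d))] with η h
  rw [h]
  simp

theorem sobolevNorm_smul (s : ℝ) (c : ℂ) (f : LTwo d) :
    sobolevNorm s (c • f : LTwo d) = ‖c‖ₑ * sobolevNorm s f := by
  simp_rw [sobolevNorm_coe, FourierTransform.fourier_smul]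
  rw [← eLpNorm_const_smul]
  refine eLpNorm_congr_ae ?_
  filter_upwards [Lp.coeFn_smul c (𝓕 f : LTwo d)] with η h
  rw [h]
  simp [mul_left_comm]

theorem sobolevNorm_sum_le (s : ℝ) (f : ℕ → LTwo d) (N : ℕ) :
    sobolevNorm s (∑ n ∈ Finset.range N, f n : LTwo d) ≤
      ∑ n ∈ Finset.range N, sobolevNorm s (f n) := by
  induction N with
  | zero => exact (sobolevNorm_zero_coe s).le.trans zero_le
  | succ N ih =>
    rw [Finset.sum_range_succ, Finset.sum_range_succ]
    exact (sobolevNorm_add_le s _ _).trans (by gcongr)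

/-- The Sobolev norms are lower semicontinuous on `L²`, by Fatou's lemma on the Fourier side. -/
theorem sobolevNorm_le_of_tendsto (s : ℝ) {F : ℕ → LTwo d} {f : LTwo d}
    (hF : Tendsto F atTop (𝓝 f)) {c : ℝ≥0∞} (hc : ∀ N, sobolevNorm s (F N) ≤ c) :
    sobolevNorm s f ≤ c := by
  have hF' : Tendsto (fun N => (𝓕 (F N) : LTwo d)) atTop (𝓝 (𝓕 f)) :=
    ((Lp.fourierTransformₗᵢ (HorizSpace d) ℂ).continuous.tendsto f).comp hF
  obtain ⟨φ, -, hφ⟩ := (tendstoInMeasure_of_tendsto_Lp hF').exists_seq_tendsto_ae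
  rw [sobolevNorm_coe]
  refine (Lp.eLpNorm_lim_le_liminf_eLpNorm
    (f := fun N η => (sobolevWeight s η : ℂ) * (𝓕 (F (φ N)) : LTwo d) η)
    (fun N => aestronglyMeasurable_weight_mul s _) _ ?_).trans ?_
  · filter_upwards [hφ] with η h
    exact h.const_mul _
  · refine liminf_le_of_le (by isBoundedDefault) fun b hb => ?_
    obtain ⟨N, hN⟩ := hb.exists
    refine hN.trans ?_
    rw [← sobolevNorm_coe]
    exact hc _

/-- The operator `T` maps `H^s` to itself with norm at most `A`. -/
def SobolevBound (s : ℝ) (T : LTwo d →L[ℂ] LTwo d) (A : ℝ) : Prop :=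
  ∀ f : LTwo d, sobolevNorm s (T f) ≤ ENNReal.ofReal A * sobolevNorm s f

theorem SobolevBound.mono {s : ℝ} {T : LTwo d →L[ℂ] LTwo d} {A B : ℝ} (h : SobolevBound s T A)
    (hAB : A ≤ B) : SobolevBound s T B := fun f =>
  (h f).trans (by gcongr)

theorem SobolevBound.comp {s : ℝ} {T S : LTwo d →L[ℂ] LTwo d} {A B : ℝ}
    (hT : SobolevBound s T A) (hS : SobolevBound s S B) (hA : 0 ≤ A) :
    SobolevBound s (T ∘L S) (A * B) := fun f => by
  rw [ENNReal.ofReal_mul hA, mul_assoc]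
  exact (hT (S f)).trans (by gcongr; exact hS f)

theorem sobolevBound_id (s : ℝ) : SobolevBound s (ContinuousLinearMap.id ℂ (LTwo d)) 1 :=
  fun f => by simp

theorem SobolevBound.tsum {s : ℝ} {T : ℕ → LTwo d →L[ℂ] LTwo d} {A : ℕ → ℝ}
    (hT : ∀ n, SobolevBound s (T n) (A n)) (hs : Summable T) (hA : Summable A)
    (hA0 : ∀ n, 0 ≤ A n) : SobolevBound s (∑' n, T n) (∑' n, A n) := fun f => by
  have hf : HasSum (fun n => T n f) ((∑' n, T n) f) :=
    (ContinuousLinearMap.apply ℂ (LTwo d) f).hasSum hs.hasSum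
  refine sobolevNorm_le_of_tendsto s hf.tendsto_sum_nat fun N => ?_
  calc sobolevNorm s (∑ n ∈ Finset.range N, T n f : LTwo d)
      ≤ ∑ n ∈ Finset.range N, sobolevNorm s (T n f) := sobolevNorm_sum_le s _ N
    _ ≤ ∑ n ∈ Finset.range N, ENNReal.ofReal (A n) * sobolevNorm s f :=
        Finset.sum_le_sum fun n _ => hT n f
    _ = ENNReal.ofReal (∑ n ∈ Finset.range N, A n) * sobolevNorm s f := by
        rw [← Finset.sum_mul, ENNReal.ofReal_sum_of_nonneg fun n _ => hA0 n]
    _ ≤ _ := by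
        gcongr
        exact hA.sum_le_tsum _ fun n _ => hA0 n

theorem sobolevBound_fourierMultOp (s : ℝ) {g : HorizSpace d →ᵇ ℂ} (hg : ‖g‖ ≤ 1) :
    SobolevBound s (fourierMultOp g) 1 := fun f => by
  rw [ENNReal.ofReal_one, one_mul, sobolevNorm_coe, sobolevNorm_coe, fourier_fourierMultOp]
  refine eLpNorm_mono_ae ?_
  filter_upwards [coeFn_mulOp g (𝓕 f)] with η h
  rw [h, norm_mul, norm_mul, norm_mul]
  gcongr
  exact mul_le_of_le_one_left (norm_nonneg _) ((g.norm_coe_le_norm η).trans hg)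

/-! ### Convolution estimates for nonnegative functions -/

theorem lintegral_mul_le_eLpNorm_two {f g : HorizSpace d → ℝ≥0∞} (hf : Measurable f)
    (hg : Measurable g) :
    ∫⁻ x, f x * g x ≤ eLpNorm f 2 volume * eLpNorm g 2 volume := by
  have := ENNReal.lintegral_mul_le_Lp_mul_Lq (volume : Measure (HorizSpace d))
    Real.HolderConjugate.two_two hf.aemeasurable hg.aemeasurable
  simpa [eLpNorm_eq_lintegral_rpow_enorm_toReal two_ne_zero ENNReal.ofNat_ne_top] using this

theorem eLpNorm_two_sq (f : HorizSpace d → ℝ≥0∞) :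
    eLpNorm f 2 volume ^ 2 = ∫⁻ x, f x ^ 2 := by
  rw [eLpNorm_eq_lintegral_rpow_enorm_toReal two_ne_zero ENNReal.ofNat_ne_top,
    ← ENNReal.rpow_natCast, ← ENNReal.rpow_mul]
  simp

theorem measurable_comp_neg_add {g : HorizSpace d → ℝ≥0∞} (hg : Measurable g)
    (x : HorizSpace d) : Measurable fun t => g (-t + x) :=
  hg.comp (measurable_neg.add_const x)

/-- Young's inequality `L¹ ⋆ L² ⊆ L²`. -/
theorem eLpNorm_lconvolution_le {k g : HorizSpace d → ℝ≥0∞} (hk : Measurable k)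
    (hg : Measurable g) :
    eLpNorm (lconvolution k g volume) 2 volume ≤ (∫⁻ x, k x) * eLpNorm g 2 volume := by
  have hpt : ∀ x, lconvolution k g volume x ^ 2 ≤
      (∫⁻ t, k t) * ∫⁻ t, k t * g (-t + x) ^ 2 := fun x => by
    have hgx : Measurable fun t => g (-t + x) := hg.comp (by fun_prop)
    have h1 := lintegral_mul_le_eLpNorm_two (f := fun t => k t ^ (1 / 2 : ℝ))
      (g := fun t => k t ^ (1 / 2 : ℝ) * g (-t + x)) (hk.pow_const _) ((hk.pow_const _).mul hgx)
    have hsq : ∀ a : ℝ≥0∞, a ^ (1 / 2 : ℝ) * a ^ (1 / 2 : ℝ) = a := fun a => by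
      rw [← ENNReal.rpow_add_of_nonneg _ _ (by norm_num) (by norm_num)]
      norm_num
    calc lconvolution k g volume x ^ 2
        = (∫⁻ t, k t ^ (1 / 2 : ℝ) * (k t ^ (1 / 2 : ℝ) * g (-t + x))) ^ 2 := by
          simp_rw [← mul_assoc, hsq]
          rfl
      _ ≤ (eLpNorm (fun t => k t ^ (1 / 2 : ℝ)) 2 volume *
          eLpNorm (fun t => k t ^ (1 / 2 : ℝ) * g (-t + x)) 2 volume) ^ 2 := by gcongr
      _ = _ := by
          rw [mul_pow, eLpNorm_two_sq, eLpNorm_two_sq]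
          simp_rw [mul_pow, pow_two (_ ^ (1 / 2 : ℝ)), hsq]
  have hsq : eLpNorm (lconvolution k g volume) 2 volume ^ 2 ≤
      ((∫⁻ x, k x) * eLpNorm g 2 volume) ^ 2 := by
    rw [eLpNorm_two_sq, mul_pow, eLpNorm_two_sq]
    calc ∫⁻ x, lconvolution k g volume x ^ 2
        ≤ ∫⁻ x, (∫⁻ t, k t) * ∫⁻ t, k t * g (-t + x) ^ 2 := lintegral_mono hpt
      _ = (∫⁻ t, k t) * ∫⁻ x, ∫⁻ t, k t * g (-t + x) ^ 2 := by
          refine lintegral_const_mul _ (Measurable.lintegral_prod_right ?_)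
          exact (hk.comp measurable_snd).mul ((hg.comp (by fun_prop)).pow_const _)
      _ = (∫⁻ t, k t) * ∫⁻ t, ∫⁻ x, k t * g (-t + x) ^ 2 := by
          rw [lintegral_lintegral_swap]
          exact ((hk.comp measurable_snd).mul ((hg.comp (by fun_prop)).pow_const _)).aemeasurable
      _ = (∫⁻ t, k t) * ∫⁻ t, k t * ∫⁻ x, g x ^ 2 := by
          congr 2
          ext t
          have hgt : Measurable fun x => g (-t + x) ^ 2 :=
            (hg.comp (measurable_const_add (-t))).pow_const 2
          rw [lintegral_const_mul _ hgt, lintegral_add_left_eq_self (fun x => g x ^ 2)]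
      _ = _ := by
          rw [lintegral_mul_const _ hk, pow_two, mul_assoc]
  exact (ENNReal.pow_le_pow_left_iff two_ne_zero).1 hsq

/-- The Sobolev weight as a nonnegative extended real. -/
noncomputable def sobolevEWeight (s : ℝ) (η : HorizSpace d) : ℝ≥0∞ :=
  ENNReal.ofReal (sobolevWeight s η)

theorem measurable_sobolevEWeight (s : ℝ) : Measurable (sobolevEWeight (d := d) s) :=
  (continuous_sobolevWeight s).measurable.ennreal_ofReal

theorem sobolevEWeight_add (s t : ℝ) (η : HorizSpace d) :
    sobolevEWeight (s + t) η = sobolevEWeight s η * sobolevEWeight t η := by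
  rw [sobolevEWeight, sobolevWeight_add, ENNReal.ofReal_mul (sobolevWeight_pos _ _).le]
  rfl

theorem sobolevEWeight_zero (η : HorizSpace d) : sobolevEWeight 0 η = 1 := by
  simp [sobolevEWeight, sobolevWeight_zero]

theorem sobolevEWeight_mono {s t : ℝ} (hst : s ≤ t) (η : HorizSpace d) :
    sobolevEWeight s η ≤ sobolevEWeight t η :=
  ENNReal.ofReal_le_ofReal (sobolevWeight_mono hst η)

/-- The weights of order `s ≥ 0` are subadditive up to a constant. -/
theorem sobolevEWeight_le_add {s : ℝ} (hs : 0 ≤ s) (x t : HorizSpace d) :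
    sobolevEWeight s x ≤ ENNReal.ofReal (4 ^ (s / 2)) *
      (sobolevEWeight s t + sobolevEWeight s (-t + x)) := by
  have hx : (2 * Real.pi) • x = (2 * Real.pi) • t + (2 * Real.pi) • (-t + x) := by
    rw [← smul_add, add_neg_cancel_left]
  unfold sobolevEWeight
  rw [← ENNReal.ofReal_add (sobolevWeight_pos _ _).le (sobolevWeight_pos _ _).le,
    ← ENNReal.ofReal_mul (by positivity)]
  refine ENNReal.ofReal_le_ofReal ?_
  have ht := sobolevWeight_pos s t
  have htx := sobolevWeight_pos s (-t + x)
  unfold sobolevWeight at *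
  rw [hx]
  generalize (2 * Real.pi) • t = a at *
  generalize (2 * Real.pi) • (-t + x) = b at *
  have hab : ‖a + b‖ ^ 2 ≤ 2 * ‖a‖ ^ 2 + 2 * ‖b‖ ^ 2 := by
    have := norm_add_le a b
    nlinarith [norm_nonneg (a + b), sq_nonneg (‖a‖ - ‖b‖)]
  rcases le_total ‖a‖ ‖b‖ with h | h
  · calc (1 + ‖a + b‖ ^ 2) ^ (s / 2) ≤ (4 * (1 + ‖b‖ ^ 2)) ^ (s / 2) := by
          gcongr
          nlinarith [norm_nonneg a]
      _ = 4 ^ (s / 2) * (1 + ‖b‖ ^ 2) ^ (s / 2) := Real.mul_rpow (by norm_num) (by positivity)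
      _ ≤ _ := by gcongr; linarith
  · calc (1 + ‖a + b‖ ^ 2) ^ (s / 2) ≤ (4 * (1 + ‖a‖ ^ 2)) ^ (s / 2) := by
          gcongr
          nlinarith [norm_nonneg b]
      _ = 4 ^ (s / 2) * (1 + ‖a‖ ^ 2) ^ (s / 2) := Real.mul_rpow (by norm_num) (by positivity)
      _ ≤ _ := by gcongr; linarith

/-- In a convolution the weight falls on either factor. -/
theorem eLpNorm_weight_mul_lconvolution_le {s : ℝ} (hs : 0 ≤ s) {k g : HorizSpace d → ℝ≥0∞}
    (hk : Measurable k) (hg : Measurable g) :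
    eLpNorm (fun x => sobolevEWeight s x * lconvolution k g volume x) 2 volume ≤
      ENNReal.ofReal (4 ^ (s / 2)) *
        ((∫⁻ x, g x) * eLpNorm (fun x => sobolevEWeight s x * k x) 2 volume +
          (∫⁻ x, k x) * eLpNorm (fun x => sobolevEWeight s x * g x) 2 volume) := by
  have hw := measurable_sobolevEWeight (d := d) s
  have hwk : Measurable fun x => sobolevEWeight s x * k x := hw.mul hk
  have hwg : Measurable fun x => sobolevEWeight s x * g x := hw.mul hg
  set c := ENNReal.ofReal (4 ^ (s / 2)) with hc
  have hpt : ∀ x, sobolevEWeight s x * lconvolution k g volume x ≤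
      c * (lconvolution g (fun x => sobolevEWeight s x * k x) volume +
        lconvolution k (fun x => sobolevEWeight s x * g x) volume) x := fun x => by
    rw [lconvolution_comm (f := g), Pi.add_apply]
    unfold lconvolution
    have h1 : Measurable fun t => k t * g (-t + x) := hk.mul (measurable_comp_neg_add hg x)
    have h2 : Measurable fun t => sobolevEWeight s t * k t * g (-t + x) :=
      hwk.mul (measurable_comp_neg_add hg x)
    have h3 : Measurable fun t => k t * (sobolevEWeight s (-t + x) * g (-t + x)) :=
      hk.mul (measurable_comp_neg_add hwg x)
    rw [← lintegral_const_mul _ h1, ← lintegral_add_left h2,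
      ← lintegral_const_mul' c _ ENNReal.ofReal_ne_top]
    refine lintegral_mono fun t => ?_
    calc sobolevEWeight s x * (k t * g (-t + x))
        ≤ c * (sobolevEWeight s t + sobolevEWeight s (-t + x)) * (k t * g (-t + x)) := by
          gcongr
          exact sobolevEWeight_le_add hs x t
      _ = _ := by ring
  have hm1 : Measurable (lconvolution g (fun x => sobolevEWeight s x * k x) volume) :=
    measurable_lconvolution _ hg hwk
  have hm2 : Measurable (lconvolution k (fun x => sobolevEWeight s x * g x) volume) :=
    measurable_lconvolution _ hk hwg
  calc _ ≤ eLpNorm (fun x => c * (lconvolution g (fun x => sobolevEWeight s x * k x) volume +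
        lconvolution k (fun x => sobolevEWeight s x * g x) volume) x) 2 volume :=
        eLpNorm_mono_enorm fun x => by simpa using hpt x
    _ ≤ c * eLpNorm (lconvolution g (fun x => sobolevEWeight s x * k x) volume +
        lconvolution k (fun x => sobolevEWeight s x * g x) volume) 2 volume :=
        eLpNorm_le_mul_eLpNorm_of_ae_le_mul'' 2 (hm1.add hm2).aestronglyMeasurable
          (.of_forall fun x => by simp)
    _ ≤ _ := by
        gcongr
        refine (eLpNorm_add_le hm1.aestronglyMeasurable hm2.aestronglyMeasurable one_le_two).trans ?_
        exact add_le_add (eLpNorm_lconvolution_le hg hwk) (eLpNorm_lconvolution_le hk hwg)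

theorem eLpNorm_sobolevEWeight_neg_lt_top {τ : ℝ} (hτ : (d : ℝ) / 2 < τ) :
    eLpNorm (sobolevEWeight (d := d) (-τ)) 2 volume < ⊤ := by
  have h1 : Integrable fun x : HorizSpace d => (1 + ‖x‖ ^ 2) ^ (-(2 * τ) / 2) :=
    integrable_rpow_neg_one_add_norm_sq (by rw [finrank_euclideanSpace_fin]; linarith)
  have h2 := h1.comp_smul (R := 2 * Real.pi) (by positivity)
  have h3 : eLpNorm (sobolevEWeight (d := d) (-τ)) 2 volume ^ 2 < ⊤ := by
    rw [eLpNorm_two_sq]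
    refine lt_of_le_of_lt (le_of_eq ?_) h2.lintegral_lt_top
    refine lintegral_congr fun η => ?_
    rw [sobolevEWeight, ← ENNReal.ofReal_pow (sobolevWeight_pos _ _).le, sobolevWeight,
      ← Real.rpow_natCast, ← Real.rpow_mul (one_add_norm_sq_pos η).le]
    congr 2
    push_cast
    ring
  exact (ENNReal.pow_lt_top_iff.1 h3).resolve_right two_ne_zero

/-- Weighted `L²` functions are integrable when the weight is large enough. -/
theorem lintegral_le_mul_eLpNorm_weight (τ : ℝ) {h : HorizSpace d → ℝ≥0∞} (hh : Measurable h) :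
    ∫⁻ η, h η ≤ eLpNorm (sobolevEWeight (d := d) (-τ)) 2 volume *
      eLpNorm (fun η => sobolevEWeight τ η * h η) 2 volume := by
  calc ∫⁻ η, h η = ∫⁻ η, sobolevEWeight (-τ) η * (sobolevEWeight τ η * h η) := by
        refine lintegral_congr fun η => ?_
        rw [← mul_assoc, ← sobolevEWeight_add, neg_add_cancel, sobolevEWeight_zero, one_mul]
    _ ≤ _ := lintegral_mul_le_eLpNorm_two (measurable_sobolevEWeight _)
        ((measurable_sobolevEWeight _).mul hh)

/-- Interpolation: the integral is controlled by the geometric mean of the `L²` norm and of a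
weighted `L²` norm. -/
theorem sq_lintegral_le_mul_eLpNorm_mul_eLpNorm (σ : ℝ) {h : HorizSpace d → ℝ≥0∞}
    (hh : Measurable h) :
    (∫⁻ η, h η) ^ 2 ≤ eLpNorm (sobolevEWeight (d := d) (-(σ / 2))) 2 volume ^ 2 *
      (eLpNorm h 2 volume * eLpNorm (fun η => sobolevEWeight σ η * h η) 2 volume) := by
  calc (∫⁻ η, h η) ^ 2 ≤ (eLpNorm (sobolevEWeight (d := d) (-(σ / 2))) 2 volume *
        eLpNorm (fun η => sobolevEWeight (σ / 2) η * h η) 2 volume) ^ 2 := by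
        gcongr
        exact lintegral_le_mul_eLpNorm_weight _ hh
    _ = eLpNorm (sobolevEWeight (d := d) (-(σ / 2))) 2 volume ^ 2 *
        ∫⁻ η, h η * (sobolevEWeight σ η * h η) := by
        rw [mul_pow, eLpNorm_two_sq (fun η => _ * _)]
        congr 1
        refine lintegral_congr fun η => ?_
        rw [show σ = σ / 2 + σ / 2 by ring, sobolevEWeight_add]
        ring_nf
    _ ≤ _ := by
        gcongr
        exact lintegral_mul_le_eLpNorm_two hh ((measurable_sobolevEWeight _).mul hh)

/-! ### The Fourier transform of a product -/

theorem sobolevNorm_coe_eq_eLpNorm (s : ℝ) (f : LTwo d) :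
    sobolevNorm s f =
      eLpNorm (fun η => sobolevEWeight s η * ‖(𝓕 f : LTwo d) η‖ₑ) 2 volume := by
  rw [sobolevNorm_coe]
  refine eLpNorm_congr_enorm_ae (.of_forall fun η => ?_)
  rw [enorm_mul, enorm_eq_self, sobolevEWeight, ← ofReal_norm, Complex.norm_real,
    Real.norm_of_nonneg (sobolevWeight_pos _ _).le]

theorem sobolevNorm_schwartz_eq_eLpNorm (s : ℝ) (u : 𝓢(HorizSpace d, ℂ)) :
    sobolevNorm s u = eLpNorm (fun η => sobolevEWeight s η * ‖(𝓕 u) η‖ₑ) 2 volume := by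
  rw [sobolevNorm_schwartz]
  refine eLpNorm_congr_enorm_ae (.of_forall fun η => ?_)
  rw [enorm_mul, enorm_eq_self, sobolevEWeight, ← ofReal_norm, Complex.norm_real,
    Real.norm_of_nonneg (sobolevWeight_pos _ _).le]

theorem sobolevNorm_mono {s t : ℝ} (hst : s ≤ t) (u : 𝓢(HorizSpace d, ℂ)) :
    sobolevNorm s u ≤ sobolevNorm t u := by
  rw [sobolevNorm_schwartz_eq_eLpNorm, sobolevNorm_schwartz_eq_eLpNorm]
  refine eLpNorm_mono_enorm fun η => ?_
  rw [enorm_eq_self, enorm_eq_self]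
  gcongr
  exact sobolevEWeight_mono hst η

theorem eLpNorm_eq_eLpNorm_fourier (u : 𝓢(HorizSpace d, ℂ)) :
    eLpNorm u 2 volume = eLpNorm (fun η => ‖(𝓕 u) η‖ₑ) 2 volume := by
  have h := Lp.norm_fourier_eq (u.toLp 2 volume : LTwo d)
  rw [SchwartzMap.toLp_fourier_eq, SchwartzMap.norm_toLp, SchwartzMap.norm_toLp,
    ENNReal.toReal_eq_toReal_iff' ((𝓕 u).memLp 2 volume).2.ne (u.memLp 2 volume).2.ne] at h
  exact h.symm.trans (eLpNorm_enorm _).symm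

theorem sobolevNorm_schwartz_lt_top (s : ℝ) (u : 𝓢(HorizSpace d, ℂ)) :
    sobolevNorm s u < ⊤ := by
  have hg : (fun η : HorizSpace d => (sobolevWeight s η : ℂ)).HasTemperateGrowth := by
    have h1 := Function.hasTemperateGrowth_one_add_norm_sq_rpow (HorizSpace d) (s / 2)
    have h2 : (fun η : HorizSpace d => (2 * Real.pi) • η).HasTemperateGrowth := by fun_prop
    exact Complex.ofRealCLM.hasTemperateGrowth.comp (h1.comp h2)
  rw [sobolevNorm_schwartz]
  refine lt_of_le_of_lt (le_of_eq ?_) ((SchwartzMap.smulLeftCLM ℂ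
    (fun η : HorizSpace d => (sobolevWeight s η : ℂ)) (𝓕 u)).memLp 2).2
  refine eLpNorm_congr_ae (.of_forall fun η => ?_)
  simp [SchwartzMap.smulLeftCLM_apply_apply hg]

/-- The pointwise product of two Schwartz functions. -/
noncomputable def schwartzMul (m u : 𝓢(HorizSpace d, ℂ)) : 𝓢(HorizSpace d, ℂ) :=
  SchwartzMap.pairing (ContinuousLinearMap.mul ℂ ℂ) m u

theorem schwartzMul_apply (m u : 𝓢(HorizSpace d, ℂ)) (x : HorizSpace d) :
    schwartzMul m u x = m x * u x := rfl

theorem enorm_fourier_schwartzMul_le (m u : 𝓢(HorizSpace d, ℂ)) (x : HorizSpace d) :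
    ‖(𝓕 (schwartzMul m u)) x‖ₑ ≤
      lconvolution (fun η => ‖(𝓕 m) η‖ₑ) (fun η => ‖(𝓕 u) η‖ₑ) volume x := by
  have hneg : ∀ (v : 𝓢(HorizSpace d, ℂ)) (y : HorizSpace d), (𝓕⁻ v) y = (𝓕 v) (-y) := fun v y => by
    rw [SchwartzMap.fourierInv_coe, SchwartzMap.fourier_coe, Real.fourierInv_eq_fourier_neg]
  have h1 : (𝓕 (schwartzMul m u)) x =
      SchwartzMap.convolution (ContinuousLinearMap.mul ℂ ℂ) (𝓕⁻ m) (𝓕⁻ u) (-x) := by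
    have : SchwartzMap.convolution (ContinuousLinearMap.mul ℂ ℂ) (𝓕⁻ m) (𝓕⁻ u) =
        𝓕⁻ (schwartzMul m u) := by
      have h := SchwartzMap.fourier_convolution (ContinuousLinearMap.mul ℂ ℂ) (𝓕⁻ m) (𝓕⁻ u)
      rw [fourier_fourierInv_eq, fourier_fourierInv_eq] at h
      exact ((fourierInv_fourier_eq _).symm.trans (congrArg (fun v => 𝓕⁻ v) h) :)
    rw [this, hneg, neg_neg]
  rw [h1, SchwartzMap.convolution_apply]
  unfold convolution lconvolution
  refine (enorm_integral_le_lintegral_enorm _).trans_eq ?_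
  rw [← lintegral_neg_eq_self]
  refine lintegral_congr fun t => ?_
  rw [ContinuousLinearMap.mul_apply', enorm_mul, hneg, hneg, neg_neg]
  congr 4
  abel

theorem measurable_enorm_coe (f : LTwo d) : Measurable fun η => ‖f η‖ₑ :=
  (Lp.stronglyMeasurable f).enorm

theorem measurable_enorm_schwartz (u : 𝓢(HorizSpace d, ℂ)) : Measurable fun η => ‖u η‖ₑ :=
  u.continuous.measurable.enorm

theorem mulOp_toLp (m u : 𝓢(HorizSpace d, ℂ)) :
    mulOp m.toBoundedContinuousFunction (u.toLp 2 volume) = (schwartzMul m u).toLp 2 volume := by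
  refine Lp.ext ?_
  filter_upwards [coeFn_mulOp m.toBoundedContinuousFunction (u.toLp 2 volume),
    u.coeFn_toLp 2 volume, (schwartzMul m u).coeFn_toLp 2 volume] with x h1 h2 h3
  rw [h1, h2, h3]
  rfl

/-- The convolution bound for a Schwartz function `u` near `f`, in terms of `f` and `f - u`. -/
theorem enorm_fourier_mulOp_le_add (m u : 𝓢(HorizSpace d, ℂ)) (f g : LTwo d)
    (hfu : f = u.toLp 2 volume + g) :
    ∀ᵐ x, ‖(𝓕 (mulOp m.toBoundedContinuousFunction f) : LTwo d) x‖ₑ ≤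
      (‖(𝓕 (mulOp m.toBoundedContinuousFunction g) : LTwo d) x‖ₑ +
        lconvolution (fun η => ‖(𝓕 m) η‖ₑ) (fun η => ‖(𝓕 g : LTwo d) η‖ₑ) volume x) +
      lconvolution (fun η => ‖(𝓕 m) η‖ₑ) (fun η => ‖(𝓕 f : LTwo d) η‖ₑ) volume x := by
  have hkm : Measurable fun η => ‖(𝓕 m) η‖ₑ := measurable_enorm_schwartz _
  set M := mulOp m.toBoundedContinuousFunction with hM
  have e1 : (𝓕 (M f) : LTwo d) = (𝓕 (schwartzMul m u)).toLp 2 volume + 𝓕 (M g) := by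
    rw [← SchwartzMap.toLp_fourier_eq, ← mulOp_toLp, ← FourierTransform.fourier_add, ← map_add,
      ← hfu]
  have e2 : (𝓕 u).toLp 2 volume = (𝓕 f : LTwo d) - 𝓕 g := by
    rw [← SchwartzMap.toLp_fourier_eq, hfu, FourierTransform.fourier_add, add_sub_cancel_right]
  have hu' : (fun η => ‖(𝓕 u) η‖ₑ) ≤ᵐ[volume]
      fun η => ‖(𝓕 f : LTwo d) η‖ₑ + ‖(𝓕 g : LTwo d) η‖ₑ := by
    filter_upwards [(𝓕 u).coeFn_toLp 2 volume, Lp.coeFn_sub (𝓕 f : LTwo d) (𝓕 g)] with η h1 h2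
    rw [← h1, e2, h2]
    exact enorm_sub_le
  filter_upwards [Lp.coeFn_add ((𝓕 (schwartzMul m u)).toLp 2 volume) (𝓕 (M g) : LTwo d),
    (𝓕 (schwartzMul m u)).coeFn_toLp 2 volume] with x h1 h2
  have hconv : lconvolution (fun η => ‖(𝓕 m) η‖ₑ) (fun η => ‖(𝓕 u) η‖ₑ) volume x ≤
      lconvolution (fun η => ‖(𝓕 m) η‖ₑ) (fun η => ‖(𝓕 f : LTwo d) η‖ₑ) volume x +
        lconvolution (fun η => ‖(𝓕 m) η‖ₑ) (fun η => ‖(𝓕 g : LTwo d) η‖ₑ) volume x := by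
    have hm : Measurable fun t => ‖(𝓕 m) t‖ₑ * ‖(𝓕 f : LTwo d) (-t + x)‖ₑ :=
      hkm.mul (measurable_comp_neg_add (measurable_enorm_coe _) x)
    unfold lconvolution
    rw [← lintegral_add_left hm]
    refine lintegral_mono_ae ?_
    have hq : Measure.QuasiMeasurePreserving (fun t : HorizSpace d => -t + x) volume volume := by
      have h := (Measure.measurePreserving_sub_left
        (volume : Measure (HorizSpace d)) x).quasiMeasurePreserving
      have he : (fun t : HorizSpace d => x - t) = fun t => -t + x := by
        ext1 t
        abel
      rwa [he] at h
    filter_upwards [hq.ae hu'] with t ht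
    rw [← mul_add]
    gcongr
  rw [e1, h1, Pi.add_apply, h2]
  calc ‖(𝓕 (schwartzMul m u)) x + (𝓕 (M g) : LTwo d) x‖ₑ
      ≤ ‖(𝓕 (schwartzMul m u)) x‖ₑ + ‖(𝓕 (M g) : LTwo d) x‖ₑ := enorm_add_le _ _
    _ ≤ (lconvolution (fun η => ‖(𝓕 m) η‖ₑ) (fun η => ‖(𝓕 f : LTwo d) η‖ₑ) volume x +
        lconvolution (fun η => ‖(𝓕 m) η‖ₑ) (fun η => ‖(𝓕 g : LTwo d) η‖ₑ) volume x) +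
          ‖(𝓕 (M g) : LTwo d) x‖ₑ := by
        gcongr
        exact (enorm_fourier_schwartzMul_le m u x).trans hconv
    _ = _ := by ring

theorem eLpNorm_coe_fourier (f : LTwo d) :
    eLpNorm (fun η => ‖(𝓕 f : LTwo d) η‖ₑ) 2 volume = ENNReal.ofReal ‖f‖ := by
  rw [eLpNorm_enorm, ← Lp.enorm_def, ← ofReal_norm, Lp.norm_fourier_eq]

/-- The convolution bound for the Fourier transform of the product of a Schwartz function and a
function in `L²`, by density of the Schwartz functions: the `L²` norm of the excess of the left
side over the right side is at most a multiple of the distance of `f` to any Schwartz function. -/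
theorem enorm_fourier_mulOp_le (m : 𝓢(HorizSpace d, ℂ)) (f : LTwo d) :
    ∀ᵐ x, ‖(𝓕 (mulOp m.toBoundedContinuousFunction f) : LTwo d) x‖ₑ ≤
      lconvolution (fun η => ‖(𝓕 m) η‖ₑ) (fun η => ‖(𝓕 f : LTwo d) η‖ₑ) volume x := by
  have hkm : Measurable fun η => ‖(𝓕 m) η‖ₑ := measurable_enorm_schwartz _
  set M := mulOp m.toBoundedContinuousFunction with hM
  set R : HorizSpace d → ℝ≥0∞ := fun x => ‖(𝓕 (M f) : LTwo d) x‖ₑ -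
    lconvolution (fun η => ‖(𝓕 m) η‖ₑ) (fun η => ‖(𝓕 f : LTwo d) η‖ₑ) volume x with hR
  have hRm : Measurable R := (measurable_enorm_coe _).sub
    (measurable_lconvolution _ hkm (measurable_enorm_coe _))
  set C : ℝ≥0∞ := ENNReal.ofReal ‖M‖ + ∫⁻ η, ‖(𝓕 m) η‖ₑ with hC
  have hCfin : C ≠ ⊤ := ENNReal.add_ne_top.2 ⟨ENNReal.ofReal_ne_top, (𝓕 m).integrable.2.ne⟩
  have hbound : ∀ u : 𝓢(HorizSpace d, ℂ),
      eLpNorm R 2 volume ≤ C * ENNReal.ofReal ‖f - u.toLp 2 volume‖ := fun u => by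
    set g : LTwo d := f - u.toLp 2 volume with hg
    have hae : ∀ᵐ x, ‖R x‖ₑ ≤ ‖((fun x => ‖(𝓕 (M g) : LTwo d) x‖ₑ) +
        lconvolution (fun η => ‖(𝓕 m) η‖ₑ) (fun η => ‖(𝓕 g : LTwo d) η‖ₑ) volume) x‖ₑ := by
      filter_upwards [enorm_fourier_mulOp_le_add m u f g (by rw [hg]; abel)] with x hx
      rw [enorm_eq_self, enorm_eq_self, Pi.add_apply]
      exact tsub_le_iff_right.2 hx
    refine (eLpNorm_mono_enorm_ae hae).trans ?_
    refine (eLpNorm_add_le (measurable_enorm_coe _).aestronglyMeasurable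
      (measurable_lconvolution _ hkm (measurable_enorm_coe _)).aestronglyMeasurable
      one_le_two).trans ?_
    rw [hC, add_mul]
    refine add_le_add ?_ ?_
    · rw [eLpNorm_coe_fourier, ← ENNReal.ofReal_mul (norm_nonneg _)]
      exact ENNReal.ofReal_le_ofReal (M.le_opNorm g)
    · refine (eLpNorm_lconvolution_le hkm (measurable_enorm_coe _)).trans ?_
      rw [eLpNorm_coe_fourier]
  have hzero : eLpNorm R 2 volume = 0 := by
    have hdense : DenseRange fun u : 𝓢(HorizSpace d, ℂ) => (u.toLp 2 volume : LTwo d) :=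
      SchwartzMap.denseRange_toLpCLM (E := HorizSpace d) (F := ℂ) (p := 2)
        (μ := volume) ENNReal.ofNat_ne_top
    have hcont : Continuous fun v : LTwo d => C * ENNReal.ofReal ‖f - v‖ := by
      refine ENNReal.continuous_const_mul hCfin |>.comp ?_
      exact ENNReal.continuous_ofReal.comp (by fun_prop)
    have hall : ∀ v : LTwo d, eLpNorm R 2 volume ≤ C * ENNReal.ofReal ‖f - v‖ := fun v =>
      hdense.induction_on v (isClosed_le continuous_const hcont) hbound
    have := hall f
    simpa using this
  rw [eLpNorm_eq_zero_iff hRm.aestronglyMeasurable two_ne_zero] at hzero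
  filter_upwards [hzero] with x hx
  exact tsub_eq_zero_iff_le.1 hx

/-! ### Multiplication by a Schwartz function on `H^s` -/

/-- Young's inequality with submultiplicative weights on both factors. -/
theorem eLpNorm_weight_mul_lconvolution_le_mul {s : ℝ} (hs : 0 ≤ s) {k g : HorizSpace d → ℝ≥0∞}
    (hk : Measurable k) (hg : Measurable g) :
    eLpNorm (fun x => sobolevEWeight s x * lconvolution k g volume x) 2 volume ≤
      ENNReal.ofReal (4 ^ (s / 2)) * 2 *
        ((∫⁻ x, sobolevEWeight s x * k x) *
          eLpNorm (fun x => sobolevEWeight s x * g x) 2 volume) := by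
  have hwk : Measurable fun x => sobolevEWeight s x * k x := (measurable_sobolevEWeight s).mul hk
  have hwg : Measurable fun x => sobolevEWeight s x * g x := (measurable_sobolevEWeight s).mul hg
  set c := ENNReal.ofReal (4 ^ (s / 2)) with hc
  have hcfin : c ≠ ⊤ := ENNReal.ofReal_ne_top
  have h1 : ∀ y : HorizSpace d, 1 ≤ sobolevEWeight s y := fun y =>
    (sobolevEWeight_zero y).symm.le.trans (sobolevEWeight_mono hs y)
  have hpt : ∀ x, sobolevEWeight s x * lconvolution k g volume x ≤
      c * 2 * lconvolution (fun x => sobolevEWeight s x * k x)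
        (fun x => sobolevEWeight s x * g x) volume x := fun x => by
    unfold lconvolution
    have hm : Measurable fun t => k t * g (-t + x) := hk.mul (measurable_comp_neg_add hg x)
    rw [← lintegral_const_mul _ hm,
      ← lintegral_const_mul' _ _ (ENNReal.mul_ne_top hcfin ENNReal.ofNat_ne_top)]
    refine lintegral_mono fun t => ?_
    calc sobolevEWeight s x * (k t * g (-t + x))
        ≤ c * (sobolevEWeight s t * 1 + 1 * sobolevEWeight s (-t + x)) * (k t * g (-t + x)) := by
          rw [mul_one, one_mul]
          gcongr
          exact sobolevEWeight_le_add hs x t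
      _ ≤ c * (sobolevEWeight s t * sobolevEWeight s (-t + x) +
            sobolevEWeight s t * sobolevEWeight s (-t + x)) * (k t * g (-t + x)) := by
          gcongr
          · exact h1 _
          · exact h1 _
      _ = _ := by ring
  have hm : Measurable (lconvolution (fun x => sobolevEWeight s x * k x)
      (fun x => sobolevEWeight s x * g x) volume) := measurable_lconvolution _ hwk hwg
  calc _ ≤ eLpNorm (fun x => c * 2 * lconvolution (fun x => sobolevEWeight s x * k x)
        (fun x => sobolevEWeight s x * g x) volume x) 2 volume :=
        eLpNorm_mono_enorm fun x => by simpa using hpt x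
    _ ≤ c * 2 * eLpNorm (lconvolution (fun x => sobolevEWeight s x * k x)
        (fun x => sobolevEWeight s x * g x) volume) 2 volume :=
        eLpNorm_le_mul_eLpNorm_of_ae_le_mul'' 2 hm.aestronglyMeasurable
          (.of_forall fun x => by simp)
    _ ≤ _ := by
        gcongr
        exact eLpNorm_lconvolution_le hwk hwg

/-- Multiplication by `m` is bounded on `H^s` by a multiple of the norm of `m` in `H^σ`,
`σ = max (t₀ + 2) s`. For `s ≤ 2` the Fourier transform of `m` is integrable against the weight of
order `s`; for `s > 2` the space `H^s` is an algebra, as `d / 2 ≤ 1`. -/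
theorem exists_sobolevBound_mulOp (hd : d ≤ 2) {s t₀ : ℝ} (hs : 0 ≤ s) (ht₀ : (d : ℝ) / 2 < t₀) :
    ∃ C : ℝ, 0 ≤ C ∧ ∀ m : 𝓢(HorizSpace d, ℂ), SobolevBound s
      (mulOp m.toBoundedContinuousFunction) (C * (sobolevNorm (max (t₀ + 2) s) m).toReal) := by
  set σ := max (t₀ + 2) s with hσ
  suffices h : ∃ C : ℝ≥0∞, C ≠ ⊤ ∧ ∀ (m : 𝓢(HorizSpace d, ℂ)) (f : LTwo d),
      eLpNorm (fun x => sobolevEWeight s x *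
        lconvolution (fun η => ‖(𝓕 m) η‖ₑ) (fun η => ‖(𝓕 f : LTwo d) η‖ₑ) volume x) 2 volume ≤
      C * sobolevNorm σ m * sobolevNorm s f by
    obtain ⟨C, hC, h⟩ := h
    refine ⟨C.toReal, ENNReal.toReal_nonneg, fun m f => ?_⟩
    rw [ENNReal.ofReal_mul ENNReal.toReal_nonneg, ENNReal.ofReal_toReal hC,
      ENNReal.ofReal_toReal (sobolevNorm_schwartz_lt_top σ m).ne, sobolevNorm_coe_eq_eLpNorm]
    refine le_trans (eLpNorm_mono_enorm_ae ?_) (h m f)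
    filter_upwards [enorm_fourier_mulOp_le m f] with x hx
    rw [enorm_eq_self, enorm_eq_self]
    gcongr
  have hk : ∀ m : 𝓢(HorizSpace d, ℂ), Measurable fun η => ‖(𝓕 m) η‖ₑ :=
    fun m => measurable_enorm_schwartz _
  have hg : ∀ f : LTwo d, Measurable fun η => ‖(𝓕 f : LTwo d) η‖ₑ :=
    fun f => measurable_enorm_coe _
  have hd' : (d : ℝ) / 2 ≤ 1 := by
    have : (d : ℝ) ≤ 2 := by exact_mod_cast hd
    linarith
  rcases le_or_gt s 2 with h2 | h2
  · refine ⟨ENNReal.ofReal (4 ^ (s / 2)) * 2 * eLpNorm (sobolevEWeight (d := d) (-t₀)) 2 volume,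
      ENNReal.mul_ne_top (ENNReal.mul_ne_top ENNReal.ofReal_ne_top ENNReal.ofNat_ne_top)
        (eLpNorm_sobolevEWeight_neg_lt_top ht₀).ne, fun m f => ?_⟩
    refine (eLpNorm_weight_mul_lconvolution_le_mul hs (hk m) (hg f)).trans ?_
    rw [← sobolevNorm_coe_eq_eLpNorm, ← mul_assoc]
    have hwk : Measurable fun η => sobolevEWeight s η * ‖(𝓕 m) η‖ₑ :=
      (measurable_sobolevEWeight s).mul (hk m)
    refine mul_le_mul_left ?_ _
    rw [mul_assoc (_ * 2)]
    refine mul_le_mul_right ((lintegral_le_mul_eLpNorm_weight t₀ hwk).trans ?_) _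
    gcongr
    have hmono : t₀ + s ≤ σ := (by linarith : t₀ + s ≤ t₀ + 2).trans (le_max_left _ _)
    refine le_trans (le_of_eq ?_) (sobolevNorm_mono hmono m)
    rw [sobolevNorm_schwartz_eq_eLpNorm]
    simp_rw [sobolevEWeight_add, mul_assoc]
  · have hsd : (d : ℝ) / 2 < s := by linarith
    have hsσ : s ≤ σ := le_max_right _ _
    have hW := (eLpNorm_sobolevEWeight_neg_lt_top (d := d) hsd).ne
    refine ⟨ENNReal.ofReal (4 ^ (s / 2)) * (2 * eLpNorm (sobolevEWeight (d := d) (-s)) 2 volume),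
      ENNReal.mul_ne_top ENNReal.ofReal_ne_top (ENNReal.mul_ne_top ENNReal.ofNat_ne_top hW),
      fun m f => ?_⟩
    refine (eLpNorm_weight_mul_lconvolution_le hs (hk m) (hg f)).trans ?_
    rw [← sobolevNorm_coe_eq_eLpNorm, ← sobolevNorm_schwartz_eq_eLpNorm]
    have e1 := lintegral_le_mul_eLpNorm_weight s (hg f)
    have e2 := lintegral_le_mul_eLpNorm_weight s (hk m)
    rw [← sobolevNorm_coe_eq_eLpNorm] at e1
    rw [← sobolevNorm_schwartz_eq_eLpNorm] at e2
    have e3 := sobolevNorm_mono hsσ m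
    set W := eLpNorm (sobolevEWeight (d := d) (-s)) 2 volume
    calc _ ≤ ENNReal.ofReal (4 ^ (s / 2)) * (W * sobolevNorm s f * sobolevNorm σ m +
          W * sobolevNorm σ m * sobolevNorm s f) := by
          gcongr
          exact e2.trans (by gcongr)
      _ = _ := by ring

/-- The norm of a square in `H^σ` gains from the `L²` norm: the weight falls on one factor, and the
Fourier transform of the other is integrated by interpolation between `L²` and `H^σ`. -/
theorem exists_sq_sobolevNorm_schwartzMul_self_le {σ : ℝ} (hσ : (d : ℝ) < σ) :
    ∃ C : ℝ, 0 ≤ C ∧ ∀ m : 𝓢(HorizSpace d, ℂ), (sobolevNorm σ (schwartzMul m m)).toReal ^ 2 ≤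
      C * (eLpNorm m 2 volume).toReal * (sobolevNorm σ m).toReal ^ 3 := by
  have hσ0 : 0 ≤ σ := (Nat.cast_nonneg d).trans hσ.le
  set c := ENNReal.ofReal (4 ^ (σ / 2)) with hc
  set W := eLpNorm (sobolevEWeight (d := d) (-(σ / 2))) 2 volume with hW
  have hWfin : W ≠ ⊤ := (eLpNorm_sobolevEWeight_neg_lt_top (by linarith)).ne
  refine ⟨((2 * c) ^ 2 * W ^ 2).toReal, ENNReal.toReal_nonneg, fun m => ?_⟩
  have hk : Measurable fun η => ‖(𝓕 m) η‖ₑ := measurable_enorm_schwartz _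
  have h1 : sobolevNorm σ (schwartzMul m m) ≤
      2 * c * ((∫⁻ η, ‖(𝓕 m) η‖ₑ) * sobolevNorm σ m) := by
    rw [sobolevNorm_schwartz_eq_eLpNorm]
    refine (eLpNorm_mono_enorm fun x => ?_).trans
      ((eLpNorm_weight_mul_lconvolution_le hσ0 hk hk).trans (le_of_eq ?_))
    · rw [enorm_eq_self, enorm_eq_self]
      gcongr
      exact enorm_fourier_schwartzMul_le m m x
    · rw [← sobolevNorm_schwartz_eq_eLpNorm]
      ring
  have h2 := sq_lintegral_le_mul_eLpNorm_mul_eLpNorm σ hk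
  rw [← eLpNorm_eq_eLpNorm_fourier, ← sobolevNorm_schwartz_eq_eLpNorm] at h2
  have h3 : sobolevNorm σ (schwartzMul m m) ^ 2 ≤
      (2 * c) ^ 2 * W ^ 2 * eLpNorm m 2 volume * sobolevNorm σ m ^ 3 := by
    calc _ ≤ (2 * c * ((∫⁻ η, ‖(𝓕 m) η‖ₑ) * sobolevNorm σ m)) ^ 2 := by gcongr
      _ = (2 * c) ^ 2 * ((∫⁻ η, ‖(𝓕 m) η‖ₑ) ^ 2 * sobolevNorm σ m ^ 2) := by ring
      _ ≤ (2 * c) ^ 2 * (W ^ 2 * (eLpNorm m 2 volume * sobolevNorm σ m) *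
          sobolevNorm σ m ^ 2) := by gcongr
      _ = _ := by ring
  have hfin : (2 * c) ^ 2 * W ^ 2 * eLpNorm m 2 volume * sobolevNorm σ m ^ 3 ≠ ⊤ := by
    refine ENNReal.mul_ne_top (ENNReal.mul_ne_top (ENNReal.mul_ne_top ?_ ?_) ?_) ?_
    · exact ENNReal.pow_ne_top (ENNReal.mul_ne_top ENNReal.ofNat_ne_top ENNReal.ofReal_ne_top)
    · exact ENNReal.pow_ne_top hWfin
    · exact (m.memLp 2 volume).2.ne
    · exact ENNReal.pow_ne_top (sobolevNorm_schwartz_lt_top σ m).ne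
  have h4 := ENNReal.toReal_mono hfin h3
  rwa [ENNReal.toReal_pow, ENNReal.toReal_mul, ENNReal.toReal_mul, ENNReal.toReal_pow] at h4

/-! ### Powers of a small function -/

/-- The iterated square `a ^ (2 ^ k)` as a Schwartz function. -/
noncomputable def schwartzIterSq (a : 𝓢(HorizSpace d, ℂ)) : ℕ → 𝓢(HorizSpace d, ℂ)
  | 0 => a
  | k + 1 => schwartzMul (schwartzIterSq a k) (schwartzIterSq a k)

theorem schwartzIterSq_apply (a : 𝓢(HorizSpace d, ℂ)) (k : ℕ) (x : HorizSpace d) :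
    schwartzIterSq a k x = a x ^ 2 ^ k := by
  induction k with
  | zero => simp [schwartzIterSq]
  | succ k ih => rw [schwartzIterSq, schwartzMul_apply, ih, ← pow_add, pow_succ, mul_two]

/-- One factor `a` is kept in `L²`, and the others are bounded by `ρ`. -/
theorem toReal_eLpNorm_schwartzIterSq_le {a : 𝓢(HorizSpace d, ℂ)} {ρ : ℝ} (hρ : 0 < ρ)
    (ha : ∀ x, ‖a x‖ ≤ ρ) (k : ℕ) :
    (eLpNorm (schwartzIterSq a k) 2 volume).toReal ≤
      ρ ^ 2 ^ k * ((eLpNorm a 2 volume).toReal / ρ) := by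
  have h : eLpNorm (schwartzIterSq a k) 2 volume ≤
      ENNReal.ofReal (ρ ^ 2 ^ k / ρ) * eLpNorm a 2 volume := by
    refine eLpNorm_le_mul_eLpNorm_of_ae_le_mul (.of_forall fun x => ?_) 2
    obtain ⟨n, hn⟩ : ∃ n, 2 ^ k = n + 1 := Nat.exists_eq_succ_of_ne_zero (by positivity)
    rw [schwartzIterSq_apply, hn, norm_pow, pow_succ, pow_succ, mul_div_cancel_right₀ _ hρ.ne']
    gcongr
    exact ha x
  have h2 := ENNReal.toReal_mono
    (ENNReal.mul_ne_top ENNReal.ofReal_ne_top (a.memLp 2 volume).2.ne) h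
  rw [ENNReal.toReal_mul, ENNReal.toReal_ofReal (by positivity)] at h2
  exact h2.trans_eq (by ring)

theorem SobolevBound.mulOp_pow {s A : ℝ} {m : HorizSpace d →ᵇ ℂ} (h : SobolevBound s (mulOp m) A)
    (hA : 0 ≤ A) (n : ℕ) : SobolevBound s (mulOp (m ^ n)) (A ^ n) := by
  induction n with
  | zero => simpa [mulOp_one] using sobolevBound_id s
  | succ n ih =>
    rw [pow_succ, pow_succ, mulOp_mul]
    exact ih.comp h (pow_nonneg hA n)

/-- A sequence with `x (k + 1) ^ 2 ≤ D * x k ^ 3` grows at most like `Y ^ (3 / 2) ^ k`, which is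
beaten by `q ^ 2 ^ k` for `q < 1`. -/
theorem exists_forall_mul_pow_le_one {D E R q : ℝ} (hq0 : 0 ≤ q) (hq : q < 1) :
    ∃ k : ℕ, ∀ x : ℕ → ℝ, (∀ k, 0 ≤ x k) → x 0 ≤ R → (∀ k, x (k + 1) ^ 2 ≤ D * x k ^ 3) →
      E * x k * q ^ 2 ^ k ≤ 1 := by
  set D' := max D 1 with hD'
  set E' := max E 1 with hE'
  set Y := max (D' * R) 1 with hY
  have hD1 : 1 ≤ D' := le_max_right _ _
  have hE1 : 1 ≤ E' := le_max_right _ _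
  have hY1 : 1 ≤ Y := le_max_right _ _
  have hlim : Tendsto (fun k : ℕ => (E' * Y) ^ ((3 / 4 : ℝ) ^ k) * q) atTop (𝓝 (1 * q)) := by
    refine Tendsto.mul_const q ?_
    have h0 : Tendsto (fun k : ℕ => (3 / 4 : ℝ) ^ k) atTop (𝓝 0) :=
      tendsto_pow_atTop_nhds_zero_of_lt_one (by norm_num) (by norm_num)
    have := (Real.continuousAt_const_rpow (a := E' * Y) (b := 0) (by positivity)).tendsto.comp h0
    rwa [Real.rpow_zero] at this
  rw [one_mul] at hlim
  obtain ⟨k, hk⟩ := (hlim.eventually (ge_mem_nhds hq)).exists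
  refine ⟨k, fun x hx0 hxR hx => ?_⟩
  have hgrow : ∀ j, D' * x j ≤ Y ^ ((3 / 2 : ℝ) ^ j) := fun j => by
    induction j with
    | zero =>
      rw [pow_zero, Real.rpow_one]
      exact (mul_le_mul_of_nonneg_left hxR (by positivity)).trans (le_max_left _ _)
    | succ j ih =>
      refine le_of_sq_le_sq ?_ (by positivity)
      calc (D' * x (j + 1)) ^ 2 = D' ^ 2 * x (j + 1) ^ 2 := by ring
        _ ≤ D' ^ 2 * (D' * x j ^ 3) := by
            have := hx0 j
            have h3 : D * x j ^ 3 ≤ D' * x j ^ 3 := by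
              gcongr
              exact le_max_left _ _
            gcongr
            exact (hx j).trans h3
        _ = (D' * x j) ^ 3 := by ring
        _ ≤ (Y ^ ((3 / 2 : ℝ) ^ j)) ^ 3 := by
            have := hx0 j
            gcongr
        _ = _ := by
            rw [← Real.rpow_mul_natCast (by positivity), ← Real.rpow_mul_natCast (by positivity),
              pow_succ]
            push_cast
            ring_nf
  have hxk : x k ≤ Y ^ ((3 / 2 : ℝ) ^ k) :=
    (le_mul_of_one_le_left (hx0 k) hD1).trans (hgrow k)
  have hE : E' ≤ E' ^ ((3 / 2 : ℝ) ^ k) :=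
    Real.self_le_rpow_of_one_le hE1 (one_le_pow₀ (by norm_num))
  calc E * x k * q ^ 2 ^ k ≤ E' ^ ((3 / 2 : ℝ) ^ k) * Y ^ ((3 / 2 : ℝ) ^ k) * q ^ 2 ^ k := by
        have := hx0 k
        gcongr
        exact (le_max_left E 1).trans hE
    _ = ((E' * Y) ^ ((3 / 4 : ℝ) ^ k) * q) ^ 2 ^ k := by
        rw [mul_pow, ← Real.mul_rpow (by positivity) (by positivity),
          ← Real.rpow_mul_natCast (by positivity)]
        push_cast
        rw [← mul_pow]
        norm_num
    _ ≤ 1 := pow_le_one₀ (by positivity) hk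

/-- The spectral radius of multiplication by `a` on `H^s` is controlled by `sup |a|` alone, in a
quantitative form: the powers of `a` decay geometrically in the algebra of bounded operators on
`H^s`, with constants that depend on `a` only through `ρ < 1` and a bound for the norm of `a` in
`H^σ`. -/
theorem exists_sobolevBound_mulOp_pow (hd : d ≤ 2) {s t₀ : ℝ} (hs : 0 ≤ s)
    (ht₀ : (d : ℝ) / 2 < t₀) {ρ : ℝ} (hρ0 : 0 < ρ) (hρ : ρ < 1) (R : ℝ) :
    ∃ K r : ℝ, 0 ≤ K ∧ 0 ≤ r ∧ r < 1 ∧ ∀ a : 𝓢(HorizSpace d, ℂ), (∀ x, ‖a x‖ ≤ ρ) →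
      (sobolevNorm (max (t₀ + 2) s) a).toReal ≤ R →
        ∀ n, SobolevBound s (mulOp (a.toBoundedContinuousFunction ^ n)) (K * r ^ n) := by
  obtain ⟨E, hE0, hE⟩ := exists_sobolevBound_mulOp hd hs ht₀
  set σ := max (t₀ + 2) s with hσ
  have hd' : (d : ℝ) ≤ 2 := by exact_mod_cast hd
  have hσ2 : t₀ + 2 ≤ σ := le_max_left _ _
  have hσ0 : 0 ≤ σ := hs.trans (le_max_right _ _)
  obtain ⟨C, hC0, hC⟩ := exists_sq_sobolevNorm_schwartzMul_self_le (d := d) (σ := σ) (by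
    have := Nat.cast_nonneg (α := ℝ) d
    linarith)
  set r := (1 + ρ) / 2 with hr
  have hr0 : 0 < r := by positivity
  have hr1 : r < 1 := by linarith
  have hρr : ρ < r := by linarith
  obtain ⟨k, hk⟩ := exists_forall_mul_pow_le_one (D := C * (R / ρ)) (E := E) (R := R / ρ)
    (q := ρ / r) (by positivity) ((div_lt_one hr0).2 hρr)
  set B := max (E * R) 1 with hB
  have hB1 : 1 ≤ B := le_max_right _ _
  -- for `n = 2 ^ k * i + j` with `j < 2 ^ k`, the factor `B ^ j` and the missing `r ^ j` are
  -- absorbed by the constant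
  refine ⟨B ^ 2 ^ k / r ^ 2 ^ k, r, by positivity, hr0.le, hr1, fun a ha haR n => ?_⟩
  have haL : (eLpNorm a 2 volume).toReal ≤ R := by
    refine le_trans (ENNReal.toReal_mono (sobolevNorm_schwartz_lt_top σ a).ne ?_) haR
    refine le_trans (le_of_eq ?_) (sobolevNorm_mono hσ0 a)
    rw [sobolevNorm_schwartz_eq_eLpNorm, eLpNorm_eq_eLpNorm_fourier]
    simp_rw [sobolevEWeight_zero, one_mul]
  have hpow : ∀ j, (schwartzIterSq a j).toBoundedContinuousFunction =
      a.toBoundedContinuousFunction ^ 2 ^ j := fun j => by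
    ext x
    exact schwartzIterSq_apply a j x
  -- the power of exponent `2 ^ k` has norm at most `r ^ 2 ^ k`
  have hbig : SobolevBound s (mulOp (a.toBoundedContinuousFunction ^ 2 ^ k)) (r ^ 2 ^ k) := by
    rw [← hpow]
    refine (hE _).mono ?_
    have h := hk (fun j => (sobolevNorm σ (schwartzIterSq a j)).toReal / ρ ^ 2 ^ j)
      (fun j => by positivity) ?_ fun j => ?_
    · rw [div_pow] at h
      rw [← div_le_one (by positivity)]
      refine le_trans (le_of_eq ?_) h
      field_simp
    · simp only [pow_zero, pow_one]
      gcongr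
      exact haR
    · have h1 := hC (schwartzIterSq a j)
      have h2 := toReal_eLpNorm_schwartzIterSq_le hρ0 ha j
      rw [div_pow, div_pow, mul_div_assoc', div_le_div_iff₀ (by positivity) (by positivity)]
      calc (sobolevNorm σ (schwartzIterSq a (j + 1))).toReal ^ 2 * (ρ ^ 2 ^ j) ^ 3
          ≤ C * (ρ ^ 2 ^ j * (R / ρ)) * (sobolevNorm σ (schwartzIterSq a j)).toReal ^ 3 *
            (ρ ^ 2 ^ j) ^ 3 := by
            gcongr
            refine h1.trans ?_
            gcongr
            refine h2.trans ?_
            gcongr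
        _ = _ := by
            rw [pow_succ 2 j, pow_mul]
            ring
  have hsmall : SobolevBound s (mulOp a.toBoundedContinuousFunction) B :=
    (hE a).mono ((mul_le_mul_of_nonneg_left haR hE0).trans (le_max_left _ _))
  have hn := Nat.div_add_mod n (2 ^ k)
  have hlt : n % 2 ^ k < 2 ^ k := Nat.mod_lt _ (by positivity)
  set i := n / 2 ^ k
  set j := n % 2 ^ k
  rw [← hn, pow_add, pow_mul, mulOp_mul]
  refine ((hbig.mulOp_pow (by positivity) i).comp (hsmall.mulOp_pow (by positivity) j)
    (by positivity)).mono ?_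
  rw [pow_add, pow_mul]
  have h1 : B ^ j ≤ B ^ 2 ^ k := pow_le_pow_right₀ hB1 hlt.le
  have h2 : r ^ 2 ^ k ≤ r ^ j := pow_le_pow_of_le_one hr0.le hr1.le hlt.le
  calc (r ^ 2 ^ k) ^ i * B ^ j ≤ (r ^ 2 ^ k) ^ i * B ^ 2 ^ k * 1 := by
        rw [mul_one]
        gcongr
    _ ≤ (r ^ 2 ^ k) ^ i * B ^ 2 ^ k * (r ^ j / r ^ 2 ^ k) := by
        gcongr
        rwa [one_le_div (by positivity)]
    _ = _ := by ring

/-! ### Bounded extensions of the operators -/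

theorem mulOp_smul (c : ℂ) (m : HorizSpace d →ᵇ ℂ) : mulOp (c • m) = c • mulOp m := by
  ext1 f
  refine Lp.ext ?_
  rw [_root_.smul_apply]
  filter_upwards [coeFn_mulOp (c • m) f, coeFn_mulOp m f, Lp.coeFn_smul c (mulOp m f)]
    with x h1 h2 h3
  rw [h1, h3, Pi.smul_apply, h2, BoundedContinuousFunction.smul_apply, smul_eq_mul, smul_eq_mul,
    mul_assoc]

theorem SobolevBound.smul {s A : ℝ} {T : LTwo d →L[ℂ] LTwo d} (h : SobolevBound s T A) (c : ℂ) :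
    SobolevBound s (c • T) (‖c‖ * A) := fun f => by
  rw [_root_.smul_apply, sobolevNorm_smul, ENNReal.ofReal_mul (norm_nonneg c),
    ofReal_norm, mul_assoc]
  gcongr
  exact h f

theorem abs_expansionMult_le_one {μ : ℝ} (hμ : 0 ≤ μ) (p n : ℕ) (ξ : HorizSpace d) :
    |expansionMult μ p n ξ| ≤ 1 := by
  match n with
  | 0 => exact abs_profileH_le_one (by positivity)
  | n + 1 => exact abs_profileG_le_one p n (by positivity)

/-- The multipliers of the expansion, in the Fourier variable `η = ξ / 2π`. -/
noncomputable def expansionMultBCF {μ : ℝ} (hμ : 0 ≤ μ) (p n : ℕ) : HorizSpace d →ᵇ ℂ :=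
  BoundedContinuousFunction.ofNormedAddCommGroup
    (fun η => (expansionMult μ p n ((2 * Real.pi) • η) : ℂ))
    (Complex.continuous_ofReal.comp ((contDiff_expansionMult hμ p n).continuous.comp
      (continuous_const_smul _))) 1
    fun η => by
      rw [Complex.norm_real]
      exact abs_expansionMult_le_one hμ p n _

theorem norm_expansionMultBCF_le_one {μ : ℝ} (hμ : 0 ≤ μ) (p n : ℕ) :
    ‖(expansionMultBCF hμ p n : HorizSpace d →ᵇ ℂ)‖ ≤ 1 :=
  BoundedContinuousFunction.norm_ofNormedAddCommGroup_le _ zero_le_one _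

/-- The series of products of multiplication operators and Fourier multipliers converges when the
powers of `a` decay geometrically both in the supremum norm and on `H^s`. -/
theorem extendsBoundedly_expansionSymbol {s μ ρ E K r : ℝ} (hμ : 0 ≤ μ) (hρ1 : ρ < 1)
    (hE : 0 ≤ E) (hK : 0 ≤ K) (hr0 : 0 ≤ r) (hr1 : r < 1) {a e₀ e : HorizSpace d → ℝ}
    {A c₀ c : HorizSpace d →ᵇ ℂ} (hA : ∀ X, A X = a X) (hc₀ : ∀ X, c₀ X = e₀ X)
    (hc : ∀ X, c X = e X) (hAρ : ‖A‖ ≤ ρ) (hc₀E : SobolevBound s (mulOp c₀) E)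
    (hcE : SobolevBound s (mulOp c) E) (hAK : ∀ n, SobolevBound s (mulOp (A ^ n)) (K * r ^ n))
    (j p : ℕ) :
    ExtendsBoundedly s (E + E * K * (1 - r)⁻¹) (expansionSymbol μ a e₀ e j p) := by
  have hρ0 : 0 ≤ ρ := (norm_nonneg A).trans hAρ
  set m : ℕ → HorizSpace d →ᵇ ℂ := fun n => n.casesOn c₀ fun n => c * A ^ (2 * (n + j)) with hm
  set g : ℕ → HorizSpace d →ᵇ ℂ := expansionMultBCF hμ p with hg
  have hg1 : ∀ n, ‖g n‖ ≤ 1 := norm_expansionMultBCF_le_one hμ p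
  have hexp : ∀ n, n ≤ 2 * (n + j) := fun n => by omega
  have hs : Summable fun n => ‖m n‖ * ‖g n‖ := by
    refine (summable_nat_add_iff 1).1 ?_
    refine .of_nonneg_of_le (fun n => by positivity) (fun n => ?_)
      ((summable_geometric_of_lt_one hρ0 hρ1).mul_left ‖c‖)
    calc ‖m (n + 1)‖ * ‖g (n + 1)‖ ≤ ‖m (n + 1)‖ :=
          mul_le_of_le_one_right (norm_nonneg _) (hg1 _)
      _ ≤ ‖c‖ * ‖A ^ (2 * (n + j))‖ := norm_mul_le _ _
      _ ≤ ‖c‖ * ρ ^ n := by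
          gcongr
          calc ‖A ^ (2 * (n + j))‖ ≤ ‖A‖ ^ (2 * (n + j)) := norm_pow_le _ _
            _ ≤ ρ ^ (2 * (n + j)) := by gcongr
            _ ≤ ρ ^ n := pow_le_pow_of_le_one hρ0 hρ1.le (hexp n)
  have hL : ∀ X η, (expansionSymbol μ a e₀ e j p X ((2 * Real.pi) • η) : ℂ) =
      ∑' n, m n X * g n η := fun X η => by
    rw [expansionSymbol, Complex.ofReal_tsum]
    refine tsum_congr fun n => ?_
    rw [Complex.ofReal_mul]
    congr 1
    cases n with
    | zero => exact (hc₀ X).symm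
    | succ n =>
      change _ = (c * A ^ (2 * (n + j))) X
      rw [BoundedContinuousFunction.mul_apply, BoundedContinuousFunction.pow_apply, hA, hc,
        expansionCoeff]
      push_cast
      rfl
  refine ⟨∑' n, mulOp (m n) ∘L fourierMultOp (g n),
    coeFn_tsum_mulOp_comp_fourierMultOp hs hL, ?_⟩
  set B : ℕ → ℝ := fun n => n.casesOn E fun n => E * K * r ^ n with hB
  have hB0 : ∀ n, 0 ≤ B n := fun n => by
    cases n with
    | zero => exact hE
    | succ n => change 0 ≤ E * K * r ^ n; positivity
  have hgeom := (hasSum_geometric_of_lt_one hr0 hr1).mul_left (E * K)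
  have hBs : Summable B := (summable_nat_add_iff (f := B) 1).1 hgeom.summable
  have hBt : ∑' n, B n = E + E * K * (1 - r)⁻¹ := by
    rw [hBs.tsum_eq_zero_add]
    exact congrArg (E + ·) hgeom.tsum_eq
  have hT : Summable fun n => mulOp (m n) ∘L fourierMultOp (g n) :=
    .of_norm_bounded hs fun n => (ContinuousLinearMap.opNorm_comp_le _ _).trans
      (mul_le_mul (norm_mulOp_le _) (norm_fourierMultOp_le _) (norm_nonneg _) (norm_nonneg _))
  rw [← hBt]
  refine SobolevBound.tsum (fun n => ?_) hT hBs hB0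
  have hmB : SobolevBound s (mulOp (m n)) (B n) := by
    cases n with
    | zero => exact hc₀E
    | succ n =>
      change SobolevBound s (mulOp (c * A ^ (2 * (n + j)))) (E * K * r ^ n)
      rw [mulOp_mul]
      refine (hcE.comp (hAK _) hE).mono ?_
      rw [mul_assoc]
      gcongr ?_ * (?_ * ?_)
      exact pow_le_pow_of_le_one hr0 hr1.le (hexp n)
  simpa using hmB.comp (sobolevBound_fourierMultOp s (hg1 n)) (hB0 n)

theorem sobolevNorm_const_mul (s : ℝ) (c : ℂ) {f : HorizSpace d → ℂ} {F : LTwo d}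
    (hf : F =ᵐ[volume] f) : sobolevNorm s (fun X => c * f X) = ‖c‖ₑ * sobolevNorm s f := by
  rw [← sobolevNorm_congr_ae s hf, ← sobolevNorm_smul]
  refine sobolevNorm_congr_ae s ?_
  filter_upwards [hf, Lp.coeFn_smul c F] with X h1 h2
  rw [h2, Pi.smul_apply, h1, smul_eq_mul]

/-- The bounds of the operators with symbols `L₁`, `L₂`, `L₃` and of their remainders depend on `b`
only through `ρ < 1` and a bound for the norm of `b` in `H^σ`. -/
theorem exists_extendsBoundedly (hd : d ≤ 2) {s t₀ : ℝ} (hs : 0 ≤ s) (ht₀ : (d : ℝ) / 2 < t₀)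
    {ρ : ℝ} (hρ0 : 0 < ρ) (hρ1 : ρ < 1) (R : ℝ) :
    ∃ M : ℝ, 0 ≤ M ∧ ∀ b : HorizSpace d → ℝ, ContDiff ℝ ∞ b → HasCompactSupport b →
      (sobolevNorm (max (t₀ + 2) s) (fun X => (b X : ℂ))).toReal ≤ R →
      ∀ μ, 0 ≤ μ → ∀ β ∈ Set.Icc (0 : ℝ) 1, (∀ X, β * |b X| ≤ ρ) →
        ExtendsBoundedly s M (symL1 μ β b) ∧ ExtendsBoundedly s M (symL2 μ β b) ∧
          ExtendsBoundedly s M (symL3 μ β b) ∧ ExtendsBoundedly s M (remainderSymbol μ β b) := by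
  obtain ⟨C, hC0, hC⟩ := exists_sobolevBound_mulOp hd hs ht₀
  obtain ⟨K, r, hK, hr0, hr1, hpow⟩ := exists_sobolevBound_mulOp_pow hd hs ht₀ hρ0 hρ1 R
  set σ := max (t₀ + 2) s with hσ
  set D := max (C * R) 1 with hD
  have hD1 : 1 ≤ D := le_max_right _ _
  set E := D ^ 5 with hE
  have hE1 : 1 ≤ E := one_le_pow₀ hD1
  have hE0 : 0 ≤ E := by positivity
  have hr1' : 0 < 1 - r := by linarith
  refine ⟨E + E * K * (1 - r)⁻¹, by positivity, fun b hb hbc hbR μ hμ β hβ hβρ => ?_⟩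
  set B : 𝓢(HorizSpace d, ℂ) := HasCompactSupport.toSchwartzMap (f := Complex.ofRealCLM ∘ b)
    (hbc.comp_left rfl) (by fun_prop) with hB
  have hBb : ∀ X, B X = b X := fun X => rfl
  have hBD : SobolevBound s (mulOp B.toBoundedContinuousFunction) D :=
    (hC B).mono ((mul_le_mul_of_nonneg_left hbR hC0).trans (le_max_left _ _))
  have hβ1 : ‖(β : ℂ)‖ ≤ 1 := by
    rw [Complex.norm_real, Real.norm_of_nonneg hβ.1]
    exact hβ.2
  set A : 𝓢(HorizSpace d, ℂ) := (β : ℂ) • B with hA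
  have hAX : ∀ X, A X = ((β * b X : ℝ) : ℂ) := fun X => by
    rw [hA, _root_.smul_apply, hBb, smul_eq_mul, Complex.ofReal_mul]
  have hAρ : ∀ X, ‖A X‖ ≤ ρ := fun X => by
    rw [hAX, Complex.norm_real, Real.norm_eq_abs, abs_mul, abs_of_nonneg hβ.1]
    exact hβρ X
  have hAR : (sobolevNorm σ A).toReal ≤ R := by
    have h : sobolevNorm σ A ≤ sobolevNorm σ B := by
      refine (sobolevNorm_const_mul σ (β : ℂ) (B.coeFn_toLp 2 volume)).trans_le ?_
      refine mul_le_of_le_one_left' ?_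
      rw [← ofReal_norm]
      exact ENNReal.ofReal_le_one.2 hβ1
    exact (ENNReal.toReal_mono (sobolevNorm_schwartz_lt_top σ B).ne h).trans hbR
  have hAK := hpow A hAρ hAR
  have hAn : ‖A.toBoundedContinuousFunction‖ ≤ ρ :=
    (BoundedContinuousFunction.norm_le hρ0.le).2 hAρ
  have hDE : D ≤ E := le_self_pow₀ hD1 (by norm_num)
  have key := fun {e₀ e : HorizSpace d → ℝ} {c₀ c : HorizSpace d →ᵇ ℂ}
      (h1 : ∀ X, c₀ X = e₀ X) (h2 : ∀ X, c X = e X) h3 h4 (j p : ℕ) =>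
    extendsBoundedly_expansionSymbol hμ hρ1 hE0 hK hr0 hr1 hAX h1 h2 hAn h3 h4 hAK j p
  have hone : SobolevBound s (mulOp (1 : HorizSpace d →ᵇ ℂ)) E := by
    rw [mulOp_one]
    exact (sobolevBound_id s).mono hE1
  have hscal : ∀ {c : ℂ} {m : HorizSpace d →ᵇ ℂ}, ‖c‖ ≤ 1 → SobolevBound s (mulOp m) E →
      SobolevBound s (mulOp (c • m)) E := fun hc hm => by
    rw [mulOp_smul]
    exact (hm.smul _).mono (mul_le_of_le_one_left hE0 hc)
  have hBE := hBD.mono hDE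
  have hB5 : SobolevBound s (mulOp (B.toBoundedContinuousFunction ^ 5)) E :=
    hBD.mulOp_pow (by positivity) 5
  have hneg : ‖(-1 : ℂ)‖ ≤ 1 := by simp
  have hzero : ‖(0 : ℂ)‖ ≤ 1 := by simp
  rw [symL1_eq_expansionSymbol hμ, symL2_eq_expansionSymbol hμ, symL3_eq_expansionSymbol hμ]
  refine ⟨key ?_ ?_ (hscal hzero hone) (hscal hneg hBE) 0 1,
    key ?_ ?_ (hscal hneg hBE) hBE 1 3,
    key ?_ ?_ hone (hscal hneg hone) 1 2,
    key ?_ ?_ (hscal hzero hone) hB5 0 5⟩ <;> intro X <;>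
  simp [hBb]

/-! ### Remainders -/

theorem ExtendsBoundedly.sobolevNorm_pseudoOp_le {s M : ℝ} {L : HorizSpace d → HorizSpace d → ℝ}
    (h : ExtendsBoundedly s M L) (u : 𝓢(HorizSpace d, ℂ)) :
    sobolevNorm s (pseudoOp L u) ≤ ENNReal.ofReal M * sobolevNorm s u := by
  obtain ⟨T, hT, hM⟩ := h
  rw [← sobolevNorm_congr_ae s (hT u), ← sobolevNorm_congr_ae s (u.coeFn_toLp 2 volume)]
  exact hM _

theorem ExtendsBoundedly.mono {s M M' : ℝ} {L : HorizSpace d → HorizSpace d → ℝ}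
    (h : ExtendsBoundedly s M L) (hM : M ≤ M') : ExtendsBoundedly s M' L := by
  obtain ⟨T, hT, hTM⟩ := h
  exact ⟨T, hT, fun f => (hTM f).trans (by gcongr)⟩

/-- The Schwartz function `|D|^(2j) u`. -/
theorem exists_fourier_eq_norm_pow_mul {s : ℝ} (j : ℕ) (u : 𝓢(HorizSpace d, ℂ)) :
    ∃ v : 𝓢(HorizSpace d, ℂ),
      (∀ η, (𝓕 v) η = ((‖(2 * Real.pi) • η‖ ^ (2 * j) : ℝ) : ℂ) * (𝓕 u) η) ∧
      sobolevNorm s v ≤ sobolevNorm (s + 2 * j) u := by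
  have hg : (fun η : HorizSpace d =>
      ((‖(2 * Real.pi) • η‖ ^ (2 * j) : ℝ) : ℂ)).HasTemperateGrowth := by
    have h1 : (fun η : HorizSpace d => ‖η‖ ^ 2).HasTemperateGrowth := by fun_prop
    have h2 : (fun η : HorizSpace d => (2 * Real.pi) • η).HasTemperateGrowth := by fun_prop
    have h3 : (fun η : HorizSpace d => (‖(2 * Real.pi) • η‖ ^ 2) ^ j).HasTemperateGrowth :=
      (h1.comp h2).pow j
    simp_rw [pow_mul]
    exact Complex.ofRealCLM.hasTemperateGrowth.comp h3
  set w := SchwartzMap.smulLeftCLM ℂ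
    (fun η : HorizSpace d => ((‖(2 * Real.pi) • η‖ ^ (2 * j) : ℝ) : ℂ)) (𝓕 u) with hw
  have hv : ∀ η, (𝓕 (𝓕⁻ w)) η = ((‖(2 * Real.pi) • η‖ ^ (2 * j) : ℝ) : ℂ) * (𝓕 u) η := fun η => by
    rw [fourier_fourierInv_eq, hw, SchwartzMap.smulLeftCLM_apply_apply hg, smul_eq_mul]
  refine ⟨𝓕⁻ w, hv, ?_⟩
  rw [sobolevNorm_schwartz, sobolevNorm_schwartz]
  refine eLpNorm_mono fun η => ?_
  rw [hv, sobolevWeight_add, norm_mul, norm_mul, norm_mul, Complex.ofReal_mul, norm_mul, mul_assoc]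
  gcongr
  rw [Complex.norm_real, Complex.norm_real, Real.norm_of_nonneg (by positivity),
    Real.norm_of_nonneg (sobolevWeight_pos _ _).le, sobolevWeight, mul_div_cancel_left₀ _ two_ne_zero,
    Real.rpow_natCast, pow_mul]
  gcongr
  linarith

/-- A factor `|ξ|^(2j)` in the symbol costs `2j` derivatives. -/
theorem sobolevNorm_pseudoOp_norm_pow_mul_le {s M : ℝ} {L : HorizSpace d → HorizSpace d → ℝ}
    (h : ExtendsBoundedly s M L) (c : ℝ) (j : ℕ) (u : 𝓢(HorizSpace d, ℂ)) :
    sobolevNorm s (pseudoOp (fun X ξ => c * (‖ξ‖ ^ (2 * j) * L X ξ)) u) ≤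
      ENNReal.ofReal (|c| * M) * sobolevNorm (s + 2 * j) u := by
  obtain ⟨v, hv, hvu⟩ := exists_fourier_eq_norm_pow_mul (s := s) j u
  have heq : pseudoOp (fun X ξ => c * (‖ξ‖ ^ (2 * j) * L X ξ)) u =
      fun X => (c : ℂ) * pseudoOp L v X := by
    ext X
    rw [pseudoOp, pseudoOp, Real.fourierInv_eq, Real.fourierInv_eq, ← integral_const_mul]
    refine integral_congr_ae (.of_forall fun η => ?_)
    simp only [hv, Circle.smul_def, smul_eq_mul]
    push_cast
    ring
  obtain ⟨T, hT, -⟩ := id h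
  rw [heq, sobolevNorm_const_mul s (c : ℂ) (hT v), ENNReal.ofReal_mul (abs_nonneg c), mul_assoc,
    ← ofReal_norm, Complex.norm_real, Real.norm_eq_abs]
  gcongr
  exact (h.sobolevNorm_pseudoOp_le v).trans (by gcongr)

theorem integrable_symbol_mul_fourier {g : HorizSpace d → ℝ} (hg : Continuous g) {C : ℝ}
    (hC : ∀ ξ, |g ξ| ≤ C) (u : 𝓢(HorizSpace d, ℂ)) :
    Integrable fun η : HorizSpace d => (g ((2 * Real.pi) • η) : ℂ) * (𝓕 u) η := by
  refine (𝓕 u).integrable.bdd_mul (c := C)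
    (Complex.continuous_ofReal.comp (hg.comp (continuous_const_smul _))).aestronglyMeasurable
    (.of_forall fun η => ?_)
  exact (Complex.norm_real _).trans_le (hC _)

theorem IsSymbolWith.integrable {K : ℕ → ℕ → ℝ} {L : HorizSpace d → HorizSpace d → ℝ}
    (h : IsSymbolWith 0 K L) (u : 𝓢(HorizSpace d, ℂ)) (X : HorizSpace d) :
    Integrable fun η : HorizSpace d => (L X ((2 * Real.pi) • η) : ℂ) * (𝓕 u) η :=
  integrable_symbol_mul_fourier (g := L X) (C := K 0 0)
    (h.1.continuous.comp (by fun_prop : Continuous fun ξ => (X, ξ)))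
    (fun ξ => by simpa using h.2 0 0 X ξ) u

/-- Linearity in the symbol, for perturbations by products `c₁(X) F(ξ) + c₂(X) G(ξ)`. -/
theorem pseudoOp_add_mul_fourierMult {L : HorizSpace d → HorizSpace d → ℝ}
    {F G : HorizSpace d → ℝ} (c₁ c₂ : HorizSpace d → ℝ) {u : 𝓢(HorizSpace d, ℂ)}
    {X : HorizSpace d}
    (hL : Integrable fun η : HorizSpace d => (L X ((2 * Real.pi) • η) : ℂ) * (𝓕 u) η)
    (hF : Integrable fun η : HorizSpace d => (F ((2 * Real.pi) • η) : ℂ) * (𝓕 u) η)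
    (hG : Integrable fun η : HorizSpace d => (G ((2 * Real.pi) • η) : ℂ) * (𝓕 u) η) :
    pseudoOp (fun X ξ => L X ξ + (c₁ X * F ξ + c₂ X * G ξ)) u X =
      pseudoOp L u X + (c₁ X * fourierMult F u X + c₂ X * fourierMult G u X) := by
  have hchar : ∀ {f : HorizSpace d → ℂ}, Integrable f →
      Integrable fun η => Real.fourierChar (inner ℝ η X) • f η := fun {f} hf =>
    ((Real.fourierIntegral_convergent_iff (-X)).2 hf).congr (.of_forall fun η => by simp)
  have hF' := (hchar hF).const_mul (c₁ X : ℂ)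
  have hG' := (hchar hG).const_mul (c₂ X : ℂ)
  have hFG : Integrable fun η =>
      (c₁ X : ℂ) * (Real.fourierChar (inner ℝ η X) • ((F ((2 * Real.pi) • η) : ℂ) * (𝓕 u) η)) +
      (c₂ X : ℂ) * (Real.fourierChar (inner ℝ η X) • ((G ((2 * Real.pi) • η) : ℂ) * (𝓕 u) η)) :=
    hF'.add hG'
  rw [fourierMult, fourierMult, pseudoOp, pseudoOp, pseudoOp, pseudoOp, Real.fourierInv_eq,
    Real.fourierInv_eq, Real.fourierInv_eq, Real.fourierInv_eq, ← integral_const_mul,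
    ← integral_const_mul, ← integral_add hF' hG', ← integral_add (hchar hL) hFG]
  refine integral_congr_ae (.of_forall fun η => ?_)
  simp only [Circle.smul_def, smul_eq_mul]
  push_cast
  ring

theorem fourierMult_one (u : 𝓢(HorizSpace d, ℂ)) (X : HorizSpace d) :
    fourierMult (fun _ => 1) u X = u X := by
  simp only [fourierMult, pseudoOp, Complex.ofReal_one, one_mul]
  rw [← SchwartzMap.fourierInv_coe, fourierInv_fourier_eq]

theorem continuous_symF3 (μ : ℝ) : Continuous (symF3 (d := d) μ) := by
  unfold symF3 sech
  exact continuous_const.div (Real.continuous_cosh.comp (by fun_prop)) fun ξ => (Real.cosh_pos _).ne'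

theorem abs_symF3_le_one (μ : ℝ) (ξ : HorizSpace d) : |symF3 μ ξ| ≤ 1 := by
  rw [symF3, sech, abs_of_pos (by have := Real.cosh_pos (√μ * ‖ξ‖); positivity)]
  exact (div_le_one (Real.cosh_pos _)).2 (Real.one_le_cosh _)

theorem integrable_symF3 (μ : ℝ) (u : 𝓢(HorizSpace d, ℂ)) :
    Integrable fun η : HorizSpace d => (symF3 μ ((2 * Real.pi) • η) : ℂ) * (𝓕 u) η :=
  integrable_symbol_mul_fourier (continuous_symF3 μ) (abs_symF3_le_one μ) u

theorem integrable_norm_sq_mul_symF3 (μ : ℝ) (u : 𝓢(HorizSpace d, ℂ)) :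
    Integrable fun η : HorizSpace d =>
      ((‖(2 * Real.pi) • η‖ ^ 2 * symF3 μ ((2 * Real.pi) • η) : ℝ) : ℂ) * (𝓕 u) η := by
  obtain ⟨v, hv, -⟩ := exists_fourier_eq_norm_pow_mul (s := 0) 1 u
  refine (integrable_symF3 μ v).congr (.of_forall fun η => ?_)
  beta_reduce
  rw [hv]
  push_cast
  ring

theorem integrable_symF4 {μ : ℝ} (hμ : 0 ≤ μ) (u : 𝓢(HorizSpace d, ℂ)) :
    Integrable fun η : HorizSpace d => (symF4 μ ((2 * Real.pi) • η) : ℂ) * (𝓕 u) η := by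
  have h : symF4 μ = fun ξ : HorizSpace d => 2 * expansionMult μ 0 0 ξ :=
    funext (symF4_eq_profileH hμ)
  refine integrable_symbol_mul_fourier (C := 2) ?_ (fun ξ => ?_) u
  · rw [h]
    exact continuous_const.mul (contDiff_expansionMult hμ 0 0).continuous
  · rw [h, abs_mul, abs_two]
    exact mul_le_of_le_one_right zero_le_two (abs_expansionMult_le_one hμ 0 0 ξ)

/-- The estimates of the remainders, whose symbols are products of a power of `|ξ|`, of `μ` and `β`,
and of a symbol bounded on `H^s`. -/
theorem sobolevNorm_pseudoOp_symL_le {s M μ β : ℝ} {b : HorizSpace d → ℝ} {K : ℕ → ℕ → ℝ}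
    (hμ : 0 ≤ μ) (hK1 : IsSymbolWith 0 K (symL1 μ β b))
    (hK2 : IsSymbolWith 0 K (symL2 μ β b)) (h2 : ExtendsBoundedly s M (symL2 μ β b))
    (hQ : ExtendsBoundedly s M (remainderSymbol μ β b)) (u : 𝓢(HorizSpace d, ℂ)) :
    sobolevNorm s (fun X => pseudoOp (symL1 μ β b) u X + (b X : ℂ) * u X)
        ≤ ENNReal.ofReal (μ * M) * sobolevNorm (s + 2) u ∧
      sobolevNorm s (fun X => pseudoOp (symL1 μ β b) u X -
          (-((b X : ℂ) * fourierMult (symF3 μ) u X) - ((μ * β ^ 2 / 6 * b X ^ 3 : ℝ) : ℂ) *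
            fourierMult (fun ξ => ‖ξ‖ ^ 2 * symF3 μ ξ) u X))
        ≤ ENNReal.ofReal (μ ^ 2 * β ^ 4 * M) * sobolevNorm (s + 4) u ∧
      sobolevNorm s (fun X => pseudoOp (symL2 μ β b) u X -
          (-((1 / 2 : ℂ) * (b X : ℂ) * fourierMult (symF4 μ) u X) +
            ((β ^ 2 / 6 * b X ^ 3 : ℝ) : ℂ) * fourierMult (symF3 μ) u X))
        ≤ ENNReal.ofReal (μ * β ^ 4 * M) * sobolevNorm (s + 2) u := by
  have hone : Integrable fun η : HorizSpace d => ((1 : ℝ) : ℂ) * (𝓕 u) η := by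
    simpa using (𝓕 u).integrable
  refine ⟨?_, ?_, ?_⟩
  · have h := sobolevNorm_pseudoOp_norm_pow_mul_le h2 (-μ) 1 u
    rw [abs_neg, abs_of_nonneg hμ, mul_one, Nat.cast_one, mul_one] at h
    refine le_trans (le_of_eq (congrArg _ (funext fun X => ?_))) h
    have hsym : (fun X ξ => -μ * (‖ξ‖ ^ 2 * symL2 μ β b X ξ)) =
        fun X ξ => symL1 μ β b X ξ + (b X * (fun _ => (1 : ℝ)) ξ + 0 * (fun _ => (1 : ℝ)) ξ) := by
      ext X ξ
      rw [← symL1_add_eq]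
      ring
    rw [hsym, pseudoOp_add_mul_fourierMult b (fun _ => 0) (hK1.integrable u X) hone hone,
      fourierMult_one]
    simp
  · have h := sobolevNorm_pseudoOp_norm_pow_mul_le hQ (-(μ ^ 2 * β ^ 4)) 2 u
    rw [abs_neg, abs_of_nonneg (by positivity)] at h
    norm_num only at h
    refine le_trans (le_of_eq (congrArg _ (funext fun X => ?_))) h
    have hsym : (fun X ξ => -(μ ^ 2 * β ^ 4) * (‖ξ‖ ^ 4 * remainderSymbol μ β b X ξ)) =
        fun X ξ => symL1 μ β b X ξ +
          (b X * symF3 μ ξ + μ * β ^ 2 / 6 * b X ^ 3 * (‖ξ‖ ^ 2 * symF3 μ ξ)) := by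
      ext X ξ
      rw [← symL1_sub_eq hμ]
      ring
    rw [hsym, pseudoOp_add_mul_fourierMult b (fun X => μ * β ^ 2 / 6 * b X ^ 3)
      (hK1.integrable u X) (integrable_symF3 μ u) (integrable_norm_sq_mul_symF3 μ u)]
    ring
  · have h := sobolevNorm_pseudoOp_norm_pow_mul_le hQ (μ * β ^ 4) 1 u
    rw [abs_of_nonneg (by positivity), mul_one, Nat.cast_one, mul_one] at h
    refine le_trans (le_of_eq (congrArg _ (funext fun X => ?_))) h
    have hsym : (fun X ξ => μ * β ^ 4 * (‖ξ‖ ^ 2 * remainderSymbol μ β b X ξ)) =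
        fun X ξ => symL2 μ β b X ξ +
          (1 / 2 * b X * symF4 μ ξ + -(β ^ 2 / 6 * b X ^ 3) * symF3 μ ξ) := by
      ext X ξ
      rw [← symL2_sub_eq hμ]
      ring
    rw [hsym, pseudoOp_add_mul_fourierMult (fun X => 1 / 2 * b X)
      (fun X => -(β ^ 2 / 6 * b X ^ 3)) (hK2.integrable u X) (integrable_symF4 hμ u)
      (integrable_symF3 μ u)]
    push_cast
    ring

/-- Constants indexed by integer bounds for two parameters are dominated by a monotone function of
the parameters. -/
theorem exists_monotone_forall_le {K : ℕ → ℕ → ℝ} (hK : ∀ i j, 0 ≤ K i j) :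
    ∃ C : ℝ × ℝ → ℝ, (∀ p, 0 < C p) ∧ Monotone C ∧ ∀ p, K ⌈p.1⌉₊ ⌈p.2⌉₊ ≤ C p := by
  refine ⟨fun p => 1 + ∑ i ∈ Finset.range (⌈p.1⌉₊ + 1), ∑ j ∈ Finset.range (⌈p.2⌉₊ + 1), K i j,
    fun p => ?_, fun p q hpq => ?_, fun p => ?_⟩
  · have := Finset.sum_nonneg fun i (_ : i ∈ Finset.range (⌈p.1⌉₊ + 1)) =>
      Finset.sum_nonneg fun j (_ : j ∈ Finset.range (⌈p.2⌉₊ + 1)) => hK i j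
    positivity
  · have h1 := Nat.ceil_mono hpq.1
    have h2 := Nat.ceil_mono hpq.2
    beta_reduce
    gcongr 1 + ?_
    refine (Finset.sum_le_sum_of_subset_of_nonneg (Finset.range_mono (Nat.succ_le_succ h1))
      fun i _ _ => Finset.sum_nonneg fun j _ => hK i j).trans ?_
    exact Finset.sum_le_sum fun i _ => Finset.sum_le_sum_of_subset_of_nonneg
      (Finset.range_mono (Nat.succ_le_succ h2)) fun j _ _ => hK i j
  · have h1 := Finset.single_le_sum (f := fun i => ∑ j ∈ Finset.range (⌈p.2⌉₊ + 1), K i j)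
      (fun i _ => Finset.sum_nonneg fun j _ => hK i j) (Finset.self_mem_range_succ ⌈p.1⌉₊)
    have h2 := Finset.single_le_sum (f := fun j => K ⌈p.1⌉₊ j)
      (fun j _ => hK _ j) (Finset.self_mem_range_succ ⌈p.2⌉₊)
    dsimp only at h1 h2 ⊢
    linarith

end WaterWaves

theorem mainTheorem7 (d : ℕ) (hd : d = 1 ∨ d = 2) (s t₀ : ℝ) (hs : 0 ≤ s)
    (ht₀ : (d : ℝ) / 2 < t₀) :
    -- The symbols are of order zero, with constants uniform in `μ` and `β`.
    (∀ (b : HorizSpace d → ℝ) (hmin : ℝ), ContDiff ℝ ∞ b → HasCompactSupport b →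
      0 < hmin → hmin < 1 →
      ∃ K : ℕ → ℕ → ℝ, ∀ μ ∈ Set.Icc (0 : ℝ) 1, ∀ β ∈ Set.Icc (0 : ℝ) 1,
        (∀ X, β * |b X| ≤ 1 - hmin) →
        WaterWaves.IsSymbolWith 0 K (WaterWaves.symL1 μ β b) ∧
        WaterWaves.IsSymbolWith 0 K (WaterWaves.symL2 μ β b) ∧
        WaterWaves.IsSymbolWith 0 K (WaterWaves.symL3 μ β b)) ∧
    -- Boundedness on `H^s` and expansions, with `M = C (1 / hmin, |b|_{H^{max(t₀ + 2, s)}})`.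
    ∃ C : ℝ × ℝ → ℝ, (∀ p, 0 < C p) ∧ Monotone C ∧
      ∀ (b : HorizSpace d → ℝ) (hmin : ℝ), ContDiff ℝ ∞ b → HasCompactSupport b →
        0 < hmin → hmin < 1 →
        ∀ μ ∈ Set.Icc (0 : ℝ) 1, ∀ β ∈ Set.Icc (0 : ℝ) 1,
        (∀ X, β * |b X| ≤ 1 - hmin) →
        ∀ M : ℝ, M = C (1 / hmin,
          (WaterWaves.sobolevNorm (max (t₀ + 2) s) (fun X => (b X : ℂ))).toReal) →
        (WaterWaves.ExtendsBoundedly s M (WaterWaves.symL1 μ β b) ∧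
          WaterWaves.ExtendsBoundedly s M (WaterWaves.symL2 μ β b) ∧
          WaterWaves.ExtendsBoundedly s M (WaterWaves.symL3 μ β b)) ∧
        ∀ u : 𝓢(HorizSpace d, ℂ),
          WaterWaves.sobolevNorm s (WaterWaves.pseudoOp (WaterWaves.symL1 μ β b) u)
            ≤ ENNReal.ofReal M * WaterWaves.sobolevNorm s u ∧
          WaterWaves.sobolevNorm s (WaterWaves.pseudoOp (WaterWaves.symL2 μ β b) u)
            ≤ ENNReal.ofReal M * WaterWaves.sobolevNorm s u ∧
          WaterWaves.sobolevNorm s (WaterWaves.pseudoOp (WaterWaves.symL3 μ β b) u)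
            ≤ ENNReal.ofReal M * WaterWaves.sobolevNorm s u ∧
          WaterWaves.sobolevNorm s (fun X =>
              WaterWaves.pseudoOp (WaterWaves.symL1 μ β b) u X + (b X : ℂ) * u X)
            ≤ ENNReal.ofReal (μ * M) * WaterWaves.sobolevNorm (s + 2) u ∧
          WaterWaves.sobolevNorm s (fun X =>
              WaterWaves.pseudoOp (WaterWaves.symL1 μ β b) u X -
                (-((b X : ℂ) * WaterWaves.fourierMult (WaterWaves.symF3 μ) u X) -
                  ((μ * β ^ 2 / 6 * b X ^ 3 : ℝ) : ℂ) *
                    WaterWaves.fourierMult (fun ξ => ‖ξ‖ ^ 2 * WaterWaves.symF3 μ ξ) u X))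
            ≤ ENNReal.ofReal (μ ^ 2 * β ^ 4 * M) * WaterWaves.sobolevNorm (s + 4) u ∧
          WaterWaves.sobolevNorm s (fun X =>
              WaterWaves.pseudoOp (WaterWaves.symL2 μ β b) u X -
                (-((1 / 2 : ℂ) * (b X : ℂ) * WaterWaves.fourierMult (WaterWaves.symF4 μ) u X) +
                  ((β ^ 2 / 6 * b X ^ 3 : ℝ) : ℂ) *
                    WaterWaves.fourierMult (WaterWaves.symF3 μ) u X))
            ≤ ENNReal.ofReal (μ * β ^ 4 * M) * WaterWaves.sobolevNorm (s + 2) u := by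
  refine ⟨fun b hmin hb hbc h0 h1 => WaterWaves.exists_isSymbolWith_symL hb hbc h0 h1, ?_⟩
  have hd2 : d ≤ 2 := by omega
  -- the constant for `1 / hmin ≤ i` and `|b| ≤ j`: then `1 - hmin ≤ (i + 1) / (i + 2)`
  choose K hK0 hK using fun i j : ℕ =>
    WaterWaves.exists_extendsBoundedly hd2 hs ht₀ (ρ := (i + 1) / (i + 2)) (by positivity)
      ((div_lt_one (by positivity)).2 (by linarith)) j
  obtain ⟨C, hCpos, hCmono, hC⟩ := WaterWaves.exists_monotone_forall_le hK0
  refine ⟨C, hCpos, hCmono, fun b hmin hb hbc h0 h1 μ hμ β hβ hle M hM => ?_⟩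
  have hρ : 1 - hmin ≤ ((⌈1 / hmin⌉₊ : ℝ) + 1) / (⌈1 / hmin⌉₊ + 2) := by
    have hi : 1 ≤ (⌈1 / hmin⌉₊ : ℝ) * hmin := (div_le_iff₀ h0).1 (Nat.le_ceil _)
    rw [le_div_iff₀ (by positivity)]
    linarith
  have hKM := (hC (1 / hmin, _)).trans_eq hM.symm
  obtain ⟨h1', h2', h3', hQ'⟩ :=
    hK _ _ b hb hbc (Nat.le_ceil _) μ hμ.1 β hβ fun X => (hle X).trans hρ
  have hL1 := h1'.mono hKM
  have hL2 := h2'.mono hKM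
  have hL3 := h3'.mono hKM
  have hQ := hQ'.mono hKM
  obtain ⟨S, hS⟩ := WaterWaves.exists_isSymbolWith_symL hb hbc h0 h1
  obtain ⟨hS1, hS2, -⟩ := hS μ hμ β hβ hle
  exact ⟨⟨hL1, hL2, hL3⟩, fun u => ⟨hL1.sobolevNorm_pseudoOp_le u, hL2.sobolevNorm_pseudoOp_le u,
    hL3.sobolevNorm_pseudoOp_le u,
    WaterWaves.sobolevNorm_pseudoOp_symL_le hμ.1 hS1 hS2 hL2 hQ u⟩⟩
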